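/- **Setting.** Let $k$ be a field of characteristic $0$, let $(\mathfrak g=\bigoplus_{i\in\mathbb Z}\mathfrak g^i,d,[\,,])$ be a differential graded Lie algebra over $k$, and let $\eta:\mathfrak g\to\mathfrak g[-1]$ be any linear map of degree $-1$. Define $\mu_1=d$, $\mu_2(v_1,v_2)=(d\eta+\eta d)[v_1,v_2]$ and, for $n\ge 3$, $$\mu_n(v_1,\dots,v_n)=(-1)^n\sum_{\sigma\in Sh(n-1,n)}(-1)^{\tilde\sigma}e(\sigma)\,\eta\big[\mu_{n-1}(v_{\sigma(1)},\dots,v_{\sigma(n-1)}),v_{\sigma(n)}\big],$$ where $Sh(n-1,n)$ is the set of permutations with $\sigma(1)<\dots<\sigma(n-1)$ and $(-1)^{\tilde\sigma}e(\sigma)$ is the sign in $v_{\sigma(1)}\wedge\dots\wedge v_{\sigma(n)}=(-1)^{\tilde\sigma}e(\sigma)\,v_1\wedge\dots\wedge v_n$. A graded Artin $k$-local algebra is a finite-dimensional $\mathbb Z$-graded, graded commutative, unital local $k$-algebra $\mathcal B$ with residue field $k$ and (nilpotent) maximal ideal $m_{\mathcal B}$; morphisms are degree-preserving homomorphisms of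 unital algebras. Extend $d$, $[\,,]$, $\eta$, $\mu_*$ to $\mathfrak g\otimes m_{\mathcal B}$, with its total grading, by the usual sign rule. Let $MC(\mathfrak g\otimes m_{\mathcal B})$ be the set of $\Gamma\in(\mathfrak g\otimes m_{\mathcal B})^1$ with $\sum_{n\ge1}\frac{(-1)^{n(n+1)/2}}{n!}\mu_n(\Gamma,\dots,\Gamma)=0$. For such $\Gamma$ put $d_\Gamma\xi=-\sum_{n\ge1}\frac{(-1)^{n(n+1)/2}}{(n-1)!}\mu_n(\Gamma,\dots,\Gamma,\xi)$. Gauge equivalence is the equivalence relation on $MC(\mathfrak g\otimes m_{\mathcal B})$ generated by $\Gamma(0)\sim\Gamma(1)$ for all polynomial paths $\Gamma(t)\in MC(\mathfrak g\otimes m_{\mathcal B})$ with $\Gamma'(t)=d_{\Gamma(t)}\xi(t)$ for some polynomial $\xi(t)$ with values in $(\mathfrak g\otimes m_{\mathcal B})^0$. Let $\mathrm{MDef}^{\mathbb Z}_{\mathfrak g}$ be the functor $\mathcal B\mapsto MC(\mathfrak g\otimes m_{\mathcal B})/\text{gauge equivalence}$ from graded Artin $k$-local algebras to sets. Let $\mathrm{MDef}^{0}_{\mathfrak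 g}$ be its restriction to algebras concentrated in degree $0$, or, for a complement $C$ of $d\mathfrak g^0$ in $\mathfrak g^1$, the functor $\mathcal B\mapsto MC(\mathfrak g\otimes m_{\mathcal B})\cap(C\otimes m_{\mathcal B})$ on such algebras. For a graded vector space $V$ with a homogeneous basis, $k[[t_V]]$ denotes the algebra of formal power series in graded commuting coordinates $t^\alpha$ dual to the basis (of degree $-j$ for a basis vector of degree $j$), with the topology of coefficientwise convergence. A functor is pro-represented by $k[[t_V]]$ if it is naturally isomorphic to the functor of continuous, degree-preserving, local $k$-algebra homomorphisms $k[[t_V]]\to\mathcal B$, where $\mathcal B$ is discrete. **Corollary 3.3.** (1) The functor $\mathrm{MDef}^{\mathbb Z}_{\mathfrak g}$ is naturally isomorphic to the linear functor $$\mathcal B\longmapsto\{\Gamma\in(\mathfrak g\otimes m_{\mathcal B})^1\mid d\Gamma=0\}\,/\,d\big((\mathfrak g\otimes m_{\mathcal B})^0\big).$$ (2) Both functors are pro-represented by the algebra $k[[t_{\mathbf H^*}]]$ of formal power series on the shifted cohomology $\mathbf H^*=H^*(\mathfrak g,d)[1]$ (a basis class in $H^i(\mathfrak g)$ has a coordinate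 of degree $1-i$), for every choice of bases of the spaces $H^i(\mathfrak g)$. So $\mathrm{MDef}^{\mathbb Z}_{\mathfrak g}$ is pro-representable by a smooth formal pointed supermanifold. If $H^*(\mathfrak g)$ is finite-dimensional, then, for every real absolute value on $k$ (such as the usual one for $k=\mathbb R,\mathbb C$), this algebra is the completion, at its maximal ideal, of the algebra of convergent power series, that is, of the analytic germ $\mathcal O_0$ of $(\mathbf H^*,0)$. (3) The functor $\mathrm{MDef}^0_{\mathfrak g}$, in the gauge form and in the form given by any complement $C$, is pro-represented by the algebra of formal power series on $H^1(\mathfrak g)$, with coordinates of degree $0$. -/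

import Mathlib

open CategoryTheory TensorProduct

set_option linter.unusedSectionVars false
set_option linter.unnecessarySeqFocus false

universe u v

namespace FormalDef

noncomputable section

/-! ### Signs, graded vector spaces, differential graded Lie algebras -/

/-- The sign `(-1)ⁿ`, as an element of `k`. -/
def sgn (k : Type*) [Field k] (n : ℤ) : k := ((n.negOnePow : ℤ) : k)

/-- The linear operator on a graded vector space which multiplies the component of degree `i`
by the scalar `c i`. -/
def scaleDeg {k : Type*} [Field k] {G : Type*} [AddCommGroup G] [Module k G]
    (𝒢 : ℤ → Submodule k G) [DirectSum.Decomposition 𝒢] (c : ℤ → k) : G →ₗ[k] G :=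
  DirectSum.toModule k ℤ G (fun i => c i • (𝒢 i).subtype) ∘ₗ
    (DirectSum.decomposeLinearEquiv 𝒢).toLinearMap

/-- A differential graded Lie algebra over `k`, on the graded vector space `G = ⨁ 𝒢 i`:
a differential of degree `1` and a graded skew-symmetric bracket of degree `0`, with the Leibniz
rule and the graded Jacobi identity (`char k = 0` in all uses). -/
structure DGLA {k : Type u} [Field k] {G : Type v} [AddCommGroup G] [Module k G]
    (𝒢 : ℤ → Submodule k G) where
  d : G →ₗ[k] G
  br : G →ₗ[k] G →ₗ[k] G
  d_mem : ∀ i, ∀ x ∈ 𝒢 i, d x ∈ 𝒢 (i + 1)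
  d_d : ∀ x, d (d x) = 0
  br_mem : ∀ i j, ∀ x ∈ 𝒢 i, ∀ y ∈ 𝒢 j, br x y ∈ 𝒢 (i + j)
  skew : ∀ i j, ∀ x ∈ 𝒢 i, ∀ y ∈ 𝒢 j, br x y = -(sgn k (i * j) • br y x)
  leibniz : ∀ i, ∀ x ∈ 𝒢 i, ∀ y, d (br x y) = br (d x) y + sgn k i • br x (d y)
  jacobi : ∀ i j l, ∀ x ∈ 𝒢 i, ∀ y ∈ 𝒢 j, ∀ z ∈ 𝒢 l,
    br (br x y) z + sgn k ((i + j) * l) • br (br z x) y + sgn k (i * (j + l)) • br (br y z) x = 0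

namespace DGLA

variable {k : Type u} [Field k] {G : Type v} [AddCommGroup G] [Module k G]
  {𝒢 : ℤ → Submodule k G}

/-- Cocycles of degree `i`. -/
def cocycles (A : DGLA 𝒢) (i : ℤ) : Submodule k G := LinearMap.ker A.d ⊓ 𝒢 i

/-- The cohomology `Hⁱ(𝔤, d)`. -/
abbrev coh (A : DGLA 𝒢) (i : ℤ) : Type v :=
  ↥(A.cocycles i) ⧸ ((𝒢 (i - 1)).map A.d).submoduleOf (A.cocycles i)

/-- The degrees of the linear coordinates on `H^*(𝔤)[1]` given by bases of the spaces `Hⁱ(𝔤)`: a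
basis class in `Hⁱ(𝔤)` has degree `i - 1` in `H^*(𝔤)[1]`, and its coordinate has degree `1 - i`. -/
def coordDeg (ι : ℤ → Type*) (a : Σ i, ι i) : ℤ := 1 - a.1

end DGLA

/-! ### The higher brackets -/

section Mu

variable {k : Type*} [Field k] {L : Type*} [AddCommGroup L] [Module k L]

/-- The higher brackets built from a differential `d`, a bracket `br` and an operator `η` of
degree `-1`. `mu d η br n p v` is `μ_{n+1}(v₀, …, vₙ)` for homogeneous `vᵢ` of degree `pᵢ`:
* `μ₁ v = d v`,
* `μ₂ (v, w) = (d η + η d) [v, w]`,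
* `μ_N (v₁, …, v_N) = (-1)^N ∑_σ (-1)^σ e(σ) η [μ_{N-1}(v_{σ 1}, …, v_{σ (N-1)}), v_{σ N}]`
  for `N ≥ 3`, the sum being over the `(N-1, 1)`-shuffles.
Such a shuffle is determined by `i = σ N`; its sign `(-1)^σ e(σ)`, that of moving `vᵢ` to the end
of the wedge product `v₁ ∧ ⋯ ∧ v_N`, is `∏_{j > i} (-(-1)^{pᵢ pⱼ})`. -/
def mu (d η : L →ₗ[k] L) (br : L →ₗ[k] L →ₗ[k] L) :
    (n : ℕ) → (Fin (n + 1) → ℤ) → (Fin (n + 1) → L) → L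
  | 0, _, v => d (v 0)
  | 1, _, v => d (η (br (v 0) (v 1))) + η (d (br (v 0) (v 1)))
  | n + 2, p, v => (-1 : k) ^ (n + 3) • ∑ i : Fin (n + 3),
      (∏ j ∈ Finset.Ioi i, -sgn k (p i * p j)) •
        η (br (mu d η br (n + 1) (fun j => p (i.succAbove j)) (fun j => v (i.succAbove j))) (v i))

/-- `SumsTo a s`: the series `∑ a n` has all but finitely many partial sums equal to `s`
(convergence in the discrete topology). All series below are eventually zero, because the maximal
ideal of an Artin algebra is nilpotent. -/
def SumsTo (a : ℕ → L) (s : L) : Prop :=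
  ∀ᶠ N in Filter.atTop, ∑ n ∈ Finset.range N, a n = s

/-- The terms `(-1)^{N(N+1)/2} / N! • μ_N(Γ, …, Γ)`, `N = n + 1`, of the Maurer-Cartan equation,
for `Γ` of degree `1`. -/
def mcTerm (d η : L →ₗ[k] L) (br : L →ₗ[k] L →ₗ[k] L) (Γ : L) (n : ℕ) : L :=
  ((-1 : k) ^ ((n + 1) * (n + 2) / 2) / ((n + 1).factorial : k)) •
    mu d η br n (fun _ => 1) (fun _ => Γ)

/-- The terms `-(-1)^{N(N+1)/2} / (N-1)! • μ_N(Γ, …, Γ, ξ)`, `N = n + 1`, of the `Γ`-deformed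
differential `d_Γ ξ`, for `Γ` of degree `1` and `ξ` of degree `0`. -/
def twTerm (d η : L →ₗ[k] L) (br : L →ₗ[k] L →ₗ[k] L) (Γ ξ : L) (n : ℕ) : L :=
  (-((-1 : k) ^ ((n + 1) * (n + 2) / 2) / (n.factorial : k))) •
    mu d η br n (Fin.snoc (α := fun _ => ℤ) (fun _ => 1) 0)
      (Fin.snoc (α := fun _ => L) (fun _ => Γ) ξ)

/-- The value at `t` of a polynomial path with coefficients in `L`. -/
def pathEval (c : ℕ →₀ L) (t : k) : L := c.sum fun j x => t ^ j • x

/-- The value at `t` of the derivative of a polynomial path with coefficients in `L`. -/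
def pathDeriv (c : ℕ →₀ L) (t : k) : L := c.sum fun j x => ((j : k) * t ^ (j - 1)) • x

end Mu

/-! ### Graded Artin local algebras -/

/-- A `ℤ`-graded Artin `k`-local algebra: a finite-dimensional, `ℤ`-graded, graded commutative
unital `k`-algebra, local with residue field `k`. The last condition is expressed by the (unique)
homomorphism to the residue field `k`, whose kernel, the maximal ideal, is nilpotent. -/
structure GrArt (k : Type u) [Field k] where
  carrier : Type u
  [ring : Ring carrier]
  [algebra : Algebra k carrier]
  gr : ℤ → Submodule k carrier
  [graded : GradedAlgebra gr]
  [finite : Module.Finite k carrier]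
  comm : ∀ i j, ∀ a ∈ gr i, ∀ b ∈ gr j, a * b = sgn k (i * j) • (b * a)
  aug : carrier →ₐ[k] k
  nilp : ∃ n : ℕ, (LinearMap.ker aug.toLinearMap) ^ n = ⊥

attribute [instance] GrArt.ring GrArt.algebra GrArt.graded GrArt.finite

variable {k : Type u} [Field k]

/-- The maximal ideal `m_B`, as a subspace. -/
def GrArt.m (B : GrArt k) : Submodule k B.carrier := LinearMap.ker B.aug.toLinearMap

instance : Category.{u} (GrArt k) where
  Hom B B' := B.gr →ₐᵍ[k] B'.gr
  id B := GradedAlgHom.id k B.gr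
  comp f g := GradedAlgHom.comp g f

/-- The underlying algebra homomorphism of a morphism of graded Artin algebras. -/
def GrArt.hom {B B' : GrArt k} (f : B ⟶ B') : B.carrier →ₐ[k] B'.carrier :=
  GradedAlgHom.toAlgHom (𝒜 := B.gr) (ℬ := B'.gr) f

theorem GrArt.hom_id (B : GrArt k) : GrArt.hom (𝟙 B) = AlgHom.id k B.carrier := rfl

theorem GrArt.hom_comp {B B' B'' : GrArt k} (f : B ⟶ B') (g : B' ⟶ B'') :
    GrArt.hom (f ≫ g) = (GrArt.hom g).comp (GrArt.hom f) := rfl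

theorem GrArt.hom_gr {B B' : GrArt k} (f : B ⟶ B') {i : ℤ} {b : B.carrier} (hb : b ∈ B.gr i) :
    GrArt.hom f b ∈ B'.gr i :=
  GradedAlgHom.map_mem f hb

theorem GrArt.isNilpotent_of_mem {B : GrArt k} {b : B.carrier} (hb : b ∈ B.m) :
    IsNilpotent b := by
  obtain ⟨n, hn⟩ := B.nilp
  refine ⟨n, ?_⟩
  have h : b ^ n ∈ (LinearMap.ker B.aug.toLinearMap) ^ n := Submodule.pow_mem_pow _ hb n
  rw [hn] at h
  simpa using h

theorem GrArt.hom_m {B B' : GrArt k} (f : B ⟶ B') {b : B.carrier} (hb : b ∈ B.m) :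
    GrArt.hom f b ∈ B'.m := by
  have h : IsNilpotent (B'.aug (GrArt.hom f b)) :=
    ((GrArt.isNilpotent_of_mem hb).map (GrArt.hom f)).map B'.aug
  simpa [GrArt.m] using h.eq_zero

/-- Artin algebras concentrated in degree zero (ordinary commutative Artin local `k`-algebras). -/
def concentrated (k : Type u) [Field k] : ObjectProperty (GrArt k) := fun B => B.gr 0 = ⊤

/-! ### The deformation functors -/

section Functors

variable {G : Type v} [AddCommGroup G] [Module k G] {𝒢 : ℤ → Submodule k G}

/-- `(𝔤 ⊗ m_B)ⁿ`, the part of total degree `n`, as a subspace of `𝔤 ⊗ B`. -/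
def totDeg (𝒢 : ℤ → Submodule k G) (B : GrArt k) (n : ℤ) : Submodule k (G ⊗[k] B.carrier) :=
  Submodule.span k {z | ∃ i j : ℤ, i + j = n ∧ ∃ x ∈ 𝒢 i, ∃ b ∈ B.gr j, b ∈ B.m ∧ z = x ⊗ₜ[k] b}

/-- `C ⊗ m_B`, as a subspace of `𝔤 ⊗ B`. -/
def tensorM (C : Submodule k G) (B : GrArt k) : Submodule k (G ⊗[k] B.carrier) :=
  Submodule.span k {z | ∃ x ∈ C, ∃ b ∈ B.m, z = x ⊗ₜ[k] b}

/-- The map `𝔤 ⊗ B → 𝔤 ⊗ B'` induced by a morphism `B → B'`. -/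
def tmap (G : Type v) [AddCommGroup G] [Module k G] {B B' : GrArt k} (f : B ⟶ B') :
    G ⊗[k] B.carrier →ₗ[k] G ⊗[k] B'.carrier :=
  (GrArt.hom f).toLinearMap.lTensor G

/-- The differential `d ⊗ 1` of `𝔤 ⊗ B`. -/
def DGLA.dT (A : DGLA 𝒢) (B : GrArt k) : G ⊗[k] B.carrier →ₗ[k] G ⊗[k] B.carrier :=
  A.d.rTensor B.carrier

/-- The operator `η ⊗ 1` on `𝔤 ⊗ B`. -/
def opT (η : G →ₗ[k] G) (B : GrArt k) : G ⊗[k] B.carrier →ₗ[k] G ⊗[k] B.carrier :=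
  η.rTensor B.carrier

variable [DirectSum.Decomposition 𝒢]

/-- The bracket of the differential graded Lie algebra `𝔤 ⊗ B`:
`[x ⊗ a, y ⊗ b] = (-1)^{|a| |y|} [x, y] ⊗ a b`. The two summands take care of the components of
even and of odd degree of the element `a`. As `d`, `η` and the bracket of `𝔤 ⊗ B` are obtained from
those of `𝔤` by extension of scalars (with the usual Koszul signs), so are the `μ_n`. -/
def DGLA.brT (A : DGLA 𝒢) (B : GrArt k) :
    G ⊗[k] B.carrier →ₗ[k] G ⊗[k] B.carrier →ₗ[k] G ⊗[k] B.carrier :=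
  TensorProduct.map₂ A.br
      (LinearMap.mul k B.carrier ∘ₗ scaleDeg B.gr (fun i => if Even i then 1 else 0)) +
    TensorProduct.map₂ (A.br.compl₂ (scaleDeg 𝒢 (sgn k)))
      (LinearMap.mul k B.carrier ∘ₗ scaleDeg B.gr (fun i => if Even i then 0 else 1))

/-- `Γ ∈ (𝔤 ⊗ m_B)¹` is a solution of the Maurer-Cartan equation
`∑_{N ≥ 1} (-1)^{N(N+1)/2} / N! μ_N(Γ, …, Γ) = 0` of `(𝔤 ⊗ m_B, μ_*)`. -/
def IsMC (A : DGLA 𝒢) (η : G →ₗ[k] G) (B : GrArt k) (Γ : G ⊗[k] B.carrier) : Prop :=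
  Γ ∈ totDeg 𝒢 B 1 ∧ SumsTo (mcTerm (A.dT B) (opT η B) (A.brT B) Γ) 0

/-- The set of solutions of the Maurer-Cartan equation in `(𝔤 ⊗ m_B, μ_*)`. -/
def MC (A : DGLA 𝒢) (η : G →ₗ[k] G) (B : GrArt k) : Type (max u v) :=
  {Γ : G ⊗[k] B.carrier // IsMC A η B Γ}

/-- Two Maurer-Cartan elements are joined by a polynomial gauge path: there are polynomials
`Γ(t)` in `(𝔤 ⊗ m_B)¹` and `ξ(t)` in `(𝔤 ⊗ m_B)⁰` such that every `Γ(t)` solves the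
Maurer-Cartan equation and `Γ'(t) = d_{Γ(t)} ξ(t)`. Here `d_Γ ξ` is, at a zero `Γ` of the
homological vector field `Q`, the value of the vector field `[Q, α]` for a vector field `α` of
value `ξ` at `Γ`, so that `Γ(t)` runs in a leaf of the distribution spanned by these fields. -/
def GaugePath (A : DGLA 𝒢) (η : G →ₗ[k] G) (B : GrArt k) (Γ₀ Γ₁ : MC A η B) : Prop :=
  ∃ p q : ℕ →₀ (G ⊗[k] B.carrier),
    (∀ j, p j ∈ totDeg 𝒢 B 1) ∧ (∀ j, q j ∈ totDeg 𝒢 B 0) ∧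
    (∀ t : k, IsMC A η B (pathEval p t)) ∧
    (∀ t : k, SumsTo (twTerm (A.dT B) (opT η B) (A.brT B) (pathEval p t) (pathEval q t))
      (pathDeriv p t)) ∧
    pathEval p (0 : k) = Γ₀.1 ∧ pathEval p (1 : k) = Γ₁.1

end Functors

section Naturality

variable {G : Type v} [AddCommGroup G] [Module k G] {𝒢 : ℤ → Submodule k G}

theorem scaleDeg_of_mem {V : Type*} [AddCommGroup V] [Module k V] (𝒱 : ℤ → Submodule k V)
    [DirectSum.Decomposition 𝒱] (c : ℤ → k) {i : ℤ} {x : V} (hx : x ∈ 𝒱 i) :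
    scaleDeg 𝒱 c x = c i • x := by
  simp only [scaleDeg, LinearMap.comp_apply, LinearEquiv.coe_coe,
    DirectSum.decomposeLinearEquiv_apply, DirectSum.decompose_of_mem 𝒱 hx]
  rw [← DirectSum.lof_eq_of k, DirectSum.toModule_lof]
  rfl

theorem hom_scaleDeg {B B' : GrArt k} (f : B ⟶ B') (c : ℤ → k) (b : B.carrier) :
    GrArt.hom f (scaleDeg B.gr c b) = scaleDeg B'.gr c (GrArt.hom f b) := by
  induction b using DirectSum.Decomposition.inductionOn B.gr with
  | zero => simp
  | homogeneous b => rw [scaleDeg_of_mem _ _ b.2, scaleDeg_of_mem _ _ (GrArt.hom_gr f b.2), map_smul]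
  | add a b ha hb => simp only [map_add, ha, hb]

theorem tmap_tmul {B B' : GrArt k} (f : B ⟶ B') (x : G) (b : B.carrier) :
    tmap G f (x ⊗ₜ b) = x ⊗ₜ GrArt.hom f b := rfl

theorem tmap_id (B : GrArt k) (z : G ⊗[k] B.carrier) : tmap G (𝟙 B) z = z := by
  simp [tmap, GrArt.hom_id]

theorem tmap_comp {B B' B'' : GrArt k} (f : B ⟶ B') (g : B' ⟶ B'') (z : G ⊗[k] B.carrier) :
    tmap G (f ≫ g) z = tmap G g (tmap G f z) := by
  simp [tmap, GrArt.hom_comp, LinearMap.lTensor_comp]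

theorem tmap_totDeg {B B' : GrArt k} (f : B ⟶ B') {n : ℤ} {z : G ⊗[k] B.carrier}
    (hz : z ∈ totDeg 𝒢 B n) : tmap G f z ∈ totDeg 𝒢 B' n := by
  have h : totDeg 𝒢 B n ≤ (totDeg 𝒢 B' n).comap (tmap G f) := by
    refine Submodule.span_le.2 ?_
    rintro _ ⟨i, j, hij, x, hx, b, hb, hm, rfl⟩
    exact Submodule.subset_span
      ⟨i, j, hij, x, hx, _, GrArt.hom_gr f hb, GrArt.hom_m f hm, tmap_tmul f x b⟩
  exact h hz

theorem tmap_tensorM {B B' : GrArt k} (f : B ⟶ B') {C : Submodule k G} {z : G ⊗[k] B.carrier}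
    (hz : z ∈ tensorM C B) : tmap G f z ∈ tensorM C B' := by
  have h : tensorM C B ≤ (tensorM C B').comap (tmap G f) := by
    refine Submodule.span_le.2 ?_
    rintro _ ⟨x, hx, b, hm, rfl⟩
    exact Submodule.subset_span ⟨x, hx, _, GrArt.hom_m f hm, tmap_tmul f x b⟩
  exact h hz

theorem tmap_opT {B B' : GrArt k} (f : B ⟶ B') (η : G →ₗ[k] G) (z : G ⊗[k] B.carrier) :
    tmap G f (opT η B z) = opT η B' (tmap G f z) := by
  induction z using TensorProduct.induction_on with
  | zero => simp
  | tmul x b => rfl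
  | add a b ha hb => simp only [map_add, ha, hb]

theorem tmap_dT {B B' : GrArt k} (f : B ⟶ B') (A : DGLA 𝒢) (z : G ⊗[k] B.carrier) :
    tmap G f (A.dT B z) = A.dT B' (tmap G f z) :=
  tmap_opT f A.d z

variable [DirectSum.Decomposition 𝒢]

theorem tmap_brT {B B' : GrArt k} (f : B ⟶ B') (A : DGLA 𝒢) (y z : G ⊗[k] B.carrier) :
    tmap G f (A.brT B y z) = A.brT B' (tmap G f y) (tmap G f z) := by
  induction y using TensorProduct.induction_on with
  | zero => simp
  | add a b ha hb => simp only [map_add, LinearMap.add_apply, ha, hb]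
  | tmul x a =>
    induction z using TensorProduct.induction_on with
    | zero => simp
    | add a b ha hb => simp only [map_add, ha, hb]
    | tmul y b => simp [DGLA.brT, tmap_tmul, hom_scaleDeg]

theorem map_mu {L L' : Type*} [AddCommGroup L] [Module k L] [AddCommGroup L'] [Module k L']
    (φ : L →ₗ[k] L') {d η : L →ₗ[k] L} {br : L →ₗ[k] L →ₗ[k] L}
    {d' η' : L' →ₗ[k] L'} {br' : L' →ₗ[k] L' →ₗ[k] L'}
    (hd : ∀ x, φ (d x) = d' (φ x)) (hη : ∀ x, φ (η x) = η' (φ x))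
    (hbr : ∀ x y, φ (br x y) = br' (φ x) (φ y)) :
    ∀ (n : ℕ) (p : Fin (n + 1) → ℤ) (v : Fin (n + 1) → L),
      φ (mu d η br n p v) = mu d' η' br' n p (fun i => φ (v i))
  | 0, _, v => by simp [mu, hd]
  | 1, _, v => by simp [mu, hd, hη, hbr]
  | n + 2, p, v => by
      simp only [mu, map_smul, map_sum, hη, hbr]
      simp only [map_mu φ hd hη hbr (n + 1)]

theorem SumsTo.map {L L' : Type*} [AddCommGroup L] [Module k L] [AddCommGroup L'] [Module k L']
    (φ : L →ₗ[k] L') {a : ℕ → L} {s : L} (h : SumsTo a s) {a' : ℕ → L'}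
    (ha : ∀ n, φ (a n) = a' n) : SumsTo a' (φ s) := by
  filter_upwards [h] with N hN
  rw [← hN, map_sum]
  exact Finset.sum_congr rfl fun n _ => (ha n).symm

theorem tmap_mcTerm {B B' : GrArt k} (f : B ⟶ B') (A : DGLA 𝒢) (η : G →ₗ[k] G)
    (Γ : G ⊗[k] B.carrier) (n : ℕ) :
    tmap G f (mcTerm (A.dT B) (opT η B) (A.brT B) Γ n) =
      mcTerm (A.dT B') (opT η B') (A.brT B') (tmap G f Γ) n := by
  simp only [mcTerm, map_smul]
  rw [map_mu (tmap G f) (tmap_dT f A) (tmap_opT f η) (tmap_brT f A)]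

theorem tmap_twTerm {B B' : GrArt k} (f : B ⟶ B') (A : DGLA 𝒢) (η : G →ₗ[k] G)
    (Γ ξ : G ⊗[k] B.carrier) (n : ℕ) :
    tmap G f (twTerm (A.dT B) (opT η B) (A.brT B) Γ ξ n) =
      twTerm (A.dT B') (opT η B') (A.brT B') (tmap G f Γ) (tmap G f ξ) n := by
  simp only [twTerm, map_smul]
  rw [map_mu (tmap G f) (tmap_dT f A) (tmap_opT f η) (tmap_brT f A)]
  congr 2
  funext i
  refine Fin.lastCases ?_ (fun j => ?_) i <;> simp

theorem tmap_pathEval {L L' : Type*} [AddCommGroup L] [Module k L] [AddCommGroup L'] [Module k L']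
    (φ : L →ₗ[k] L') (c : ℕ →₀ L) (t : k) :
    φ (pathEval c t) = pathEval (c.mapRange φ (map_zero φ)) t := by
  rw [pathEval, pathEval, Finsupp.sum_mapRange_index (by simp)]
  simp [Finsupp.sum, map_sum]

theorem tmap_pathDeriv {L L' : Type*} [AddCommGroup L] [Module k L] [AddCommGroup L']
    [Module k L'] (φ : L →ₗ[k] L') (c : ℕ →₀ L) (t : k) :
    φ (pathDeriv c t) = pathDeriv (c.mapRange φ (map_zero φ)) t := by
  rw [pathDeriv, pathDeriv, Finsupp.sum_mapRange_index (by simp)]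
  simp [Finsupp.sum, map_sum]

theorem IsMC.tmap {B B' : GrArt k} (f : B ⟶ B') {A : DGLA 𝒢} {η : G →ₗ[k] G}
    {Γ : G ⊗[k] B.carrier} (h : IsMC A η B Γ) : IsMC A η B' (tmap G f Γ) := by
  refine ⟨tmap_totDeg f h.1, ?_⟩
  have := h.2.map (FormalDef.tmap G f) (tmap_mcTerm f A η Γ)
  simpa using this

/-- Functoriality of the set of Maurer-Cartan solutions. -/
def MC.map (A : DGLA 𝒢) (η : G →ₗ[k] G) {B B' : GrArt k} (f : B ⟶ B') (Γ : MC A η B) :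
    MC A η B' :=
  ⟨tmap G f Γ.1, Γ.2.tmap f⟩

theorem GaugePath.map (A : DGLA 𝒢) (η : G →ₗ[k] G) {B B' : GrArt k} (f : B ⟶ B')
    {Γ₀ Γ₁ : MC A η B} (h : GaugePath A η B Γ₀ Γ₁) :
    GaugePath A η B' (MC.map A η f Γ₀) (MC.map A η f Γ₁) := by
  obtain ⟨p, q, hp, hq, h1, h2, h3, h4⟩ := h
  refine ⟨p.mapRange (tmap G f) (map_zero _), q.mapRange (tmap G f) (map_zero _), ?_, ?_, ?_, ?_,
    ?_, ?_⟩
  · intro j; simpa using tmap_totDeg f (hp j)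
  · intro j; simpa using tmap_totDeg f (hq j)
  · intro t; rw [← tmap_pathEval]; exact (h1 t).tmap f
  · intro t
    rw [← tmap_pathEval, ← tmap_pathEval, ← tmap_pathDeriv]
    exact (h2 t).map (tmap G f) (tmap_twTerm f A η _ _)
  · rw [← tmap_pathEval, h3]; rfl
  · rw [← tmap_pathEval, h4]; rfl

end Naturality

section MDef

variable {G : Type v} [AddCommGroup G] [Module k G] {𝒢 : ℤ → Submodule k G}
  [DirectSum.Decomposition 𝒢]

/-- The modified deformation functor `MDef^ℤ_𝔤`: solutions of the Maurer-Cartan equation of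
`(𝔤 ⊗ m_B, μ_*)` modulo the equivalence relation generated by gauge paths. -/
def MDefZ (A : DGLA 𝒢) (η : G →ₗ[k] G) : GrArt k ⥤ Type (max u v) where
  obj B := Quot (GaugePath A η B)
  map f := ↾(Quot.map (MC.map A η f) fun _ _ h => h.map A η f)
  map_id B := by
    ext z
    induction z using Quot.ind with
    | mk Γ => exact congrArg (Quot.mk _) (Subtype.ext (tmap_id B Γ.1))
  map_comp f g := by
    ext z
    induction z using Quot.ind with
    | mk Γ => exact congrArg (Quot.mk _) (Subtype.ext (tmap_comp f g Γ.1))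

/-- The restriction `MDef^0_𝔤` of the modified deformation functor (gauge classes of
Maurer-Cartan solutions) to Artin algebras concentrated in degree zero. -/
def MDef0 (A : DGLA 𝒢) (η : G →ₗ[k] G) : (concentrated k).FullSubcategory ⥤ Type (max u v) :=
  (concentrated k).ι ⋙ MDefZ A η

/-- The functor `MDef^0_𝔤` in the form of a slice: Maurer-Cartan solutions lying in `C ⊗ m_B`,
for Artin algebras `B` concentrated in degree zero (`C ⊆ 𝔤¹` will be a complement to the
coboundaries `d 𝔤⁰`, so that `C ⊗ m_B` is a complement to `d (𝔤 ⊗ m_B)⁰` in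
`(𝔤 ⊗ m_B)¹ = 𝔤¹ ⊗ m_B`). -/
def MDef0Slice (A : DGLA 𝒢) (η : G →ₗ[k] G) (C : Submodule k G) :
    (concentrated k).FullSubcategory ⥤ Type (max u v) where
  obj B := {Γ : MC A η B.obj // Γ.1 ∈ tensorM C B.obj}
  map f := ↾(fun Γ => ⟨MC.map A η ((concentrated k).ι.map f) Γ.1, tmap_tensorM _ Γ.2⟩)
  map_id B := by
    ext Γ
    exact Subtype.ext (tmap_id B.obj Γ.1.1)
  map_comp f g := by
    ext Γ
    exact Subtype.ext (tmap_comp _ _ Γ.1.1)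

/-- The cocycles `{Γ ∈ (𝔤 ⊗ m_B)¹ | d Γ = 0}`. -/
def cocT (A : DGLA 𝒢) (B : GrArt k) : Submodule k (G ⊗[k] B.carrier) :=
  LinearMap.ker (A.dT B) ⊓ totDeg 𝒢 B 1

/-- The coboundaries `d (𝔤 ⊗ m_B)⁰`, inside the cocycles. -/
def cobT (A : DGLA 𝒢) (B : GrArt k) : Submodule k (cocT A B) :=
  ((totDeg 𝒢 B 0).map (A.dT B)).submoduleOf (cocT A B)

/-- The map induced on cocycles by a morphism of Artin algebras. -/
def cocMap (A : DGLA 𝒢) {B B' : GrArt k} (f : B ⟶ B') : cocT A B →ₗ[k] cocT A B' :=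
  (tmap G f).restrict fun z hz => by
    refine ⟨?_, tmap_totDeg f hz.2⟩
    have h : A.dT B z = 0 := hz.1
    change A.dT B' (tmap G f z) = 0
    rw [← tmap_dT, h, map_zero]

theorem cobT_le (A : DGLA 𝒢) {B B' : GrArt k} (f : B ⟶ B') :
    cobT A B ≤ (cobT A B').comap (cocMap A f) := by
  rintro z ⟨w, hw, hz⟩
  refine ⟨tmap G f w, tmap_totDeg f hw, ?_⟩
  rw [← tmap_dT, hz]
  rfl

/-- The linear functor `B ↦ {Γ ∈ (𝔤 ⊗ m_B)¹ | d Γ = 0} / Im d`. -/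
def DefLin (A : DGLA 𝒢) : GrArt k ⥤ Type (max u v) where
  obj B := ↥(cocT A B) ⧸ cobT A B
  map f := ↾((cobT A _).mapQ (cobT A _) (cocMap A f) (cobT_le A f))
  map_id B := by
    ext z
    induction z using Submodule.Quotient.induction_on with
    | H z => exact congrArg Submodule.Quotient.mk (Subtype.ext (tmap_id B z.1))
  map_comp f g := by
    ext z
    induction z using Submodule.Quotient.induction_on with
    | H z => exact congrArg Submodule.Quotient.mk (Subtype.ext (tmap_comp f g z.1))

end MDef

/-! ### Graded commutative formal power series -/

section PowerSeries

variable {I : Type*} (deg : I → ℤ)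

/-- The exponents of the nonzero monomials in graded commuting variables `tᵢ` of degree `deg i`:
variables of odd degree square to zero. -/
def IsSuper (m : I →₀ ℕ) : Prop := ∀ i, Odd (deg i) → m i ≤ 1

variable {deg} in
theorem IsSuper.of_le {m n : I →₀ ℕ} (h : IsSuper deg n) (hmn : m ≤ n) : IsSuper deg m :=
  fun i hi => (hmn i).trans (h i hi)

/-- The algebra `k[[t_I]]` of formal power series in graded commuting variables `tᵢ` (`i ∈ I`) of
degree `deg i`. An element is a family of coefficients, indexed by the ordered monomials
`t^m = ∏ tᵢ^(m i)` (factors in increasing order). For `deg = 0` this is the usual algebra of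
formal power series. -/
def SuperPowerSeries (k : Type u) [Field k] {I : Type*} (deg : I → ℤ) : Type _ :=
  {m : I →₀ ℕ // IsSuper deg m} → k

namespace SuperPowerSeries

instance : AddCommGroup (SuperPowerSeries k deg) :=
  inferInstanceAs (AddCommGroup ({m : I →₀ ℕ // IsSuper deg m} → k))

instance : Module k (SuperPowerSeries k deg) :=
  inferInstanceAs (Module k ({m : I →₀ ℕ // IsSuper deg m} → k))

variable {deg}

open Classical in
/-- The coefficient of `t^m`, which is zero when `t^m = 0`. -/
def coeff (f : SuperPowerSeries k deg) (m : I →₀ ℕ) : k :=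
  if h : IsSuper deg m then f ⟨m, h⟩ else 0

theorem coeff_of (f : SuperPowerSeries k deg) {m : I →₀ ℕ} (h : IsSuper deg m) :
    coeff f m = f ⟨m, h⟩ := by simp [coeff, h]

theorem coeff_of_not (f : SuperPowerSeries k deg) {m : I →₀ ℕ} (h : ¬ IsSuper deg m) :
    coeff f m = 0 := by simp [coeff, h]

theorem ext_coeff {f g : SuperPowerSeries k deg} (h : ∀ m, IsSuper deg m → coeff f m = coeff g m) :
    f = g := by
  funext m
  rw [← coeff_of f m.2, ← coeff_of g m.2, h m.1 m.2]

@[simp] theorem coeff_add (f g : SuperPowerSeries k deg) (m : I →₀ ℕ) :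
    coeff (f + g) m = coeff f m + coeff g m := by
  by_cases h : IsSuper deg m
  · simp only [coeff_of _ h]; rfl
  · simp [coeff_of_not _ h]

@[simp] theorem coeff_smul (c : k) (f : SuperPowerSeries k deg) (m : I →₀ ℕ) :
    coeff (c • f) m = c * coeff f m := by
  by_cases h : IsSuper deg m
  · simp only [coeff_of _ h]; rfl
  · simp [coeff_of_not _ h]

@[simp] theorem coeff_zero (m : I →₀ ℕ) : coeff (0 : SuperPowerSeries k deg) m = 0 := by
  by_cases h : IsSuper deg m
  · simp only [coeff_of _ h]; rfl
  · simp [coeff_of_not _ h]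

variable [LinearOrder I]

variable (deg) in
/-- The exponent of the sign in `t^a t^b = ± t^(a+b)`: every factor `tⱼ` of `t^b` is moved to the
left across the factors `tᵢ` of `t^a` with `i > j`. -/
def signExp (a b : I →₀ ℕ) : ℤ :=
  a.sum fun i x => b.sum fun j y => if j < i then deg i * deg j * x * y else 0

theorem signExp_add_left (a a' b : I →₀ ℕ) :
    signExp deg (a + a') b = signExp deg a b + signExp deg a' b := by
  unfold signExp
  rw [Finsupp.sum_add_index']
  · intro i; simp
  · intro i x y
    simp only [Finsupp.sum, ← Finset.sum_add_distrib]
    refine Finset.sum_congr rfl fun j _ => ?_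
    split_ifs <;> push_cast <;> ring

theorem signExp_add_right (a b b' : I →₀ ℕ) :
    signExp deg a (b + b') = signExp deg a b + signExp deg a b' := by
  unfold signExp
  simp only [Finsupp.sum, ← Finset.sum_add_distrib]
  refine Finset.sum_congr rfl fun i _ => ?_
  have h := Finsupp.sum_add_index' (f := b) (g := b')
    (h := fun j y => if j < i then deg i * deg j * (a i : ℤ) * (y : ℤ) else 0)
    (by intro j; simp) (by intro j x y; split_ifs <;> push_cast <;> ring)
  simpa only [Finsupp.sum] using h

theorem signExp_zero_left (b : I →₀ ℕ) : signExp deg 0 b = 0 := by simp [signExp]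

theorem signExp_zero_right (a : I →₀ ℕ) : signExp deg a 0 = 0 := by simp [signExp]

theorem sgn_add (m n : ℤ) : sgn k (m + n) = sgn k m * sgn k n := by
  simp [sgn, Int.negOnePow_add]

theorem sgn_zero : sgn k 0 = 1 := by simp [sgn]

theorem fst_le_of_mem {m : I →₀ ℕ} {p : (I →₀ ℕ) × (I →₀ ℕ)}
    (hp : p ∈ Finset.HasAntidiagonal.antidiagonal m) : p.1 ≤ m :=
  (Finset.HasAntidiagonal.mem_antidiagonal.1 hp) ▸ le_self_add

theorem snd_le_of_mem {m : I →₀ ℕ} {p : (I →₀ ℕ) × (I →₀ ℕ)}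
    (hp : p ∈ Finset.HasAntidiagonal.antidiagonal m) : p.2 ≤ m :=
  (Finset.HasAntidiagonal.mem_antidiagonal.1 hp) ▸ le_add_self

instance : Mul (SuperPowerSeries k deg) where
  mul f g := fun m => ∑ p ∈ Finset.HasAntidiagonal.antidiagonal m.1,
    sgn k (signExp deg p.1 p.2) * (coeff f p.1 * coeff g p.2)

open Classical in
instance : One (SuperPowerSeries k deg) where
  one := fun m => if m.1 = 0 then 1 else 0

theorem coeff_mul (f g : SuperPowerSeries k deg) {m : I →₀ ℕ} (h : IsSuper deg m) :
    coeff (f * g) m = ∑ p ∈ Finset.HasAntidiagonal.antidiagonal m,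
      sgn k (signExp deg p.1 p.2) * (coeff f p.1 * coeff g p.2) := by
  rw [coeff_of _ h]; rfl

theorem isSuper_zero : IsSuper deg 0 := fun i _ => by simp

open Classical in
theorem coeff_one (m : I →₀ ℕ) :
    coeff (1 : SuperPowerSeries k deg) m = if m = 0 then 1 else 0 := by
  by_cases h : IsSuper deg m
  · rw [coeff_of _ h]; rfl
  · rw [coeff_of_not _ h, if_neg]
    rintro rfl
    exact h isSuper_zero

theorem coeff_zero_mul (f g : SuperPowerSeries k deg) :
    coeff (f * g) 0 = coeff f 0 * coeff g 0 := by
  rw [coeff_mul _ _ isSuper_zero]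
  simp [signExp_zero_left, sgn_zero]

instance : Ring (SuperPowerSeries k deg) where
  __ := (inferInstance : AddCommGroup (SuperPowerSeries k deg))
  left_distrib f g h := ext_coeff fun m hm => by
    simp only [coeff_add, coeff_mul _ _ hm, ← Finset.sum_add_distrib]
    exact Finset.sum_congr rfl fun p _ => by ring
  right_distrib f g h := ext_coeff fun m hm => by
    simp only [coeff_add, coeff_mul _ _ hm, ← Finset.sum_add_distrib]
    exact Finset.sum_congr rfl fun p _ => by ring
  zero_mul f := ext_coeff fun m hm => by simp [coeff_mul _ _ hm]
  mul_zero f := ext_coeff fun m hm => by simp [coeff_mul _ _ hm]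
  one_mul f := ext_coeff fun m hm => by
    rw [coeff_mul _ _ hm, Finset.sum_eq_single (0, m)]
    · simp [coeff_one, signExp_zero_left, sgn_zero]
    · rintro ⟨a, b⟩ hab hne
      rw [coeff_one, if_neg, zero_mul, mul_zero]
      rintro rfl
      exact hne (by simpa using hab)
    · simp
  mul_one f := ext_coeff fun m hm => by
    rw [coeff_mul _ _ hm, Finset.sum_eq_single (m, 0)]
    · simp [coeff_one, signExp_zero_right, sgn_zero]
    · rintro ⟨a, b⟩ hab hne
      rw [coeff_one, if_neg, mul_zero, mul_zero]
      rintro rfl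
      exact hne (by simpa using hab)
    · simp
  mul_assoc f g h := ext_coeff fun m hm => by
    have h1 : ∀ p ∈ Finset.HasAntidiagonal.antidiagonal m, coeff (f * g) p.1 =
        ∑ q ∈ Finset.HasAntidiagonal.antidiagonal p.1,
          sgn k (signExp deg q.1 q.2) * (coeff f q.1 * coeff g q.2) := fun p hp =>
      coeff_mul f g (hm.of_le (fst_le_of_mem hp))
    have h2 : ∀ p ∈ Finset.HasAntidiagonal.antidiagonal m, coeff (g * h) p.2 =
        ∑ q ∈ Finset.HasAntidiagonal.antidiagonal p.2,
          sgn k (signExp deg q.1 q.2) * (coeff g q.1 * coeff h q.2) := fun p hp =>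
      coeff_mul g h (hm.of_le (snd_le_of_mem hp))
    rw [coeff_mul _ _ hm, coeff_mul _ _ hm]
    refine (Finset.sum_congr rfl fun p hp => by rw [h1 p hp]).trans
      (Eq.trans ?_ (Finset.sum_congr rfl fun p hp => by rw [h2 p hp]).symm)
    simp only [Finset.sum_mul, Finset.mul_sum, Finset.sum_sigma']
    refine Finset.sum_nbij' (fun x => ⟨(x.2.1, x.2.2 + x.1.2), (x.2.2, x.1.2)⟩)
      (fun x => ⟨(x.1.1 + x.2.1, x.2.2), (x.1.1, x.2.1)⟩) ?_ ?_ ?_ ?_ ?_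
    · rintro ⟨⟨a, b⟩, ⟨c, e⟩⟩ hx
      simp only [Finset.mem_sigma, Finset.HasAntidiagonal.mem_antidiagonal] at hx ⊢
      exact ⟨by rw [← hx.1, ← hx.2, add_assoc], trivial⟩
    · rintro ⟨⟨a, b⟩, ⟨c, e⟩⟩ hx
      simp only [Finset.mem_sigma, Finset.HasAntidiagonal.mem_antidiagonal] at hx ⊢
      exact ⟨by rw [← hx.1, ← hx.2, add_assoc], trivial⟩
    · rintro ⟨⟨a, b⟩, ⟨c, e⟩⟩ hx
      simp only [Finset.mem_sigma, Finset.HasAntidiagonal.mem_antidiagonal] at hx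
      obtain ⟨rfl, rfl⟩ := hx
      rfl
    · rintro ⟨⟨a, b⟩, ⟨c, e⟩⟩ hx
      simp only [Finset.mem_sigma, Finset.HasAntidiagonal.mem_antidiagonal] at hx
      obtain ⟨rfl, rfl⟩ := hx
      rfl
    · rintro ⟨⟨a, b⟩, ⟨c, e⟩⟩ hx
      simp only [Finset.mem_sigma, Finset.HasAntidiagonal.mem_antidiagonal] at hx
      obtain ⟨rfl, rfl⟩ := hx
      simp only [signExp_add_left, signExp_add_right, sgn_add]
      ring

instance : Algebra k (SuperPowerSeries k deg) :=
  Algebra.ofModule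
    (fun c f g => ext_coeff fun m hm => by
      simp only [coeff_smul, coeff_mul _ _ hm, Finset.mul_sum]
      exact Finset.sum_congr rfl fun p _ => by ring)
    (fun c f g => ext_coeff fun m hm => by
      simp only [coeff_smul, coeff_mul _ _ hm, Finset.mul_sum]
      exact Finset.sum_congr rfl fun p _ => by ring)

/-- The constant term. -/
def constCoeff : SuperPowerSeries k deg →+* k where
  toFun f := coeff f 0
  map_one' := by simp [coeff_one]
  map_mul' := coeff_zero_mul
  map_zero' := coeff_zero 0
  map_add' f g := coeff_add f g 0

/-- A power series is homogeneous of degree `n` if all its monomials have degree `n`. -/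
def IsHomog (f : SuperPowerSeries k deg) (n : ℤ) : Prop :=
  ∀ m, coeff f m ≠ 0 → (m.sum fun i x => (x : ℤ) * deg i) = n

/-- The topology of coefficientwise convergence (product of discrete topologies); for finitely
many variables, the adic topology of the maximal ideal. -/
@[reducible]
def topology (k : Type u) [Field k] (deg : I → ℤ) : TopologicalSpace (SuperPowerSeries k deg) :=
  TopologicalSpace.induced coeff (@Pi.topologicalSpace (I →₀ ℕ) (fun _ => k) fun _ => ⊥)

/-- Local continuous homomorphisms of graded algebras from the pro-Artin algebra `k[[t_I]]` to
a (discrete) graded Artin algebra. -/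
structure ProHom {I : Type v} [LinearOrder I] (deg : I → ℤ) (B : GrArt k) :
    Type (max u v) where
  hom : SuperPowerSeries k deg →ₐ[k] B.carrier
  cont : @Continuous _ _ (topology k deg) ⊥ hom
  homog : ∀ n f, IsHomog f n → hom f ∈ B.gr n
  loc : ∀ f, constCoeff f = 0 → hom f ∈ B.m

@[ext] theorem ProHom.ext' {I : Type v} [LinearOrder I] {deg : I → ℤ} {B : GrArt k}
    {φ ψ : ProHom deg B} (h : ∀ f, φ.hom f = ψ.hom f) : φ = ψ := by
  cases φ; cases ψ
  congr
  exact AlgHom.ext h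

/-- The functor pro-represented by `k[[t_I]]`. -/
def proFunctor (k : Type u) [Field k] {I : Type v} [LinearOrder I] (deg : I → ℤ) :
    GrArt k ⥤ Type (max u v) where
  obj B := ProHom deg B
  map g := ↾(fun φ =>
    { hom := (GrArt.hom g).comp φ.hom
      cont := @Continuous.comp _ _ _ (topology k deg) ⊥ ⊥ φ.hom (GrArt.hom g) continuous_bot φ.cont
      homog := fun n f hf => GrArt.hom_gr g (φ.homog n f hf)
      loc := fun f hf => GrArt.hom_m g (φ.loc f hf) })
  map_id B := by
    ext φ f
    rfl
  map_comp g h := by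
    ext φ f
    rfl

/-! ### Convergent power series and completion -/

/-- `f` is convergent near the origin, with respect to an absolute value `v` of `k` (for
`k = ℝ, ℂ` and the usual absolute value: `f` is the expansion of an analytic superfunction):
for some `r > 0` the numbers `v(f_m) r^|m|` are bounded. -/
def IsConvergent (v : AbsoluteValue k ℝ) (f : SuperPowerSeries k deg) : Prop :=
  ∃ r : ℝ, 0 < r ∧ ∃ C : ℝ, ∀ m, v (coeff f m) * r ^ m.degree ≤ C

theorem IsConvergent.mono {v : AbsoluteValue k ℝ} {f : SuperPowerSeries k deg} {r C s : ℝ}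
    (hs : 0 < s) (hsr : s ≤ r) (h : ∀ m, v (coeff f m) * r ^ m.degree ≤ C) (m : I →₀ ℕ) :
    v (coeff f m) * s ^ m.degree ≤ C :=
  (mul_le_mul_of_nonneg_left (pow_le_pow_left₀ hs.le hsr _) (v.nonneg _)).trans (h m)

theorem card_antidiagonal_le (m : I →₀ ℕ) :
    (Finset.HasAntidiagonal.antidiagonal m).card ≤ 2 ^ m.degree := by
  have h1 : (Finset.HasAntidiagonal.antidiagonal m).card ≤ (Finset.Iic m).card := by
    refine Finset.card_le_card_of_injOn Prod.fst (fun p hp => ?_) (fun p hp q hq h => ?_)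
    · simpa using fst_le_of_mem hp
    · have hp' := Finset.HasAntidiagonal.mem_antidiagonal.1 hp
      have hq' := Finset.HasAntidiagonal.mem_antidiagonal.1 hq
      refine Prod.ext h (add_left_cancel (a := p.1) ?_)
      rw [hp', h, hq']
  refine h1.trans ?_
  rw [Finsupp.card_Iic, Finsupp.degree_apply, ← Finset.prod_pow_eq_pow_sum]
  refine Finset.prod_le_prod' fun i _ => ?_
  simpa using Nat.succ_le_of_lt (Nat.lt_two_pow_self (n := m i))

theorem map_sgn_mul (v : AbsoluteValue k ℝ) (n : ℤ) (x : k) : v (sgn k n * x) = v x := by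
  rcases Int.even_or_odd n with h | h
  · simp [sgn, Int.negOnePow_even n h]
  · simp [sgn, Int.negOnePow_odd n h]

theorem IsConvergent.mul {v : AbsoluteValue k ℝ} {f g : SuperPowerSeries k deg}
    (hf : IsConvergent v f) (hg : IsConvergent v g) : IsConvergent v (f * g) := by
  obtain ⟨r, hr, C, hC⟩ := hf
  obtain ⟨s, hs, D, hD⟩ := hg
  have ht : 0 < min r s := lt_min hr hs
  have hC' := IsConvergent.mono ht (min_le_left r s) hC
  have hD' := IsConvergent.mono ht (min_le_right r s) hD
  set t := min r s
  have hC0 : 0 ≤ C := le_trans (by positivity) (hC' 0)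
  have hD0 : 0 ≤ D := le_trans (by positivity) (hD' 0)
  refine ⟨t / 2, by positivity, C * D, fun m => ?_⟩
  by_cases hm : IsSuper deg m
  swap
  · rw [coeff_of_not _ hm]; simpa using mul_nonneg hC0 hD0
  have key : v (coeff (f * g) m) * t ^ m.degree ≤ 2 ^ m.degree * (C * D) := by
    rw [coeff_mul _ _ hm]
    calc _ ≤ (∑ p ∈ Finset.HasAntidiagonal.antidiagonal m, v (coeff f p.1) * v (coeff g p.2)) * t ^ m.degree := by
          refine mul_le_mul_of_nonneg_right ((v.sum_le _ _).trans (le_of_eq ?_)) (by positivity)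
          exact Finset.sum_congr rfl fun p _ => by rw [map_sgn_mul, map_mul]
      _ = ∑ p ∈ Finset.HasAntidiagonal.antidiagonal m,
            (v (coeff f p.1) * t ^ p.1.degree) * (v (coeff g p.2) * t ^ p.2.degree) := by
          rw [Finset.sum_mul]
          refine Finset.sum_congr rfl fun p hp => ?_
          rw [← Finset.HasAntidiagonal.mem_antidiagonal.1 hp, map_add, pow_add]
          ring
      _ ≤ ∑ _p ∈ Finset.HasAntidiagonal.antidiagonal m, C * D :=
          Finset.sum_le_sum fun p _ => mul_le_mul (hC' _) (hD' _) (by positivity) hC0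
      _ = (Finset.HasAntidiagonal.antidiagonal m).card * (C * D) := by simp
      _ ≤ 2 ^ m.degree * (C * D) :=
          mul_le_mul_of_nonneg_right (by exact_mod_cast card_antidiagonal_le m) (by positivity)
  rw [div_pow, mul_div_assoc', div_le_iff₀ (by positivity)]
  linarith

/-- The algebra of convergent power series (the analytic germ at the origin). -/
def convergent (v : AbsoluteValue k ℝ) (deg : I → ℤ) : Subalgebra k (SuperPowerSeries k deg) where
  carrier := {f | IsConvergent v f}
  mul_mem' := IsConvergent.mul
  add_mem' := by
    rintro f g ⟨r, hr, C, hC⟩ ⟨s, hs, D, hD⟩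
    have ht : 0 < min r s := lt_min hr hs
    refine ⟨min r s, ht, C + D, fun m => ?_⟩
    have h1 := IsConvergent.mono ht (min_le_left r s) hC m
    have h2 := IsConvergent.mono ht (min_le_right r s) hD m
    have h3 := mul_le_mul_of_nonneg_right (v.add_le (coeff f m) (coeff g m))
      (pow_nonneg ht.le m.degree)
    rw [coeff_add]
    linarith
  algebraMap_mem' c := by
    refine ⟨1, one_pos, v c, fun m => ?_⟩
    rw [Algebra.algebraMap_eq_smul_one, coeff_smul, coeff_one]
    split_ifs <;> simp

/-- The inclusion of the convergent power series into the formal ones. -/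
def convergentIncl (v : AbsoluteValue k ℝ) (deg : I → ℤ) :
    convergent v deg →+* SuperPowerSeries k deg :=
  (convergent v deg).val.toRingHom

/-- The maximal ideal of the algebra of convergent power series. -/
def convergentIdeal (v : AbsoluteValue k ℝ) (deg : I → ℤ) : Ideal (convergent v deg) :=
  RingHom.ker (constCoeff.comp (convergentIncl v deg))

instance (v : AbsoluteValue k ℝ) (deg : I → ℤ) : (convergentIdeal v deg).IsTwoSided :=
  inferInstanceAs (RingHom.ker _).IsTwoSided

end SuperPowerSeries

/-- The completion `lim_n R / Jⁿ` of a ring at a two-sided ideal. -/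
def adicLimit {R : Type*} [Ring R] (J : Ideal R) [J.IsTwoSided] : Subring (∀ n : ℕ, R ⧸ J ^ n) where
  carrier := {s | ∀ n, Ideal.Quotient.factor (Ideal.pow_le_pow_right n.le_succ) (s (n + 1)) = s n}
  mul_mem' ha hb n := by simp [ha n, hb n]
  one_mem' n := by simp
  add_mem' ha hb n := by simp [ha n, hb n]
  zero_mem' n := by simp
  neg_mem' ha n := by simp [ha n]

/-- The canonical map of a ring to its completion. -/
def adicLimit.of {R : Type*} [Ring R] (J : Ideal R) [J.IsTwoSided] : R →+* adicLimit J :=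
  (RingHom.pi fun n => Ideal.Quotient.mk (J ^ n)).codRestrict _ fun x n => by simp

/-- A ring homomorphism `j : R → S` exhibits `S` as the `J`-adic completion of `R`. -/
def IsCompletion {R S : Type*} [Ring R] [Ring S] (j : R →+* S) (J : Ideal R) [J.IsTwoSided] :
    Prop :=
  ∃ e : S ≃+* adicLimit J, ∀ x, e (j x) = adicLimit.of J x

end PowerSeries

end

end FormalDef

open FormalDef

/-!
The Maurer-Cartan series of `μ_*` can be summed. If `F` is its value at `Γ`, the recursion
expressing `μ_N` through `η [μ_{N-1}, ·]` gives `F = -d (Γ + ½ η [Γ, Γ]) + η [F, Γ]`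
(`exists_curvature`). As `η [·, Γ]` is nilpotent on `𝔤 ⊗ m_B`, the equation `F = 0` says that `d` kills
`straighten Γ = Γ + ½ η [Γ, Γ]`, and `straighten` is a bijection of `(𝔤 ⊗ m_B)¹`, again by
nilpotency. In the same way, `T = d_Γ ξ` satisfies `T + η [Γ, T] = d (ξ + η [Γ, ξ])`
(`exists_deformed_differential`), where the left-hand side is the derivative of `straighten` in the
direction `T`. So `straighten` turns gauge paths into polynomial paths of cocycles with velocity in
`d (𝔤 ⊗ m_B)⁰`, and the segment between two cohomologous cocycles comes from a gauge path: gauge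
classes are cohomology classes (`mdefIsoDefLin`).

Over a field, the complex `(𝔤, d)` contracts to its cohomology by linear identities
(`HomotopyData`). After tensoring with `B` they identify the classes of cocycles in `(𝔤 ⊗ m_B)¹`
with the finitely supported families of elements of `m_B`, of degree `1 - i` for a class in `Hⁱ`
(`HomotopyData.familiesEquiv`). Such families are the possible images of the coordinates under a
continuous local homomorphism `k[[t]] → B` (`proHomEquiv`): continuity makes them finitely
supported, and a family can be substituted in a power series because `m_B` is nilpotent. The sign
bookkeeping is the multiplication rule `ordProd_mul` for ordered monomials.

For the slice given by a complement `C`, let `π` be the projection of `𝔤¹` to `C` along the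
coboundaries. It carries `straighten` for `η` to `straighten` for `π η`, whose bijectivity shows
that each class of cocycles contains the straightening of exactly one Maurer-Cartan element of the
slice (`slice_bijective`). Finally, for finitely many variables the `n`-th power of the maximal
ideal of the algebra of convergent power series consists of the series of order at least `n`
(`convergentIdeal_pow`), and a formal power series is the compatible sequence of its truncations.
-/

namespace FormalDef

open SuperPowerSeries

noncomputable section

/-! ### Signs and tensor products with a graded Artin algebra -/

section Tensor

variable {k : Type u} [Field k]

theorem sgn_even {n : ℤ} (h : Even n) : sgn k n = 1 := by simp [sgn, Int.negOnePow_even n h]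

theorem sgn_odd {n : ℤ} (h : Odd n) : sgn k n = -1 := by simp [sgn, Int.negOnePow_odd n h]

theorem sgn_mul_self (n : ℤ) : sgn k n * sgn k n = 1 := by
  rw [← sgn_add, sgn_even ⟨n, rfl⟩]

/-- A span of vectors closed under scalar multiplication consists of their sums. -/
theorem span_induction_add {V : Type*} [AddCommGroup V] [Module k V] {S : Set V}
    (hS : ∀ (c : k), ∀ x ∈ S, c • x ∈ S) {p : V → Prop} (mem : ∀ x ∈ S, p x) (zero : p 0)
    (add : ∀ x y, p x → p y → p (x + y)) {x : V} (hx : x ∈ Submodule.span k S) : p x := by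
  have h : ∀ c : k, p (c • x) := by
    induction hx using Submodule.span_induction with
    | mem x hx => exact fun c => mem _ (hS c x hx)
    | zero => intro c; simpa using zero
    | add x y _ _ hx hy => intro c; rw [smul_add]; exact add _ _ (hx c) (hy c)
    | smul a x _ hx => intro c; rw [smul_smul]; exact hx _
  simpa using h 1

variable {G : Type v} [AddCommGroup G] [Module k G]

/-- The part of total degree `n` of `𝔤 ⊗ m_B ^ s`: the filtration of `𝔤 ⊗ B` by powers of the
maximal ideal. For `s = 1` it is `totDeg`. -/
def filDeg (𝒢 : ℤ → Submodule k G) (B : GrArt k) (s : ℕ) (n : ℤ) :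
    Submodule k (G ⊗[k] B.carrier) :=
  Submodule.span k
    {z | ∃ i j : ℤ, i + j = n ∧ ∃ x ∈ 𝒢 i, ∃ b ∈ B.gr j, b ∈ B.m ^ s ∧ z = x ⊗ₜ[k] b}

variable {𝒢 : ℤ → Submodule k G} {B : GrArt k}

theorem filDeg_one (n : ℤ) : filDeg 𝒢 B 1 n = totDeg 𝒢 B n := by
  simp only [filDeg, totDeg, pow_one]

theorem filDeg_induction {s : ℕ} {n : ℤ} {p : G ⊗[k] B.carrier → Prop}
    (tmul : ∀ i j x b, i + j = n → x ∈ 𝒢 i → b ∈ B.gr j → b ∈ B.m ^ s → p (x ⊗ₜ b))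
    (zero : p 0) (add : ∀ x y, p x → p y → p (x + y))
    {z : G ⊗[k] B.carrier} (hz : z ∈ filDeg 𝒢 B s n) : p z := by
  refine span_induction_add ?_ ?_ zero add hz
  · rintro c _ ⟨i, j, h, x, hx, b, hb, hs, rfl⟩
    exact ⟨i, j, h, c • x, Submodule.smul_mem _ c hx, b, hb, hs, by rw [TensorProduct.smul_tmul']⟩
  · rintro _ ⟨i, j, h, x, hx, b, hb, hs, rfl⟩
    exact tmul i j x b h hx hb hs

theorem totDeg_induction {n : ℤ} {p : G ⊗[k] B.carrier → Prop}
    (tmul : ∀ i j x b, i + j = n → x ∈ 𝒢 i → b ∈ B.gr j → b ∈ B.m → p (x ⊗ₜ b))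
    (zero : p 0) (add : ∀ x y, p x → p y → p (x + y))
    {z : G ⊗[k] B.carrier} (hz : z ∈ totDeg 𝒢 B n) : p z := by
  rw [← filDeg_one] at hz
  refine filDeg_induction (fun i j x b h hx hb hm => ?_) zero add hz
  rw [pow_one] at hm
  exact tmul i j x b h hx hb hm

theorem tmul_mem_filDeg {s : ℕ} {n i j : ℤ} {x : G} {b : B.carrier} (h : i + j = n)
    (hx : x ∈ 𝒢 i) (hb : b ∈ B.gr j) (hs : b ∈ B.m ^ s) : x ⊗ₜ b ∈ filDeg 𝒢 B s n :=
  Submodule.subset_span ⟨i, j, h, x, hx, b, hb, hs, rfl⟩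

theorem tmul_mem_totDeg {n i j : ℤ} {x : G} {b : B.carrier} (h : i + j = n)
    (hx : x ∈ 𝒢 i) (hb : b ∈ B.gr j) (hs : b ∈ B.m) : x ⊗ₜ b ∈ totDeg 𝒢 B n :=
  Submodule.subset_span ⟨i, j, h, x, hx, b, hb, hs, rfl⟩

theorem GrArt.m_mul_le (B : GrArt k) (P : Submodule k B.carrier) : P * B.m ≤ B.m := by
  refine Submodule.mul_le.2 fun a _ b hb => ?_
  have hb' : B.aug b = 0 := hb
  change B.aug (a * b) = 0
  rw [map_mul, hb', mul_zero]

theorem filDeg_le_totDeg {s : ℕ} (hs : 1 ≤ s) (n : ℤ) : filDeg 𝒢 B s n ≤ totDeg 𝒢 B n := by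
  obtain ⟨s, rfl⟩ := Nat.exists_eq_add_of_le' hs
  refine Submodule.span_mono ?_
  rintro _ ⟨i, j, h, x, hx, b, hb, hm, rfl⟩
  rw [pow_succ] at hm
  exact ⟨i, j, h, x, hx, b, hb, B.m_mul_le _ hm, rfl⟩

theorem filDeg_eq_bot (𝒢 : ℤ → Submodule k G) (B : GrArt k) :
    ∃ N, ∀ s, N ≤ s → ∀ n, filDeg 𝒢 B s n = ⊥ := by
  obtain ⟨N, hN⟩ := B.nilp
  refine ⟨N, fun s hs n => ?_⟩
  have hm : B.m ^ s = ⊥ := by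
    obtain ⟨r, rfl⟩ := Nat.exists_eq_add_of_le hs
    rw [pow_add, show B.m ^ N = ⊥ from hN, Submodule.bot_mul]
  rw [filDeg, Submodule.span_eq_bot]
  rintro _ ⟨i, j, h, x, hx, b, hb, hb', rfl⟩
  rw [hm, Submodule.mem_bot] at hb'
  rw [hb', TensorProduct.tmul_zero]

theorem opT_tmul (η : G →ₗ[k] G) (x : G) (b : B.carrier) : opT η B (x ⊗ₜ b) = η x ⊗ₜ b := rfl

theorem opT_mem {η : G →ₗ[k] G} {e : ℤ} (hη : ∀ i, ∀ x ∈ 𝒢 i, η x ∈ 𝒢 (i + e)) {s : ℕ} {n n' : ℤ}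
    (hn : n + e = n') {z : G ⊗[k] B.carrier} (hz : z ∈ filDeg 𝒢 B s n) :
    opT η B z ∈ filDeg 𝒢 B s n' := by
  refine filDeg_induction (p := fun z => opT η B z ∈ filDeg 𝒢 B s n') ?_ ?_ ?_ hz
  · intro i j x b h hx hb hm
    exact tmul_mem_filDeg (by omega) (hη i x hx) hb hm
  · simp
  · intro x y hx hy; rw [map_add]; exact add_mem hx hy

theorem opT_mem_totDeg {η : G →ₗ[k] G} {e : ℤ} (hη : ∀ i, ∀ x ∈ 𝒢 i, η x ∈ 𝒢 (i + e)) {n n' : ℤ}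
    (hn : n + e = n') {z : G ⊗[k] B.carrier} (hz : z ∈ totDeg 𝒢 B n) :
    opT η B z ∈ totDeg 𝒢 B n' := by
  rw [← filDeg_one] at hz ⊢
  exact opT_mem hη hn hz

theorem dT_mem (A : DGLA 𝒢) {s : ℕ} {n n' : ℤ} (hn : n + 1 = n') {z : G ⊗[k] B.carrier}
    (hz : z ∈ filDeg 𝒢 B s n) : A.dT B z ∈ filDeg 𝒢 B s n' :=
  opT_mem (η := A.d) A.d_mem hn hz

theorem dT_mem_totDeg (A : DGLA 𝒢) {n n' : ℤ} (hn : n + 1 = n') {z : G ⊗[k] B.carrier}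
    (hz : z ∈ totDeg 𝒢 B n) : A.dT B z ∈ totDeg 𝒢 B n' :=
  opT_mem_totDeg (η := A.d) A.d_mem hn hz

theorem dT_tmul (A : DGLA 𝒢) (x : G) (b : B.carrier) : A.dT B (x ⊗ₜ b) = A.d x ⊗ₜ b := rfl

theorem dT_dT (A : DGLA 𝒢) (z : G ⊗[k] B.carrier) : A.dT B (A.dT B z) = 0 := by
  induction z using TensorProduct.induction_on with
  | zero => simp
  | tmul x b => rw [dT_tmul, dT_tmul, A.d_d, TensorProduct.zero_tmul]
  | add a b ha hb => rw [map_add, map_add, ha, hb, add_zero]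

variable [DirectSum.Decomposition 𝒢]

/-- The Koszul sign rule `[x ⊗ a, y ⊗ b] = (-1)^{|a| |y|} [x, y] ⊗ a b`. -/
theorem brT_tmul (A : DGLA 𝒢) {j l : ℤ} (x y : G) {a : B.carrier} (b : B.carrier)
    (ha : a ∈ B.gr j) (hy : y ∈ 𝒢 l) :
    A.brT B (x ⊗ₜ a) (y ⊗ₜ b) = sgn k (j * l) • (A.br x y ⊗ₜ (a * b)) := by
  simp only [DGLA.brT, LinearMap.add_apply, TensorProduct.map₂_apply_tmul, LinearMap.comp_apply,
    scaleDeg_of_mem _ _ ha, map_smul]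
  rcases Int.even_or_odd j with h | h
  · rw [if_pos h, if_pos h, sgn_even (h.mul_right l)]
    simp
  · have h' : ¬ Even j := Int.not_even_iff_odd.2 h
    have hs : sgn k (j * l) = sgn k l := by
      rcases Int.even_or_odd l with h2 | h2
      · rw [sgn_even (h2.mul_left j), sgn_even h2]
      · rw [sgn_odd (h.mul h2), sgn_odd h2]
    rw [if_neg h', if_neg h', hs]
    simp [TensorProduct.smul_tmul', LinearMap.compl₂_apply, scaleDeg_of_mem _ _ hy]

theorem brT_mem (A : DGLA 𝒢) {s r t : ℕ} {n n' n'' : ℤ} (ht : s + r = t) (hn : n + n' = n'')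
    {y z : G ⊗[k] B.carrier} (hy : y ∈ filDeg 𝒢 B s n) (hz : z ∈ filDeg 𝒢 B r n') :
    A.brT B y z ∈ filDeg 𝒢 B t n'' := by
  refine filDeg_induction (p := fun y => A.brT B y z ∈ filDeg 𝒢 B t n'') ?_ ?_ ?_ hy
  · intro i j x a h hx ha hm
    refine filDeg_induction (p := fun z => A.brT B (x ⊗ₜ a) z ∈ filDeg 𝒢 B t n'') ?_ ?_ ?_ hz
    · intro i' j' x' a' h' hx' ha' hm'
      rw [brT_tmul A _ _ _ ha hx']
      refine Submodule.smul_mem _ _ (tmul_mem_filDeg (i := i + i') (j := j + j') (by omega)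
        (A.br_mem _ _ _ hx _ hx') (SetLike.mul_mem_graded ha ha') ?_)
      rw [← ht, pow_add]
      exact Submodule.mul_mem_mul hm hm'
    · simp
    · intro x y hx hy; rw [map_add]; exact add_mem hx hy
  · simp
  · intro x y hx hy; rw [map_add, LinearMap.add_apply]; exact add_mem hx hy

theorem brT_skew (A : DGLA 𝒢) {n n' : ℤ}
    {y z : G ⊗[k] B.carrier} (hy : y ∈ totDeg 𝒢 B n) (hz : z ∈ totDeg 𝒢 B n') :
    A.brT B y z = -(sgn k (n * n') • A.brT B z y) := by
  refine totDeg_induction (p := fun y => A.brT B y z = -(sgn k (n * n') • A.brT B z y)) ?_ ?_ ?_ hy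
  · intro i j x a h hx ha hm
    refine totDeg_induction
      (p := fun z => A.brT B (x ⊗ₜ a) z = -(sgn k (n * n') • A.brT B z (x ⊗ₜ a))) ?_ ?_ ?_ hz
    · intro i' j' x' a' h' hx' ha' hm'
      rw [brT_tmul A _ _ _ ha hx', brT_tmul A _ _ _ ha' hx, A.skew i i' x hx x' hx',
        B.comm j j' a ha a' ha', ← h, ← h']
      simp only [TensorProduct.neg_tmul, ← TensorProduct.smul_tmul', TensorProduct.tmul_smul,
        smul_neg, smul_smul]
      congr 2
      have e : (i + j) * (i' + j') = i * i' + j * i' + j * j' + i * j' := by ring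
      rw [e, sgn_add, sgn_add, sgn_add, mul_comm j' i, mul_assoc (_ * _ * _), sgn_mul_self]
      ring
    · simp
    · intro x y hx hy; rw [map_add, hx, hy, map_add, LinearMap.add_apply, smul_add, neg_add]
  · simp
  · intro x y hx hy; rw [map_add, LinearMap.add_apply, hx, hy, map_add, smul_add, neg_add]

theorem dT_brT (A : DGLA 𝒢) {n n' : ℤ}
    {y z : G ⊗[k] B.carrier} (hy : y ∈ totDeg 𝒢 B n) (hz : z ∈ totDeg 𝒢 B n') :
    A.dT B (A.brT B y z) = A.brT B (A.dT B y) z + sgn k n • A.brT B y (A.dT B z) := by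
  refine totDeg_induction (p := fun y => A.dT B (A.brT B y z) =
    A.brT B (A.dT B y) z + sgn k n • A.brT B y (A.dT B z)) ?_ ?_ ?_ hy
  · intro i j x a h hx ha hm
    refine totDeg_induction (p := fun z => A.dT B (A.brT B (x ⊗ₜ a) z) =
      A.brT B (A.dT B (x ⊗ₜ a)) z + sgn k n • A.brT B (x ⊗ₜ a) (A.dT B z)) ?_ ?_ ?_ hz
    · intro i' j' x' a' h' hx' ha' hm'
      rw [brT_tmul A _ _ _ ha hx', dT_tmul, dT_tmul, brT_tmul A _ _ _ ha hx',
        brT_tmul A _ _ _ ha (A.d_mem _ _ hx'), map_smul, dT_tmul, A.leibniz i x hx x', ← h]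
      simp only [TensorProduct.add_tmul, ← TensorProduct.smul_tmul', smul_add, smul_smul]
      congr 2
      rw [mul_add, mul_one, sgn_add, sgn_add]
      linear_combination (-sgn k (j * i') * sgn k i) * sgn_mul_self (k := k) j
    · simp
    · intro x y hx hy; simp only [map_add, hx, hy, smul_add]; abel
  · simp
  · intro x y hx hy; simp only [map_add, LinearMap.add_apply, hx, hy, smul_add]; abel

end Tensor

/-! ### Recursion for the terms of the Maurer-Cartan series -/

section Recursion

variable {k : Type*} [Field k] {L : Type*} [AddCommGroup L] [Module k L]
  (d η : L →ₗ[k] L) (br : L →ₗ[k] L →ₗ[k] L) (Γ ξ : L)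

/-- The sign `(-1)^{N(N+1)/2}` differs from its predecessor by `(-1)^N`; here `N = n + 3`. -/
theorem neg_one_pow_triangle (n : ℕ) :
    (-1 : k) ^ ((n + 3) * (n + 4) / 2) = (-1) ^ (n + 3) * (-1) ^ ((n + 2) * (n + 3) / 2) := by
  have h : (n + 3) * (n + 4) / 2 = (n + 3) + (n + 2) * (n + 3) / 2 := by
    rw [show (n + 3) * (n + 4) = (n + 2) * (n + 3) + (n + 3) * 2 by ring,
      Nat.add_mul_div_right _ _ (by norm_num), add_comm]
  rw [h, pow_add]

theorem mcTerm_zero : mcTerm d η br Γ 0 = -d Γ := by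
  simp [mcTerm, mu]

theorem mcTerm_one :
    mcTerm d η br Γ 1 = -((2 : k)⁻¹ • (d (η (br Γ Γ)) + η (d (br Γ Γ)))) := by
  simp [mcTerm, mu, div_eq_mul_inv, Nat.factorial]
  norm_num
  exact add_comm _ _

theorem twTerm_zero : twTerm d η br Γ ξ 0 = d ξ := by
  simp [twTerm, mu, Fin.snoc]

theorem twTerm_one : twTerm d η br Γ ξ 1 = d (η (br Γ ξ)) + η (d (br Γ ξ)) := by
  have h : (Fin.snoc (α := fun _ => L) (fun _ : Fin 1 => Γ) ξ) 0 = Γ := rfl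
  have h' : (Fin.snoc (α := fun _ => L) (fun _ : Fin 1 => Γ) ξ) 1 = ξ := rfl
  simp only [twTerm, mu, h, h']
  norm_num

/-- For `Γ` of degree `1` all shuffles contribute equally, with sign `+1`. -/
theorem mu_const (n : ℕ) :
    mu d η br (n + 2) (fun _ => 1) (fun _ => Γ) =
      ((-1 : k) ^ (n + 3) * (n + 3 : ℕ)) • η (br (mu d η br (n + 1) (fun _ => 1) (fun _ => Γ)) Γ) := by
  rw [mu]
  simp only [one_mul, sgn_odd odd_one, neg_neg, Finset.prod_const_one, one_smul, Finset.sum_const,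
    Finset.card_univ, Fintype.card_fin]
  rw [mul_smul, Nat.cast_smul_eq_nsmul]

theorem snoc_succAbove_castSucc {α : Type*} {n : ℕ} (a b : α) (i : Fin (n + 2)) :
    (fun j => Fin.snoc (α := fun _ => α) (fun _ : Fin (n + 2) => a) b (i.castSucc.succAbove j)) =
      Fin.snoc (α := fun _ => α) (fun _ : Fin (n + 1) => a) b := by
  funext j
  refine Fin.lastCases ?_ (fun j => ?_) j
  · rw [Fin.succAbove_castSucc_of_le _ _ (Fin.le_last i), Fin.succ_last, Fin.snoc_last,
      Fin.snoc_last]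
  · rw [Fin.castSucc_succAbove_castSucc, Fin.snoc_castSucc, Fin.snoc_castSucc]

/-- The shuffle moving `ξ` to the end has sign `+1`; those moving one of the `n + 2` copies of `Γ`
have sign `-1`, from the transposition with `ξ`. -/
theorem mu_snoc (n : ℕ) :
    mu d η br (n + 2) (Fin.snoc (α := fun _ => ℤ) (fun _ => 1) 0)
        (Fin.snoc (α := fun _ => L) (fun _ => Γ) ξ) =
      (-1 : k) ^ (n + 3) • (η (br (mu d η br (n + 1) (fun _ => 1) (fun _ => Γ)) ξ) -
        ((n + 2 : ℕ) : k) • η (br (mu d η br (n + 1) (Fin.snoc (α := fun _ => ℤ) (fun _ => 1) 0)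
          (Fin.snoc (α := fun _ => L) (fun _ => Γ) ξ)) Γ)) := by
  rw [mu, Fin.sum_univ_castSucc]
  congr 1
  have hp : ∀ i : Fin (n + 2), ∏ j ∈ Finset.Ioi i.castSucc,
      -sgn k ((Fin.snoc (α := fun _ => ℤ) (fun _ : Fin (n + 2) => 1) 0 : Fin (n + 3) → ℤ) i.castSucc *
        (Fin.snoc (α := fun _ => ℤ) (fun _ : Fin (n + 2) => 1) 0 : Fin (n + 3) → ℤ) j) = -1 := by
    intro i
    rw [Finset.prod_eq_single (Fin.last _)]
    · simp [sgn_zero]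
    · intro j _ hj
      obtain ⟨j, rfl⟩ := Fin.exists_castSucc_eq.2 hj
      simp [sgn_odd]
    · intro h
      exact absurd (Finset.mem_Ioi.2 (Fin.castSucc_lt_last i)) h
  simp only [hp]
  simp only [snoc_succAbove_castSucc, Fin.snoc_castSucc, Fin.snoc_last, Fin.succAbove_last,
    Finset.sum_const, Finset.card_univ, Fintype.card_fin]
  rw [show Finset.Ioi (Fin.last (n + 2)) = ∅ from Finset.Ioi_eq_empty.2 isMax_top,
    Finset.prod_empty, ← Nat.cast_smul_eq_nsmul k]
  simp only [one_smul, neg_smul, smul_neg]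
  abel

theorem neg_one_pow_mul_self (n : ℕ) : (-1 : k) ^ n * (-1) ^ n = 1 := by
  rw [← mul_pow]; simp

variable [CharZero k]

theorem mcTerm_succ (n : ℕ) :
    mcTerm d η br Γ (n + 2) = η (br (mcTerm d η br Γ (n + 1)) Γ) := by
  simp only [mcTerm, mu_const, map_smul, LinearMap.smul_apply, smul_smul]
  congr 1
  rw [show n + 2 + 1 = n + 3 from rfl, show n + 2 + 2 = n + 4 from rfl,
    show n + 1 + 1 = n + 2 from rfl, show n + 1 + 2 = n + 3 from rfl, neg_one_pow_triangle,
    Nat.factorial_succ (n + 2)]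
  have h1 : ((n + 2).factorial : k) ≠ 0 := Nat.cast_ne_zero.2 (Nat.factorial_ne_zero _)
  have h2 : ((n + 3 : ℕ) : k) ≠ 0 := Nat.cast_ne_zero.2 (by omega)
  rw [Nat.cast_mul, show n + 2 + 1 = n + 3 from rfl]
  field_simp
  linear_combination neg_one_pow_mul_self (k := k) (n + 3)

theorem twTerm_succ (n : ℕ) :
    twTerm d η br Γ ξ (n + 2) =
      -η (br (mcTerm d η br Γ (n + 1)) ξ) - η (br (twTerm d η br Γ ξ (n + 1)) Γ) := by
  simp only [mcTerm, twTerm, mu_snoc, map_smul, LinearMap.smul_apply, smul_smul, smul_sub]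
  rw [← neg_smul]
  have h1 : ((n + 1).factorial : k) ≠ 0 := Nat.cast_ne_zero.2 (Nat.factorial_ne_zero _)
  have h2 : ((n + 2 : ℕ) : k) ≠ 0 := Nat.cast_ne_zero.2 (by omega)
  have h3 := neg_one_pow_mul_self (k := k) (n + 3)
  have h4 : ((n + 2).factorial : k) = ((n + 2 : ℕ) : k) * ((n + 1).factorial : k) := by
    rw [Nat.factorial_succ (n + 1), Nat.cast_mul]
  congr 2
  · rw [show n + 2 + 1 = n + 3 from rfl, show n + 2 + 2 = n + 4 from rfl,
      show n + 1 + 1 = n + 2 from rfl, show n + 1 + 2 = n + 3 from rfl, neg_one_pow_triangle, h4]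
    field_simp
    linear_combination -h3
  · rw [show n + 2 + 1 = n + 3 from rfl, show n + 2 + 2 = n + 4 from rfl,
      show n + 1 + 1 = n + 2 from rfl, show n + 1 + 2 = n + 3 from rfl, neg_one_pow_triangle, h4]
    field_simp
    linear_combination -h3

end Recursion

/-! ### Fixed points of maps contracting the filtration -/

section Contraction

variable {k : Type u} [Field k] {G : Type v} [AddCommGroup G] [Module k G]
  {𝒢 : ℤ → Submodule k G} {B : GrArt k} {n : ℤ}

/-- A (nonlinear) self-map of `(𝔤 ⊗ m_B)ⁿ` which is contracting for the filtration by powers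
of the maximal ideal. -/
structure IsContracting (𝒢 : ℤ → Submodule k G) (B : GrArt k) (n : ℤ)
    (T : G ⊗[k] B.carrier → G ⊗[k] B.carrier) : Prop where
  mem : ∀ x ∈ totDeg 𝒢 B n, T x ∈ totDeg 𝒢 B n
  sub_mem_filDeg : ∀ s, ∀ x ∈ totDeg 𝒢 B n, ∀ y ∈ totDeg 𝒢 B n, x - y ∈ filDeg 𝒢 B s n →
    T x - T y ∈ filDeg 𝒢 B (s + 1) n

theorem IsContracting.eq_of_fixed {T : G ⊗[k] B.carrier → G ⊗[k] B.carrier}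
    (hT : IsContracting 𝒢 B n T) {x y : G ⊗[k] B.carrier} (hx : x ∈ totDeg 𝒢 B n)
    (hy : y ∈ totDeg 𝒢 B n) (hTx : T x = x) (hTy : T y = y) : x = y := by
  have h : ∀ s, x - y ∈ filDeg 𝒢 B (s + 1) n := by
    intro s
    induction s with
    | zero => rw [zero_add, filDeg_one]; exact sub_mem hx hy
    | succ s ih => simpa only [hTx, hTy] using hT.sub_mem_filDeg _ x hx y hy ih
  obtain ⟨N, hN⟩ := filDeg_eq_bot 𝒢 B
  have := h N
  rw [hN _ (Nat.le_succ N), Submodule.mem_bot] at this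
  exact sub_eq_zero.1 this

theorem IsContracting.iterate_mem {T : G ⊗[k] B.carrier → G ⊗[k] B.carrier}
    (hT : IsContracting 𝒢 B n T) (s : ℕ) : T^[s] 0 ∈ totDeg 𝒢 B n := by
  induction s with
  | zero => exact zero_mem _
  | succ s ih => rw [Function.iterate_succ_apply']; exact hT.mem _ ih

/-- The number of iterations which leads to the fixed point depends only on `B`. -/
theorem IsContracting.exists_iterate (𝒢 : ℤ → Submodule k G) (B : GrArt k) (n : ℤ) :
    ∃ N, ∀ T, IsContracting 𝒢 B n T → T (T^[N] 0) = T^[N] 0 := by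
  obtain ⟨N, hN⟩ := filDeg_eq_bot 𝒢 B
  refine ⟨N, fun T hT => ?_⟩
  have h : ∀ s, T^[s + 1] 0 - T^[s] 0 ∈ filDeg 𝒢 B (s + 1) n := by
    intro s
    induction s with
    | zero => rw [filDeg_one]; exact sub_mem (hT.iterate_mem _) (hT.iterate_mem _)
    | succ s ih =>
      have := hT.sub_mem_filDeg _ _ (hT.iterate_mem _) _ (hT.iterate_mem _) ih
      rwa [← Function.iterate_succ_apply' T, ← Function.iterate_succ_apply' T] at this
  have := h N
  rw [hN _ (Nat.le_succ N), Submodule.mem_bot, Function.iterate_succ_apply'] at this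
  exact sub_eq_zero.1 this

variable [DirectSum.Decomposition 𝒢] (A : DGLA 𝒢) {κ : G →ₗ[k] G}

theorem opT_brT_mem (hκ : ∀ i, ∀ x ∈ 𝒢 i, κ x ∈ 𝒢 (i - 1)) {s r t : ℕ} {n n' n'' : ℤ}
    (ht : s + r = t) (hn : n + n' - 1 = n'') {y z : G ⊗[k] B.carrier}
    (hy : y ∈ filDeg 𝒢 B s n) (hz : z ∈ filDeg 𝒢 B r n') :
    opT κ B (A.brT B y z) ∈ filDeg 𝒢 B t n'' :=
  opT_mem (e := -1) hκ hn (brT_mem A ht rfl hy hz)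

theorem opT_brT_mem_totDeg (hκ : ∀ i, ∀ x ∈ 𝒢 i, κ x ∈ 𝒢 (i - 1)) {n n' n'' : ℤ}
    (hn : n + n' - 1 = n'') {y z : G ⊗[k] B.carrier}
    (hy : y ∈ totDeg 𝒢 B n) (hz : z ∈ totDeg 𝒢 B n') :
    opT κ B (A.brT B y z) ∈ totDeg 𝒢 B n'' := by
  rw [← filDeg_one] at hy hz
  exact filDeg_le_totDeg (by norm_num) _ (opT_brT_mem A hκ (t := 2) rfl hn hy hz)

theorem isContracting_linear (hκ : ∀ i, ∀ x ∈ 𝒢 i, κ x ∈ 𝒢 (i - 1)) {Γ : G ⊗[k] B.carrier}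
    (hΓ : Γ ∈ totDeg 𝒢 B 1) {w : G ⊗[k] B.carrier} (hw : w ∈ totDeg 𝒢 B n) :
    IsContracting 𝒢 B n fun ξ => w - opT κ B (A.brT B Γ ξ) where
  mem x hx := sub_mem hw (opT_brT_mem_totDeg A hκ (by ring) hΓ hx)
  sub_mem_filDeg s x hx y hy h := by
    rw [← filDeg_one] at hΓ
    rw [sub_sub_sub_cancel_left, ← map_sub, ← map_sub, ← neg_sub x y, map_neg, map_neg]
    exact neg_mem (opT_brT_mem A hκ (add_comm 1 s) (by ring) hΓ h)

theorem isContracting_quadratic (hκ : ∀ i, ∀ x ∈ 𝒢 i, κ x ∈ 𝒢 (i - 1)) {z : G ⊗[k] B.carrier}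
    (hz : z ∈ totDeg 𝒢 B 1) :
    IsContracting 𝒢 B 1 fun Γ => z - (2 : k)⁻¹ • opT κ B (A.brT B Γ Γ) where
  mem x hx := sub_mem hz (Submodule.smul_mem _ _ (opT_brT_mem_totDeg A hκ (by ring) hx hx))
  sub_mem_filDeg s x hx y hy h := by
    have e : A.brT B y y - A.brT B x x = -(A.brT B (x - y) x + A.brT B y (x - y)) := by
      simp only [map_sub, LinearMap.sub_apply]; abel
    rw [sub_sub_sub_cancel_left, ← smul_sub, ← map_sub, e, map_neg, map_add]
    rw [← filDeg_one] at hx hy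
    exact Submodule.smul_mem _ _ (neg_mem (add_mem (opT_brT_mem A hκ rfl (by ring) h hx)
      (opT_brT_mem A hκ (add_comm 1 s) (by ring) hy h)))

/-- The nonlinear change of coordinates `Γ ↦ Γ + ½ κ [Γ, Γ]` of `(𝔤 ⊗ m_B)¹`. For `κ = η` it
carries the Maurer-Cartan equation of `μ_*` to the linear equation `d Γ = 0`. -/
def straighten (A : DGLA 𝒢) (κ : G →ₗ[k] G) (B : GrArt k) (Γ : G ⊗[k] B.carrier) :
    G ⊗[k] B.carrier :=
  Γ + (2 : k)⁻¹ • opT κ B (A.brT B Γ Γ)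

theorem tmap_straighten {B' : GrArt k} (f : B ⟶ B') (Γ : G ⊗[k] B.carrier) :
    tmap G f (straighten A κ B Γ) = straighten A κ B' (tmap G f Γ) := by
  simp only [straighten, map_add, map_smul, tmap_opT, tmap_brT]

variable {A}

theorem straighten_mem (hκ : ∀ i, ∀ x ∈ 𝒢 i, κ x ∈ 𝒢 (i - 1)) {Γ : G ⊗[k] B.carrier}
    (hΓ : Γ ∈ totDeg 𝒢 B 1) : straighten A κ B Γ ∈ totDeg 𝒢 B 1 :=
  add_mem hΓ (Submodule.smul_mem _ _ (opT_brT_mem_totDeg A hκ (by ring) hΓ hΓ))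

theorem straighten_inj (hκ : ∀ i, ∀ x ∈ 𝒢 i, κ x ∈ 𝒢 (i - 1)) {Γ Γ' : G ⊗[k] B.carrier}
    (hΓ : Γ ∈ totDeg 𝒢 B 1) (hΓ' : Γ' ∈ totDeg 𝒢 B 1)
    (h : straighten A κ B Γ = straighten A κ B Γ') : Γ = Γ' :=
  (isContracting_quadratic A hκ (straighten_mem hκ hΓ)).eq_of_fixed hΓ hΓ'
    (by rw [straighten, add_sub_cancel_right]) (by rw [h, straighten, add_sub_cancel_right])

theorem exists_straighten_eq (hκ : ∀ i, ∀ x ∈ 𝒢 i, κ x ∈ 𝒢 (i - 1)) {z : G ⊗[k] B.carrier}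
    (hz : z ∈ totDeg 𝒢 B 1) : ∃ Γ ∈ totDeg 𝒢 B 1, straighten A κ B Γ = z := by
  obtain ⟨N, hN⟩ := IsContracting.exists_iterate 𝒢 B 1
  have hT := isContracting_quadratic A hκ hz
  refine ⟨_, hT.iterate_mem N, ?_⟩
  rw [straighten]
  have h := hN _ hT
  exact (sub_eq_iff_eq_add.1 h).symm

end Contraction

/-! ### The Maurer-Cartan equation and the deformed differential in straightened coordinates -/

section MaurerCartan

theorem SumsTo.unique {L : Type*} [AddCommGroup L] {a : ℕ → L} {s s' : L}
    (h : SumsTo a s) (h' : SumsTo a s') : s = s' := by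
  obtain ⟨N, hN, hN'⟩ := (h.and h').exists
  rw [← hN, hN']

variable {k : Type u} [Field k] [CharZero k] {G : Type v} [AddCommGroup G] [Module k G]
  {𝒢 : ℤ → Submodule k G} {B : GrArt k} [DirectSum.Decomposition 𝒢] {A : DGLA 𝒢}
  {η : G →ₗ[k] G}

theorem mcTerm_mem (hη : ∀ i, ∀ x ∈ 𝒢 i, η x ∈ 𝒢 (i - 1)) {Γ : G ⊗[k] B.carrier}
    (hΓ : Γ ∈ totDeg 𝒢 B 1) (n : ℕ) :
    mcTerm (A.dT B) (opT η B) (A.brT B) Γ n ∈ filDeg 𝒢 B (n + 1) 2 := by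
  rw [← filDeg_one] at hΓ
  induction n with
  | zero => rw [mcTerm_zero]; exact neg_mem (dT_mem A (by norm_num) hΓ)
  | succ n ih =>
    cases n with
    | zero =>
      rw [zero_add, mcTerm_one]
      have h : A.brT B Γ Γ ∈ filDeg 𝒢 B 2 2 := brT_mem A (by norm_num) (by norm_num) hΓ hΓ
      have h1 : opT η B (A.brT B Γ Γ) ∈ filDeg 𝒢 B 2 1 := opT_mem (e := -1) hη (by norm_num) h
      have h2 : A.dT B (A.brT B Γ Γ) ∈ filDeg 𝒢 B 2 3 := dT_mem A (by norm_num) h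
      exact neg_mem (Submodule.smul_mem _ _ (add_mem (dT_mem A (by norm_num) h1)
        (opT_mem (e := -1) hη (by norm_num) h2)))
    | succ n => rw [mcTerm_succ]; exact opT_brT_mem A hη rfl (by norm_num) ih hΓ

theorem twTerm_mem (hη : ∀ i, ∀ x ∈ 𝒢 i, η x ∈ 𝒢 (i - 1)) {Γ ξ : G ⊗[k] B.carrier}
    (hΓ : Γ ∈ totDeg 𝒢 B 1) (hξ : ξ ∈ totDeg 𝒢 B 0) (n : ℕ) :
    twTerm (A.dT B) (opT η B) (A.brT B) Γ ξ n ∈ filDeg 𝒢 B (n + 1) 1 := by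
  have hmc := mcTerm_mem (A := A) hη hΓ
  rw [← filDeg_one] at hΓ hξ
  induction n with
  | zero => rw [twTerm_zero]; exact dT_mem A (by norm_num) hξ
  | succ n ih =>
    cases n with
    | zero =>
      rw [zero_add, twTerm_one]
      have h : A.brT B Γ ξ ∈ filDeg 𝒢 B 2 1 := brT_mem A (by norm_num) (by norm_num) hΓ hξ
      have h1 : opT η B (A.brT B Γ ξ) ∈ filDeg 𝒢 B 2 0 := opT_mem (e := -1) hη (by norm_num) h
      have h2 : A.dT B (A.brT B Γ ξ) ∈ filDeg 𝒢 B 2 2 := dT_mem A (by norm_num) h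
      exact add_mem (dT_mem A (by norm_num) h1) (opT_mem (e := -1) hη (by norm_num) h2)
    | succ n =>
      rw [twTerm_succ]
      exact sub_mem (neg_mem (opT_brT_mem A hη rfl (by norm_num) (hmc _) hξ))
        (opT_brT_mem A hη rfl (by norm_num) ih hΓ)

/-- A sequence whose `n`-th term lies in the `n + 1`-st step of the filtration is eventually zero. -/
theorem exists_eq_zero_of_mem_filDeg (𝒢 : ℤ → Submodule k G) (B : GrArt k) :
    ∃ N, ∀ (a : ℕ → G ⊗[k] B.carrier) (n : ℤ), (∀ i, a i ∈ filDeg 𝒢 B (i + 1) n) →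
      (∀ i, N ≤ i → a i = 0) := by
  obtain ⟨N, hN⟩ := filDeg_eq_bot 𝒢 B
  refine ⟨N, fun a n ha i hi => ?_⟩
  have := ha i
  rwa [hN _ (by omega), Submodule.mem_bot] at this

theorem sum_range_eq_of_eq_zero {L : Type*} [AddCommGroup L] {a : ℕ → L} {N : ℕ}
    (h : ∀ i, N ≤ i → a i = 0) {M : ℕ} (hM : N ≤ M) :
    ∑ i ∈ Finset.range M, a i = ∑ i ∈ Finset.range N, a i := by
  refine (Finset.sum_subset (Finset.range_mono hM) fun i _ hi => h i ?_).symm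
  simpa using hi

theorem sumsTo_of_eq_zero {L : Type*} [AddCommGroup L] {a : ℕ → L} {N : ℕ}
    (h : ∀ i, N ≤ i → a i = 0) : SumsTo a (∑ i ∈ Finset.range N, a i) := by
  filter_upwards [Filter.eventually_ge_atTop N] with M hM
  exact sum_range_eq_of_eq_zero h hM

/-- The curvature `F`, the sum of the Maurer-Cartan series of `Γ`, is determined by the
differential of `straighten Γ` through the equation `F = -d (Γ + ½ η [Γ, Γ]) + η [F, Γ]`, since
`η [·, Γ]` is nilpotent. -/
theorem exists_curvature (hη : ∀ i, ∀ x ∈ 𝒢 i, η x ∈ 𝒢 (i - 1)) {Γ : G ⊗[k] B.carrier}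
    (hΓ : Γ ∈ totDeg 𝒢 B 1) :
    ∃ F ∈ totDeg 𝒢 B 2, SumsTo (mcTerm (A.dT B) (opT η B) (A.brT B) Γ) F ∧
      F = -A.dT B (straighten A η B Γ) + opT η B (A.brT B F Γ) := by
  obtain ⟨N, hN⟩ := exists_eq_zero_of_mem_filDeg 𝒢 B
  set a := mcTerm (A.dT B) (opT η B) (A.brT B) Γ with ha
  have hmem : ∀ i, a i ∈ filDeg 𝒢 B (i + 1) 2 := mcTerm_mem hη hΓ
  have h0 := hN a 2 hmem
  refine ⟨_, ?_, sumsTo_of_eq_zero h0, ?_⟩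
  · exact sum_mem fun i _ => filDeg_le_totDeg (by omega) _ (hmem i)
  set F := ∑ i ∈ Finset.range N, a i with hF
  have e1 : F = ∑ i ∈ Finset.range N, a (i + 2) + a 1 + a 0 := by
    rw [hF, ← sum_range_eq_of_eq_zero h0 (show N ≤ N + 2 by omega), Finset.sum_range_succ',
      Finset.sum_range_succ']
  have e2 : F = ∑ i ∈ Finset.range N, a (i + 1) + a 0 := by
    rw [hF, ← sum_range_eq_of_eq_zero h0 (show N ≤ N + 1 by omega), Finset.sum_range_succ']
  have e3 : ∑ i ∈ Finset.range N, a (i + 2) = opT η B (A.brT B (F - a 0) Γ) := by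
    rw [e2, add_sub_cancel_right, map_sum, LinearMap.sum_apply, map_sum]
    exact Finset.sum_congr rfl fun i _ => mcTerm_succ _ _ _ _ i
  have hd : A.dT B (A.brT B Γ Γ) = (2 : k) • A.brT B (A.dT B Γ) Γ := by
    rw [dT_brT A hΓ hΓ, brT_skew A hΓ (dT_mem_totDeg (n' := 2) A rfl hΓ), sgn_odd odd_one,
      sgn_even (by decide)]
    rw [two_smul]; simp
  have hd' : opT η B (A.brT B (A.dT B Γ) Γ) = (2 : k)⁻¹ • opT η B (A.dT B (A.brT B Γ Γ)) := by
    rw [hd, map_smul, smul_smul, inv_mul_cancel₀ two_ne_zero, one_smul]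
  conv_lhs => rw [e1, e3, ha, mcTerm_one, mcTerm_zero, sub_neg_eq_add]
  simp only [straighten, map_add, LinearMap.add_apply, map_smul, hd', smul_add]
  abel

theorem sumsTo_mcTerm_iff (hη : ∀ i, ∀ x ∈ 𝒢 i, η x ∈ 𝒢 (i - 1)) {Γ : G ⊗[k] B.carrier}
    (hΓ : Γ ∈ totDeg 𝒢 B 1) :
    SumsTo (mcTerm (A.dT B) (opT η B) (A.brT B) Γ) 0 ↔ A.dT B (straighten A η B Γ) = 0 := by
  obtain ⟨F, hF, hs, he⟩ := exists_curvature (A := A) hη hΓ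
  constructor
  · intro h
    obtain rfl := hs.unique h
    simpa using he
  · intro h
    rw [h, neg_zero, zero_add, brT_skew A hF hΓ, sgn_even (by decide), one_smul, map_neg,
      ← zero_sub] at he
    have hT := isContracting_linear (n := 2) A hη hΓ (zero_mem _)
    rwa [hT.eq_of_fixed hF (zero_mem _) he.symm (by simp)] at hs

theorem isMC_iff (hη : ∀ i, ∀ x ∈ 𝒢 i, η x ∈ 𝒢 (i - 1)) {Γ : G ⊗[k] B.carrier} :
    IsMC A η B Γ ↔ Γ ∈ totDeg 𝒢 B 1 ∧ A.dT B (straighten A η B Γ) = 0 :=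
  and_congr_right fun h => sumsTo_mcTerm_iff hη h

/-- At a Maurer-Cartan element, the deformed differential `T = d_Γ ξ` is determined by
`T + η [Γ, T] = d (ξ + η [Γ, ξ])`; the left-hand side is the derivative of `straighten` at `Γ` in
the direction `T`. -/
theorem exists_deformed_differential (hη : ∀ i, ∀ x ∈ 𝒢 i, η x ∈ 𝒢 (i - 1))
    {Γ ξ : G ⊗[k] B.carrier} (hΓ : IsMC A η B Γ) (hξ : ξ ∈ totDeg 𝒢 B 0) :
    ∃ T ∈ totDeg 𝒢 B 1, SumsTo (twTerm (A.dT B) (opT η B) (A.brT B) Γ ξ) T ∧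
      T + opT η B (A.brT B Γ T) = A.dT B (ξ + opT η B (A.brT B Γ ξ)) := by
  obtain ⟨N, hN⟩ := exists_eq_zero_of_mem_filDeg 𝒢 B
  set a := mcTerm (A.dT B) (opT η B) (A.brT B) Γ with ha
  set b := twTerm (A.dT B) (opT η B) (A.brT B) Γ ξ with hb
  have h0 := hN a 2 (mcTerm_mem hη hΓ.1)
  have hmem : ∀ i, b i ∈ filDeg 𝒢 B (i + 1) 1 := twTerm_mem hη hΓ.1 hξ
  have h0' := hN b 1 hmem
  have hT : ∑ i ∈ Finset.range N, b i ∈ totDeg 𝒢 B 1 :=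
    sum_mem fun i _ => filDeg_le_totDeg (by omega) _ (hmem i)
  refine ⟨_, hT, sumsTo_of_eq_zero h0', ?_⟩
  set T := ∑ i ∈ Finset.range N, b i with hTdef
  have e0 : ∑ i ∈ Finset.range N, a (i + 1) + a 0 = 0 := by
    rw [← Finset.sum_range_succ', sum_range_eq_of_eq_zero h0 (by omega)]
    exact (sumsTo_of_eq_zero h0).unique hΓ.2
  have e1 : T = ∑ i ∈ Finset.range N, b (i + 2) + b 1 + b 0 := by
    rw [hTdef, ← sum_range_eq_of_eq_zero h0' (show N ≤ N + 2 by omega), Finset.sum_range_succ',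
      Finset.sum_range_succ']
  have e2 : T = ∑ i ∈ Finset.range N, b (i + 1) + b 0 := by
    rw [hTdef, ← sum_range_eq_of_eq_zero h0' (show N ≤ N + 1 by omega), Finset.sum_range_succ']
  have e3 : ∑ i ∈ Finset.range N, b (i + 2) =
      -opT η B (A.brT B (-a 0) ξ) - opT η B (A.brT B (T - b 0) Γ) := by
    rw [e2, add_sub_cancel_right, ← eq_neg_of_add_eq_zero_left e0]
    simp only [map_sum, LinearMap.sum_apply]
    rw [← Finset.sum_neg_distrib, ← Finset.sum_sub_distrib]
    exact Finset.sum_congr rfl fun i _ => twTerm_succ _ _ _ _ _ i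
  have hd : A.dT B (A.brT B Γ ξ) = A.brT B (A.dT B Γ) ξ - A.brT B (A.dT B ξ) Γ := by
    rw [dT_brT A hΓ.1 hξ, brT_skew A hΓ.1 (dT_mem_totDeg (n' := 1) A rfl hξ)]
    simp only [mul_one, sgn_odd odd_one]
    simp [sub_eq_add_neg]
  have hs : A.brT B Γ T = A.brT B T Γ := by
    rw [brT_skew A hΓ.1 hT]
    simp [sgn_odd odd_one]
  rw [hs]
  rw [e3, ha, hb, twTerm_one, twTerm_zero, mcTerm_zero, hd, neg_neg] at e1
  refine (congrArg (· + opT η B (A.brT B T Γ)) e1).trans ?_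
  simp only [map_add, map_sub, LinearMap.sub_apply]
  abel

end MaurerCartan

/-! ### Polynomial paths -/

section Paths

variable {k : Type*} [Field k] {L L' L'' : Type*} [AddCommGroup L] [Module k L]
  [AddCommGroup L'] [Module k L'] [AddCommGroup L''] [Module k L'']

/-- `f` is a polynomial path with coefficients in the subspace `S`, and `f'` is its derivative. -/
def IsPolyPath (S : Submodule k L) (f f' : k → L) : Prop :=
  ∃ c : ℕ →₀ L, (∀ j, c j ∈ S) ∧ (∀ t, pathEval c t = f t) ∧ ∀ t, pathDeriv c t = f' t

namespace IsPolyPath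

variable {S : Submodule k L} {S' : Submodule k L'} {S'' : Submodule k L''}
  {f f' g g' : k → L}

theorem add (hf : IsPolyPath S f f') (hg : IsPolyPath S g g') :
    IsPolyPath S (fun t => f t + g t) (fun t => f' t + g' t) := by
  obtain ⟨c, hc, h1, h2⟩ := hf
  obtain ⟨e, he, h3, h4⟩ := hg
  refine ⟨c + e, fun j => add_mem (hc j) (he j), fun t => ?_, fun t => ?_⟩
  · simp only [← h1, ← h3]; rw [pathEval, Finsupp.sum_add_index'] <;> simp [pathEval]
  · simp only [← h2, ← h4]; rw [pathDeriv, Finsupp.sum_add_index'] <;> simp [pathDeriv]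

theorem zero : IsPolyPath S (fun _ => 0) fun _ => 0 :=
  ⟨0, by simp, by simp [pathEval], by simp [pathDeriv]⟩

theorem sum {ι : Type*} (s : Finset ι) {f f' : ι → k → L} (h : ∀ i, IsPolyPath S (f i) (f' i)) :
    IsPolyPath S (fun t => ∑ i ∈ s, f i t) (fun t => ∑ i ∈ s, f' i t) := by
  classical
  induction s using Finset.induction_on with
  | empty => simpa using zero
  | insert a s ha ih => simpa only [Finset.sum_insert ha] using (h a).add ih

theorem monomial (n : ℕ) {x : L} (hx : x ∈ S) :
    IsPolyPath S (fun t => t ^ n • x) (fun t => ((n : k) * t ^ (n - 1)) • x) := by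
  refine ⟨Finsupp.single n x, fun j => ?_, fun t => ?_, fun t => ?_⟩
  · rw [Finsupp.single_apply]; split_ifs
    exacts [hx, zero_mem _]
  · simp [pathEval]
  · simp [pathDeriv]

theorem const {x : L} (hx : x ∈ S) : IsPolyPath S (fun _ => x) fun _ => 0 := by
  simpa using monomial (k := k) 0 hx

theorem line {x y : L} (hx : x ∈ S) (hy : y ∈ S) :
    IsPolyPath S (fun t : k => x + t • y) fun _ => y := by
  simpa using (const hx).add (monomial (k := k) 1 hy)

theorem map (hf : IsPolyPath S f f') (φ : L →ₗ[k] L') (hφ : ∀ x ∈ S, φ x ∈ S') :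
    IsPolyPath S' (fun t => φ (f t)) (fun t => φ (f' t)) := by
  obtain ⟨c, hc, h1, h2⟩ := hf
  refine ⟨c.mapRange φ (map_zero φ), fun j => by simpa using hφ _ (hc j), fun t => ?_, fun t => ?_⟩
  · simp only [← h1, tmap_pathEval]
  · simp only [← h2, tmap_pathDeriv]

theorem map₂ (hf : IsPolyPath S f f') {g g' : k → L'} (hg : IsPolyPath S' g g')
    (φ : L →ₗ[k] L' →ₗ[k] L'') (hφ : ∀ x ∈ S, ∀ y ∈ S', φ x y ∈ S'') :
    IsPolyPath S'' (fun t => φ (f t) (g t)) (fun t => φ (f' t) (g t) + φ (f t) (g' t)) := by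
  obtain ⟨c, hc, h1, h2⟩ := hf
  obtain ⟨e, he, h3, h4⟩ := hg
  have h := IsPolyPath.sum (k := k) c.support fun i => IsPolyPath.sum (k := k) e.support fun j =>
    monomial (k := k) (i + j) (hφ _ (hc i) _ (he j))
  convert h using 2 with t t
  · simp only [← h1, ← h3, pathEval, Finsupp.sum, map_sum, LinearMap.sum_apply, map_smul,
      LinearMap.smul_apply, pow_add, Finset.smul_sum]
    rw [Finset.sum_comm]
    refine Finset.sum_congr rfl fun i _ => Finset.sum_congr rfl fun j _ => ?_
    rw [smul_smul, mul_comm]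
  · simp only [← h1, ← h2, ← h3, ← h4, pathEval, pathDeriv, Finsupp.sum, map_sum,
      LinearMap.sum_apply, map_smul, LinearMap.smul_apply, Finset.smul_sum]
    rw [← Finset.sum_add_distrib, Finset.sum_comm (s := c.support)]
    refine Finset.sum_congr rfl fun j _ => ?_
    rw [← Finset.sum_add_distrib]
    refine Finset.sum_congr rfl fun i _ => ?_
    rw [smul_smul, smul_smul, ← add_smul]
    congr 1
    rcases i with _ | i
    · simp
    rcases j with _ | j
    · simp
    · rw [show i + 1 + (j + 1) - 1 = i + 1 + j by omega]
      simp only [Nat.add_sub_cancel, pow_add, pow_one]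
      push_cast
      ring

theorem congr (hf : IsPolyPath S f f') (h : ∀ t, f t = g t) (h' : ∀ t, f' t = g' t) :
    IsPolyPath S g g' := by
  obtain ⟨c, hc, h1, h2⟩ := hf
  exact ⟨c, hc, fun t => (h1 t).trans (h t), fun t => (h2 t).trans (h' t)⟩

theorem mem (hf : IsPolyPath S f f') (t : k) : f t ∈ S := by
  obtain ⟨c, hc, h1, h2⟩ := hf
  rw [← h1]
  exact sum_mem fun i _ => S.smul_mem _ (hc i)

theorem deriv_mem (hf : IsPolyPath S f f') (t : k) : f' t ∈ S := by
  obtain ⟨c, hc, h1, h2⟩ := hf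
  rw [← h2]
  exact sum_mem fun i _ => S.smul_mem _ (hc i)

theorem exists_polynomial (hf : IsPolyPath S f f') (l : L →ₗ[k] k) :
    ∃ P : Polynomial k, (∀ t, P.eval t = l (f t)) ∧ ∀ t, P.derivative.eval t = l (f' t) := by
  obtain ⟨c, hc, h1, h2⟩ := hf
  refine ⟨c.sum fun j x => Polynomial.monomial j (l x), fun t => ?_, fun t => ?_⟩
  · simp [← h1, pathEval, Finsupp.sum, Polynomial.eval_finsetSum, mul_comm]
  · simp only [← h2, Finsupp.sum, pathDeriv, map_sum, Polynomial.eval_finsetSum,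
      Polynomial.derivative_monomial, Polynomial.eval_monomial, map_smul, smul_eq_mul]
    exact Finset.sum_congr rfl fun j _ => by ring

/-- A polynomial path with derivative in the subspace `W` has constant class modulo `W`. -/
theorem sub_mem_of_deriv_mem [CharZero k] (hf : IsPolyPath S f f') {W : Submodule k L}
    (h : ∀ t, f' t ∈ W) (s t : k) : f s - f t ∈ W := by
  by_contra hW
  obtain ⟨l, hl, hlW⟩ := Submodule.exists_le_ker_of_notMem hW
  obtain ⟨P, hP, hP'⟩ := hf.exists_polynomial l
  have hd : P.derivative = 0 := Polynomial.funext fun t => by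
    rw [hP', Polynomial.eval_zero]
    exact hlW (h t)
  apply hl
  rw [map_sub, ← hP, ← hP, Polynomial.eq_C_of_derivative_eq_zero hd, Polynomial.eval_C,
    Polynomial.eval_C, sub_self]

theorem deriv_unique [Infinite k] (hf : IsPolyPath S f f') {T : Submodule k L}
    (hg : IsPolyPath T f g') (t : k) : f' t = g' t := by
  by_contra hne
  have h0 : f' t - g' t ∉ (⊥ : Submodule k L) := fun h => hne (sub_eq_zero.1 h)
  obtain ⟨l, hl, -⟩ := Submodule.exists_le_ker_of_notMem h0
  obtain ⟨P, hP, hP'⟩ := hf.exists_polynomial l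
  obtain ⟨Q, hQ, hQ'⟩ := hg.exists_polynomial l
  obtain rfl : P = Q := Polynomial.funext fun t => by rw [hP, hQ]
  exact hl (by rw [map_sub, ← hP', ← hQ', sub_self])

end IsPolyPath

end Paths

/-! ### Gauge classes of Maurer-Cartan elements and cohomology classes -/

section Gauge

variable {k : Type u} [Field k] {G : Type v} [AddCommGroup G] [Module k G]
  {𝒢 : ℤ → Submodule k G} {B : GrArt k} {A : DGLA 𝒢} {η : G →ₗ[k] G}

theorem mkQ_cobT_eq_iff (z z' : cocT A B) :
    (cobT A B).mkQ z = (cobT A B).mkQ z' ↔ z.1 - z'.1 ∈ (totDeg 𝒢 B 0).map (A.dT B) := by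
  rw [Submodule.mkQ_apply, Submodule.mkQ_apply, Submodule.Quotient.eq]
  rfl

variable [DirectSum.Decomposition 𝒢]

theorem brT_comm_of_one {y z : G ⊗[k] B.carrier} (hy : y ∈ totDeg 𝒢 B 1)
    (hz : z ∈ totDeg 𝒢 B 1) : A.brT B y z = A.brT B z y := by
  rw [brT_skew A hy hz]
  simp [sgn_odd odd_one]

variable [CharZero k]

/-- The chain rule for `straighten`. -/
theorem IsPolyPath.straighten (hη : ∀ i, ∀ x ∈ 𝒢 i, η x ∈ 𝒢 (i - 1))
    {f f' : k → G ⊗[k] B.carrier} (hf : IsPolyPath (totDeg 𝒢 B 1) f f') :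
    IsPolyPath (totDeg 𝒢 B 1) (fun t => FormalDef.straighten A η B (f t))
      (fun t => f' t + opT η B (A.brT B (f t) (f' t))) := by
  have h := hf.map₂ hf ((A.brT B).compr₂ (opT η B)) (S'' := totDeg 𝒢 B 1)
    fun x hx y hy => opT_brT_mem_totDeg A hη (by norm_num) hx hy
  have h2 := h.map ((2 : k)⁻¹ • LinearMap.id) (S' := totDeg 𝒢 B 1)
    fun x hx => Submodule.smul_mem _ _ hx
  refine (hf.add h2).congr (fun t => rfl) fun t => ?_
  simp only [LinearMap.compr₂_apply, LinearMap.smul_apply, LinearMap.id_apply]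
  rw [brT_comm_of_one (hf.deriv_mem t) (hf.mem t), ← two_smul k, smul_smul,
    inv_mul_cancel₀ two_ne_zero, one_smul]

theorem GaugePath.straighten_sub_mem (hη : ∀ i, ∀ x ∈ 𝒢 i, η x ∈ 𝒢 (i - 1)) {Γ₀ Γ₁ : MC A η B}
    (h : GaugePath A η B Γ₀ Γ₁) :
    straighten A η B Γ₁.1 - straighten A η B Γ₀.1 ∈ (totDeg 𝒢 B 0).map (A.dT B) := by
  obtain ⟨p, q, hp, hq, hmc, htw, h0, h1⟩ := h
  have hpath : IsPolyPath (totDeg 𝒢 B 1) (pathEval p) (pathDeriv p) :=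
    ⟨p, hp, fun _ => rfl, fun _ => rfl⟩
  have hpath' : IsPolyPath (totDeg 𝒢 B 0) (pathEval q) (pathDeriv q) :=
    ⟨q, hq, fun _ => rfl, fun _ => rfl⟩
  rw [← h0, ← h1]
  refine (hpath.straighten hη).sub_mem_of_deriv_mem (fun t => ?_) 1 0
  obtain ⟨T, hT, hs, he⟩ := exists_deformed_differential hη (hmc t) (hpath'.mem t)
  rw [(htw t).unique hs, he]
  exact Submodule.mem_map_of_mem (add_mem (hpath'.mem t)
    (opT_brT_mem_totDeg A hη (by norm_num) (hpath.mem t) (hpath'.mem t)))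

/-- The segment between cohomologous cocycles, in straightened coordinates, is a gauge path. -/
theorem gaugePath_of_straighten_sub_mem (hη : ∀ i, ∀ x ∈ 𝒢 i, η x ∈ 𝒢 (i - 1)) {Γ₀ Γ₁ : MC A η B}
    (h : straighten A η B Γ₁.1 - straighten A η B Γ₀.1 ∈ (totDeg 𝒢 B 0).map (A.dT B)) :
    GaugePath A η B Γ₀ Γ₁ := by
  obtain ⟨w, hw, hz⟩ := h
  have h0 := (isMC_iff hη).1 Γ₀.2
  have h1 := (isMC_iff hη).1 Γ₁.2
  set z₀ := straighten A η B Γ₀.1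
  have hz₀m : z₀ ∈ totDeg 𝒢 B 1 := straighten_mem hη h0.1
  have hdw : A.dT B w ∈ totDeg 𝒢 B 1 := dT_mem_totDeg A (by norm_num) hw
  have hline := IsPolyPath.line (k := k) hz₀m hdw
  -- the polynomial path `p` of elements with `straighten (p t) = z₀ + t • d w`
  obtain ⟨N, hN⟩ := IsContracting.exists_iterate 𝒢 B 1
  let T : k → G ⊗[k] B.carrier → G ⊗[k] B.carrier := fun t Γ =>
    (z₀ + t • A.dT B w) - (2 : k)⁻¹ • opT η B (A.brT B Γ Γ)
  have hTc : ∀ t, IsContracting 𝒢 B 1 (T t) := fun t => isContracting_quadratic A hη (hline.mem t)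
  have hpoly : ∀ s, ∃ f', IsPolyPath (totDeg 𝒢 B 1) (fun t => (T t)^[s] 0) f' := by
    intro s
    induction s with
    | zero => exact ⟨_, IsPolyPath.zero⟩
    | succ s ih =>
      obtain ⟨f', hf⟩ := ih
      have h := hf.map₂ hf ((A.brT B).compr₂ (opT η B)) (S'' := totDeg 𝒢 B 1)
        fun x hx y hy => opT_brT_mem_totDeg A hη (by norm_num) hx hy
      have h2 := h.map (-((2 : k)⁻¹ • LinearMap.id)) (S' := totDeg 𝒢 B 1)
        fun x hx => neg_mem (Submodule.smul_mem _ _ hx)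
      refine ⟨_, (hline.add h2).congr (fun t => ?_) fun t => rfl⟩
      simp [T, Function.iterate_succ_apply', sub_eq_add_neg]
  obtain ⟨f', hf⟩ := hpoly N
  set f : k → G ⊗[k] B.carrier := fun t => (T t)^[N] 0
  have hfs : ∀ t, straighten A η B (f t) = z₀ + t • A.dT B w := fun t => by
    have h := hN _ (hTc t)
    exact (sub_eq_iff_eq_add.1 h).symm
  have hfmc : ∀ t, IsMC A η B (f t) := fun t => by
    refine (isMC_iff hη).2 ⟨hf.mem t, ?_⟩
    rw [hfs, map_add, map_smul, dT_dT, smul_zero, add_zero, h0.2]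
  -- the polynomial path `g` with `g t + η [f t, g t] = w`
  obtain ⟨M, hM⟩ := IsContracting.exists_iterate 𝒢 B 0
  let U : k → G ⊗[k] B.carrier → G ⊗[k] B.carrier := fun t ξ => w - opT η B (A.brT B (f t) ξ)
  have hUc : ∀ t, IsContracting 𝒢 B 0 (U t) := fun t => isContracting_linear A hη (hf.mem t) hw
  have hpoly' : ∀ s, ∃ f', IsPolyPath (totDeg 𝒢 B 0) (fun t => (U t)^[s] 0) f' := by
    intro s
    induction s with
    | zero => exact ⟨_, IsPolyPath.zero⟩
    | succ s ih =>
      obtain ⟨g', hg⟩ := ih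
      have h := hf.map₂ hg ((A.brT B).compr₂ (opT η B)) (S'' := totDeg 𝒢 B 0)
        fun x hx y hy => opT_brT_mem_totDeg A hη (by norm_num) hx hy
      have h2 := h.map (-LinearMap.id) (S' := totDeg 𝒢 B 0) fun x hx => neg_mem hx
      refine ⟨_, ((IsPolyPath.const hw).add h2).congr (fun t => ?_) fun t => rfl⟩
      simp [U, Function.iterate_succ_apply', sub_eq_add_neg]
  obtain ⟨g', hg⟩ := hpoly' M
  set g : k → G ⊗[k] B.carrier := fun t => (U t)^[M] 0
  have hgs : ∀ t, g t + opT η B (A.brT B (f t) (g t)) = w := fun t => by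
    have h := hM _ (hUc t)
    exact (sub_eq_iff_eq_add.1 h).symm
  -- the derivative of `f` and the deformed differential of `g` solve the same linear equation
  have hderiv : ∀ t, f' t + opT η B (A.brT B (f t) (f' t)) = A.dT B w := by
    exact fun t => ((hf.straighten hη (A := A)).congr hfs fun _ => rfl).deriv_unique hline t
  have htw : ∀ t, SumsTo (twTerm (A.dT B) (opT η B) (A.brT B) (f t) (g t)) (f' t) := by
    intro t
    obtain ⟨T', hT', hs, he⟩ := exists_deformed_differential hη (hfmc t) (hg.mem t)
    rw [hgs] at he
    have hc := isContracting_linear A hη (hf.mem t) hdw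
    rwa [hc.eq_of_fixed hT' (hf.deriv_mem t) (by rw [← he, add_sub_cancel_right])
      (by rw [← hderiv t, add_sub_cancel_right])] at hs
  obtain ⟨p, hp, hp1, hp2⟩ := hf
  obtain ⟨q, hq, hq1, hq2⟩ := hg
  refine ⟨p, q, hp, hq, fun t => ?_, fun t => ?_, ?_, ?_⟩
  · rw [hp1]; exact hfmc t
  · rw [hp1, hq1, hp2]; exact htw t
  · rw [hp1]
    refine straighten_inj (A := A) hη (hfmc 0).1 h0.1 ?_
    rw [hfs, zero_smul, add_zero]
  · rw [hp1]
    refine straighten_inj (A := A) hη (hfmc 1).1 h1.1 ?_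
    rw [hfs, one_smul, hz]
    abel

/-- The cocycle of a Maurer-Cartan element, in straightened coordinates. -/
def MC.cocycle (hη : ∀ i, ∀ x ∈ 𝒢 i, η x ∈ 𝒢 (i - 1)) (Γ : MC A η B) : cocT A B :=
  ⟨straighten A η B Γ.1, ((isMC_iff hη).1 Γ.2).2, straighten_mem hη Γ.2.1⟩

/-- Gauge classes of Maurer-Cartan elements correspond to classes of cocycles. -/
def gaugeClassEquiv (hη : ∀ i, ∀ x ∈ 𝒢 i, η x ∈ 𝒢 (i - 1)) :
    Quot (GaugePath A η B) ≃ ↥(cocT A B) ⧸ cobT A B :=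
  Equiv.ofBijective
    (Quot.lift (fun Γ => (cobT A B).mkQ (MC.cocycle hη Γ)) fun Γ Γ' h => by
      rw [eq_comm, mkQ_cobT_eq_iff]
      exact h.straighten_sub_mem hη)
    (by
      constructor
      · intro x y
        induction x using Quot.ind with | mk x => ?_
        induction y using Quot.ind with | mk y => ?_
        intro h
        refine Quot.sound (gaugePath_of_straighten_sub_mem hη ?_)
        exact (mkQ_cobT_eq_iff _ _).1 h.symm
      · intro z
        obtain ⟨z, rfl⟩ := (cobT A B).mkQ_surjective z
        obtain ⟨Γ, hΓ, h⟩ := exists_straighten_eq (A := A) hη z.2.2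
        have hmc : IsMC A η B Γ := (isMC_iff hη).2 ⟨hΓ, by rw [h]; exact z.2.1⟩
        exact ⟨Quot.mk _ ⟨Γ, hmc⟩, congrArg _ (Subtype.ext h)⟩)

variable (A) in
/-- The modified deformation functor is isomorphic to the linear functor. -/
def mdefIsoDefLin (hη : ∀ i, ∀ x ∈ 𝒢 i, η x ∈ 𝒢 (i - 1)) : MDefZ A η ≅ DefLin A :=
  NatIso.ofComponents (fun _ => (gaugeClassEquiv hη).toIso) fun f => by
    ext x
    induction x using Quot.ind with
    | mk Γ =>
      exact congrArg (cobT A _).mkQ (Subtype.ext (tmap_straighten A f Γ.1).symm)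

end Gauge

/-! ### Homotopy data relating a complex with its cohomology -/

section Homotopy

variable {k : Type u} [Field k] {G : Type v} [AddCommGroup G] [Module k G]
  {𝒢 : ℤ → Submodule k G}

/-- Homotopy data for the complex `(𝔤, d)` in the degrees `i ∈ D`: cocycles `s α` of degree
`1 - deg α`, coordinates `p` dual to them which vanish on coboundaries, and operators `h`, `τ` with
`x = s (p x) + d (h x) + τ (d x)`. As the conditions are linear identities, they persist after
tensoring with any `B`. -/
structure HomotopyData (A : DGLA 𝒢) {I : Type v} (deg : I → ℤ) (D : Set ℤ) where
  s : I → G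
  p : G →ₗ[k] I →₀ k
  h : G →ₗ[k] G
  τ : G →ₗ[k] G
  s_mem : ∀ α, s α ∈ 𝒢 (1 - deg α)
  d_s : ∀ α, A.d (s α) = 0
  p_s : ∀ α, p (s α) = Finsupp.single α 1
  p_d : ∀ x, p (A.d x) = 0
  p_deg : ∀ i, ∀ x ∈ 𝒢 i, ∀ α, p x α ≠ 0 → deg α = 1 - i
  h_mem : ∀ i, ∀ x ∈ 𝒢 i, h x ∈ 𝒢 (i - 1)
  decomp : ∀ i ∈ D, ∀ x ∈ 𝒢 i,
    x = Finsupp.linearCombination k s (p x) + A.d (h x) + τ (A.d x)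

variable [DirectSum.Decomposition 𝒢]

/-- The linear map on a graded vector space with prescribed components. -/
def ofComponents (𝒢 : ℤ → Submodule k G) [DirectSum.Decomposition 𝒢] {M : Type*} [AddCommGroup M]
    [Module k M] (f : ∀ i, 𝒢 i →ₗ[k] M) : G →ₗ[k] M :=
  DirectSum.toModule k ℤ M f ∘ₗ (DirectSum.decomposeLinearEquiv 𝒢).toLinearMap

theorem ofComponents_of_mem {M : Type*} [AddCommGroup M] [Module k M] (f : ∀ i, 𝒢 i →ₗ[k] M)
    {i : ℤ} {x : G} (hx : x ∈ 𝒢 i) : ofComponents 𝒢 f x = f i ⟨x, hx⟩ := by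
  simp only [ofComponents, LinearMap.comp_apply, LinearEquiv.coe_coe,
    DirectSum.decomposeLinearEquiv_apply, DirectSum.decompose_of_mem 𝒢 hx]
  rw [← DirectSum.lof_eq_of k, DirectSum.toModule_lof]

theorem exists_pseudo_inverse {V W : Type*} [AddCommGroup V] [Module k V] [AddCommGroup W]
    [Module k W] (f : V →ₗ[k] W) : ∃ g : W →ₗ[k] V, ∀ x, f (g (f x)) = f x := by
  obtain ⟨g, hg⟩ := f.rangeRestrict.exists_rightInverse_of_surjective f.range_rangeRestrict
  obtain ⟨g', hg'⟩ := LinearMap.exists_extend g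
  refine ⟨g', fun x => ?_⟩
  have h1 : g' (f x) = g (f.rangeRestrict x) := LinearMap.congr_fun hg' (f.rangeRestrict x)
  rw [h1]
  exact congrArg Subtype.val (LinearMap.congr_fun hg (f.rangeRestrict x))

/-- A graded pseudo-inverse of the differential. -/
theorem DGLA.exists_pseudo_inverse (A : DGLA 𝒢) :
    ∃ τ : G →ₗ[k] G, (∀ i, ∀ x ∈ 𝒢 i, τ x ∈ 𝒢 (i - 1)) ∧ ∀ x, A.d (τ (A.d x)) = A.d x := by
  choose g hg using fun i => FormalDef.exists_pseudo_inverse (A.d ∘ₗ (𝒢 i).subtype)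
  have hτ : ∀ i, ∀ x ∈ 𝒢 i,
      ofComponents 𝒢 (fun j => (𝒢 (j - 1)).subtype ∘ₗ g (j - 1) ∘ₗ (𝒢 j).subtype) x =
        g (i - 1) x := fun i x hx => ofComponents_of_mem _ hx
  refine ⟨ofComponents 𝒢 fun j => (𝒢 (j - 1)).subtype ∘ₗ g (j - 1) ∘ₗ (𝒢 j).subtype, ?_, ?_⟩
  · intro i x hx
    rw [hτ i x hx]
    exact (g (i - 1) x).2
  · intro x
    induction x using DirectSum.Decomposition.inductionOn 𝒢 with
    | zero => simp
    | @homogeneous i x =>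
      rw [hτ _ _ (A.d_mem i x x.2), add_sub_cancel_right]
      exact hg i x
    | add x y hx hy => simp only [map_add, hx, hy]

/-- Bases of the cohomology spaces in the degrees `i ∈ D` give homotopy data in these degrees. -/
theorem DGLA.exists_homotopyData (A : DGLA 𝒢) {I : Type v} (deg : I → ℤ) (D : Set ℤ)
    (b : ∀ i ∈ D, Module.Basis {α // deg α = 1 - i} k (A.coh i)) (hD : ∀ α, 1 - deg α ∈ D) :
    Nonempty (HomotopyData A deg D) := by
  classical
  obtain ⟨τ, hτ, hdτ⟩ := A.exists_pseudo_inverse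
  -- a projection onto the cocycles
  have hτd : ∀ i, ∀ x ∈ 𝒢 i, τ (A.d x) ∈ 𝒢 i := fun i x hx => by
    simpa using hτ _ _ (A.d_mem i x hx)
  have hπ : ∀ i, ∀ x : 𝒢 i, (LinearMap.id - τ ∘ₗ A.d : G →ₗ[k] G) x ∈ A.cocycles i := by
    intro i x
    refine ⟨?_, sub_mem x.2 (hτd i x x.2)⟩
    change A.d (x - τ (A.d x)) = 0
    rw [map_sub, hdτ, sub_self]
  let π : ∀ i, 𝒢 i →ₗ[k] A.cocycles i := fun i =>
    ((LinearMap.id - τ ∘ₗ A.d) ∘ₗ (𝒢 i).subtype).codRestrict _ (hπ i)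
  have hπ_coe : ∀ i (x : 𝒢 i), (π i x : G) = x - τ (A.d x) := fun i x => rfl
  have hπ_of : ∀ i (x : 𝒢 i) (hx : A.d x = 0), π i x = ⟨x, hx, x.2⟩ := fun i x hx =>
    Subtype.ext (by rw [hπ_coe, hx, map_zero, sub_zero])
  let cls : ∀ i, A.cocycles i →ₗ[k] A.coh i := fun i => Submodule.mkQ _
  have hcls : ∀ i (z : A.cocycles i), cls i z = 0 ↔ ∃ w ∈ 𝒢 (i - 1), A.d w = z := fun i z =>
    Submodule.Quotient.mk_eq_zero _
  choose r hr using fun i => (Submodule.mkQ_surjective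
    (((𝒢 (i - 1)).map A.d).submoduleOf (A.cocycles i)))
  let s : I → G := fun α => r (1 - deg α) (b _ (hD α) ⟨α, by ring⟩)
  have hs : ∀ i (hi : i ∈ D) (α : {α // deg α = 1 - i}), s α = r i (b i hi α) := by
    rintro i hi ⟨α, hα⟩
    obtain rfl : i = 1 - deg α := by omega
    rfl
  let co : ∀ i, 𝒢 i →ₗ[k] I →₀ k := fun i =>
    if hi : i ∈ D then
      Finsupp.lmapDomain k k Subtype.val ∘ₗ (b i hi).repr.toLinearMap ∘ₗ cls i ∘ₗ π i
    else 0
  have hco : ∀ i (hi : i ∈ D) x,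
      co i x = Finsupp.mapDomain Subtype.val ((b i hi).repr (cls i (π i x))) := fun i hi x => by
    simp only [co, dif_pos hi]; rfl
  let p : G →ₗ[k] I →₀ k := ofComponents 𝒢 co
  have hp : ∀ i x (hx : x ∈ 𝒢 i), p x = co i ⟨x, hx⟩ := fun i x hx => ofComponents_of_mem _ hx
  have hs_mem : ∀ α, s α ∈ 𝒢 (1 - deg α) := fun α => (r _ _).2.2
  have hs_d : ∀ α, A.d (s α) = 0 := fun α => (r _ _).2.1
  have hp_deg : ∀ i, ∀ x ∈ 𝒢 i, ∀ α, p x α ≠ 0 → deg α = 1 - i := by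
    intro i x hx α h
    by_contra hne
    apply h
    rw [hp i x hx]
    by_cases hi : i ∈ D
    · rw [hco i hi]
      exact Finsupp.mapDomain_of_notMem_range _ _ (by simpa using hne)
    · simp [co, dif_neg hi]
  have hsp : ∀ i, ∀ x ∈ 𝒢 i, Finsupp.linearCombination k s (p x) ∈ 𝒢 i := by
    intro i x hx
    refine sum_mem fun α hα => Submodule.smul_mem _ _ ?_
    have h := hp_deg i x hx α (Finsupp.mem_support_iff.1 hα)
    have h2 := hs_mem α
    rwa [h, sub_sub_cancel] at h2
  refine ⟨⟨s, p, τ ∘ₗ (LinearMap.id - τ ∘ₗ A.d - Finsupp.linearCombination k s ∘ₗ p), τ, hs_mem,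
    hs_d, ?_, ?_, hp_deg, ?_, ?_⟩⟩
  · intro α
    rw [hp _ _ (hs_mem α), hco _ (hD α), hπ_of _ _ (hs_d α)]
    have : cls (1 - deg α) ⟨s α, hs_d α, hs_mem α⟩ = b _ (hD α) ⟨α, by ring⟩ := hr _ _
    rw [this, Module.Basis.repr_self, Finsupp.mapDomain_single]
  · intro x
    induction x using DirectSum.Decomposition.inductionOn 𝒢 with
    | zero => simp
    | @homogeneous i x =>
      rw [hp _ _ (A.d_mem i x x.2)]
      by_cases hi : i + 1 ∈ D
      · rw [hco _ hi, hπ_of _ _ (A.d_d x), (hcls _ _).2, map_zero, Finsupp.mapDomain_zero]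
        exact ⟨x, by simp, rfl⟩
      · simp [co, dif_neg hi]
    | add x y hx hy => rw [map_add, map_add, hx, hy, add_zero]
  · intro i x hx
    exact hτ i _ (sub_mem (sub_mem hx (hτd i x hx)) (hsp i x hx))
  · intro i hi x hx
    have hmem : Finsupp.linearCombination k s (p x) ∈ A.cocycles i := by
      refine ⟨?_, hsp i x hx⟩
      change A.d _ = 0
      rw [Finsupp.linearCombination_apply, Finsupp.sum, map_sum]
      exact Finset.sum_eq_zero fun α _ => by rw [map_smul, hs_d, smul_zero]
    have hzero : cls i (π i ⟨x, hx⟩ - ⟨_, hmem⟩) = 0 := by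
      set c := (b i hi).repr (cls i (π i ⟨x, hx⟩)) with hc
      have e : (⟨_, hmem⟩ : A.cocycles i) =
          Finsupp.linearCombination k (fun α => r i (b i hi α)) c := by
        refine Subtype.ext ?_
        change Finsupp.linearCombination k s (p x) = _
        rw [hp i x hx, hco i hi, Finsupp.linearCombination_mapDomain, ← hc,
          Finsupp.linearCombination_apply, Finsupp.linearCombination_apply, Finsupp.sum,
          Finsupp.sum, Submodule.coe_sum]
        exact Finset.sum_congr rfl fun α _ => by rw [Function.comp_apply, hs i hi]; rfl
      rw [map_sub, e, Finsupp.linearCombination_apply, Finsupp.sum, map_sum, sub_eq_zero,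
        ← (b i hi).linearCombination_repr (cls i (π i ⟨x, hx⟩)), ← hc,
        Finsupp.linearCombination_apply, Finsupp.sum]
      refine Finset.sum_congr rfl fun α _ => ?_
      rw [map_smul]
      exact congrArg _ (hr i _).symm
    obtain ⟨w, hw, hdw⟩ := (hcls i _).1 hzero
    have e2 : x - τ (A.d x) - Finsupp.linearCombination k s (p x) = A.d w := hdw.symm
    change x = _ + A.d (τ (x - τ (A.d x) - Finsupp.linearCombination k s (p x))) + _
    rw [e2, hdτ, ← e2]
    abel

end Homotopy

/-! ### The linear functor in coordinates -/

section Families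

variable {k : Type u} [Field k]

/-- Finitely supported families of elements `β α ∈ m_B` of degree `deg α`. -/
def families {I : Type v} (deg : I → ℤ) (B : GrArt k) : Submodule k (I →₀ B.carrier) where
  carrier := {β | ∀ α, β α ∈ B.gr (deg α) ∧ β α ∈ B.m}
  add_mem' h h' α := ⟨add_mem (h α).1 (h' α).1, add_mem (h α).2 (h' α).2⟩
  zero_mem' _ := ⟨zero_mem _, zero_mem _⟩
  smul_mem' c _ h α := ⟨Submodule.smul_mem _ c (h α).1, Submodule.smul_mem _ c (h α).2⟩

/-- The action of a morphism of Artin algebras on families. -/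
def families.map {I : Type v} {deg : I → ℤ} {B B' : GrArt k} (f : B ⟶ B') (β : families deg B) :
    families deg B' :=
  ⟨β.1.mapRange (GrArt.hom f) (map_zero _), fun α => by
    rw [Finsupp.mapRange_apply]
    exact ⟨GrArt.hom_gr f (β.2 α).1, GrArt.hom_m f (β.2 α).2⟩⟩

variable {G : Type v} [AddCommGroup G] [Module k G] {𝒢 : ℤ → Submodule k G} {A : DGLA 𝒢}
  {I : Type v} {deg : I → ℤ} {D : Set ℤ} {B : GrArt k}

/-- The element `∑ s α ⊗ β α` of `𝔤 ⊗ B`. -/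
def tensorFamily (s : I → G) (B : GrArt k) : (I →₀ B.carrier) →ₗ[k] G ⊗[k] B.carrier :=
  Finsupp.lsum k fun α => TensorProduct.mk k G B.carrier (s α)

theorem tensorFamily_single (s : I → G) (α : I) (b : B.carrier) :
    tensorFamily s B (Finsupp.single α b) = s α ⊗ₜ b := by
  simp [tensorFamily]

theorem tensorFamily_eq_sum (s : I → G) (β : I →₀ B.carrier) :
    tensorFamily s B β = ∑ α ∈ β.support, s α ⊗ₜ β α := by
  simp [tensorFamily, Finsupp.sum]

theorem tmap_tensorFamily (s : I → G) {B' : GrArt k} (f : B ⟶ B') (β : I →₀ B.carrier) :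
    tmap G f (tensorFamily s B β) =
      tensorFamily s B' (β.mapRange (GrArt.hom f) (map_zero _)) := by
  induction β using Finsupp.induction_linear with
  | zero => simp
  | add x y hx hy => rw [map_add, map_add, hx, hy, Finsupp.mapRange_add (map_add _), map_add]
  | single α b => rw [tensorFamily_single, Finsupp.mapRange_single, tensorFamily_single, tmap_tmul]

open Classical in
/-- The coordinates `p ⊗ 1` of an element of `𝔤 ⊗ B`. -/
def coordT (p : G →ₗ[k] I →₀ k) (B : GrArt k) : G ⊗[k] B.carrier →ₗ[k] I →₀ B.carrier :=
  (TensorProduct.finsuppScalarLeft k B.carrier I).toLinearMap ∘ₗ p.rTensor B.carrier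

theorem coordT_tmul_apply (p : G →ₗ[k] I →₀ k) (x : G) (b : B.carrier) (α : I) :
    coordT p B (x ⊗ₜ b) α = p x α • b := by
  simp [coordT]

variable (H : HomotopyData A deg D)

theorem HomotopyData.coordT_dT (z : G ⊗[k] B.carrier) : coordT H.p B (A.dT B z) = 0 := by
  induction z using TensorProduct.induction_on with
  | zero => simp
  | tmul x b => ext α; rw [dT_tmul, coordT_tmul_apply, H.p_d]; simp
  | add x y hx hy => rw [map_add, map_add, hx, hy, add_zero]

theorem HomotopyData.coordT_tensorFamily (β : I →₀ B.carrier) :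
    coordT H.p B (tensorFamily H.s B β) = β := by
  classical
  induction β using Finsupp.induction_linear with
  | zero => simp
  | add x y hx hy => rw [map_add, map_add, hx, hy]
  | single α b =>
    ext γ
    rw [tensorFamily_single, coordT_tmul_apply, H.p_s, Finsupp.single_apply, Finsupp.single_apply]
    split_ifs <;> simp

theorem HomotopyData.coordT_mem {z : G ⊗[k] B.carrier} (hz : z ∈ totDeg 𝒢 B 1) :
    coordT H.p B z ∈ families deg B := by
  refine totDeg_induction (p := fun z => coordT H.p B z ∈ families deg B) ?_ ?_ ?_ hz
  · intro i j x b h hx hb hm α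
    rw [coordT_tmul_apply]
    by_cases h0 : H.p x α = 0
    · rw [h0, zero_smul]; exact ⟨zero_mem _, zero_mem _⟩
    · obtain rfl : j = deg α := by rw [H.p_deg i x hx α h0]; omega
      exact ⟨Submodule.smul_mem _ _ hb, Submodule.smul_mem _ _ hm⟩
  · rw [map_zero]; exact zero_mem _
  · intro x y hx hy; rw [map_add]; exact add_mem hx hy

theorem HomotopyData.tensorFamily_mem {β : I →₀ B.carrier} (hβ : β ∈ families deg B) :
    tensorFamily H.s B β ∈ cocT A B := by
  rw [tensorFamily_eq_sum]
  refine sum_mem fun α _ => ⟨?_, tmul_mem_totDeg (by ring) (H.s_mem α) (hβ α).1 (hβ α).2⟩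
  change A.dT B _ = 0
  rw [dT_tmul, H.d_s, TensorProduct.zero_tmul]

theorem HomotopyData.decompT (hB : ∀ i ∉ D, ∀ b ∈ B.gr (1 - i), b = 0) {z : G ⊗[k] B.carrier}
    (hz : z ∈ totDeg 𝒢 B 1) :
    z = tensorFamily H.s B (coordT H.p B z) + A.dT B (opT H.h B z) + opT H.τ B (A.dT B z) := by
  classical
  refine totDeg_induction (p := fun z => z = tensorFamily H.s B (coordT H.p B z) +
    A.dT B (opT H.h B z) + opT H.τ B (A.dT B z)) ?_ ?_ ?_ hz
  · intro i j x b h hx hb hm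
    by_cases hi : i ∈ D
    · have e : tensorFamily H.s B (coordT H.p B (x ⊗ₜ b)) =
          Finsupp.linearCombination k H.s (H.p x) ⊗ₜ b := by
        have : ∀ c : I →₀ k, tensorFamily H.s B
            (TensorProduct.finsuppScalarLeft k B.carrier I (c ⊗ₜ b)) =
              Finsupp.linearCombination k H.s c ⊗ₜ b := by
          intro c
          induction c using Finsupp.induction_linear with
          | zero => simp
          | add c e hc he => rw [TensorProduct.add_tmul, map_add, map_add, hc, he, map_add,
              TensorProduct.add_tmul]
          | single α c => simp [TensorProduct.finsuppScalarLeft_apply_tmul, tensorFamily_single,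
              TensorProduct.smul_tmul']
        exact this _
      rw [e, opT_tmul, dT_tmul, dT_tmul, opT_tmul, ← TensorProduct.add_tmul,
        ← TensorProduct.add_tmul, ← H.decomp i hi x hx]
    · obtain rfl : j = 1 - i := by omega
      rw [hB i hi b hb]
      simp
  · simp
  · intro x y hx hy
    conv_lhs => rw [hx, hy]
    simp only [map_add]
    abel

/-- Families of elements of `m_B` are coordinates on the classes of cocycles in `(𝔤 ⊗ m_B)¹`,
when homotopy data are given in the degrees which contribute to `(𝔤 ⊗ m_B)¹`. -/
def HomotopyData.familiesEquiv [DirectSum.Decomposition 𝒢]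
    (hB : ∀ i ∉ D, ∀ b ∈ B.gr (1 - i), b = 0) :
    families deg B ≃ ↥(cocT A B) ⧸ cobT A B :=
  Equiv.ofBijective
    (fun β => (cobT A B).mkQ ⟨tensorFamily H.s B β.1, H.tensorFamily_mem β.2⟩) (by
      constructor
      · intro β β' h
        obtain ⟨w, -, hw⟩ := (mkQ_cobT_eq_iff _ _).1 h
        have h2 := congrArg (coordT H.p B) hw
        rw [H.coordT_dT, map_sub, H.coordT_tensorFamily, H.coordT_tensorFamily] at h2
        exact Subtype.ext (sub_eq_zero.1 h2.symm)
      · intro z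
        obtain ⟨z, rfl⟩ := (cobT A B).mkQ_surjective z
        refine ⟨⟨_, H.coordT_mem z.2.2⟩, ?_⟩
        refine Eq.symm ((mkQ_cobT_eq_iff _ _).2 ?_)
        have h := H.decompT hB z.2.2
        have hd : A.dT B z.1 = 0 := z.2.1
        rw [hd, map_zero, add_zero] at h
        have h' : z.1 - tensorFamily H.s B (coordT H.p B z.1) = A.dT B (opT H.h B z.1) :=
          sub_eq_of_eq_add' h
        exact h' ▸ Submodule.mem_map_of_mem
          (opT_mem_totDeg (e := -1) H.h_mem (by norm_num) z.2.2))

theorem HomotopyData.familiesEquiv_map [DirectSum.Decomposition 𝒢] {B' : GrArt k}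
    (hB : ∀ i ∉ D, ∀ b ∈ B.gr (1 - i), b = 0) (hB' : ∀ i ∉ D, ∀ b ∈ B'.gr (1 - i), b = 0)
    (f : B ⟶ B') (β : families deg B) :
    H.familiesEquiv hB' (families.map f β) = (DefLin A).map f (H.familiesEquiv hB β) :=
  congrArg (cobT A B').mkQ (Subtype.ext (tmap_tensorFamily H.s f β.1).symm)

end Families

/-! ### Ordered monomials in graded commuting elements -/

section OrderedMonomials

variable {I : Type*} [LinearOrder I] {R : Type*} [Ring R]

/-- The ordered monomial `∏ (b i) ^ (m i)`, with factors in increasing order of `i`. -/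
def ordProd (b : I → R) (m : I →₀ ℕ) : R := (((Finsupp.toMultiset m).sort).map b).prod

theorem ordProd_zero (b : I → R) : ordProd b 0 = 1 := by simp [ordProd]

theorem ordProd_add_single (b : I → R) {m : I →₀ ℕ} {i : I} (h : ∀ j ∈ m.support, j ≤ i) :
    ordProd b (m + Finsupp.single i 1) = ordProd b m * b i := by
  have e : (Finsupp.toMultiset (m + Finsupp.single i 1)).sort =
      (Finsupp.toMultiset m).sort ++ [i] := by
    refine List.Perm.eq_of_pairwise' (r := (· ≤ ·)) (Multiset.pairwise_sort _ _) ?_ ?_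
    · refine List.pairwise_append.2 ⟨Multiset.pairwise_sort _ _, by simp, fun a ha c hc => ?_⟩
      rw [Multiset.mem_sort, Finsupp.mem_toMultiset] at ha
      rw [List.mem_singleton.1 hc]
      exact h a ha
    · rw [← Multiset.coe_eq_coe, Multiset.sort_eq, ← Multiset.coe_add, Multiset.sort_eq, map_add,
        Finsupp.toMultiset_single, one_smul]
      rfl
  rw [ordProd, e, List.map_append, List.prod_append]
  simp [ordProd]

theorem ordProd_single (b : I → R) (i : I) : ordProd b (Finsupp.single i 1) = b i := by
  simpa [ordProd_zero] using ordProd_add_single b (m := 0) (i := i) (by simp)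

/-- Exponents are built by adding variables one at a time in increasing order. -/
theorem ordered_induction {p : (I →₀ ℕ) → Prop} (zero : p 0)
    (add : ∀ m i, (∀ j ∈ m.support, j ≤ i) → p m → p (m + Finsupp.single i 1)) (m : I →₀ ℕ) :
    p m := by
  classical
  induction m using Finsupp.induction_on_max₂ with
  | zero => exact zero
  | add_single i n m h _ ih =>
    clear * - ih h add
    induction n with
    | zero => simpa using ih
    | succ n ihn =>
      rw [Finsupp.single_add, ← add_assoc]
      refine add _ _ (fun j hj => ?_) ihn
      rcases Finset.mem_union.1 (Finsupp.support_add hj) with hj | hj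
      · exact (h j hj).le
      · exact (Finset.mem_singleton.1 (Finsupp.support_single_subset hj)).le

theorem map_ordProd {R' : Type*} [Ring R'] (φ : R →+* R') (b : I → R) (m : I →₀ ℕ) :
    φ (ordProd b m) = ordProd (fun i => φ (b i)) m := by
  rw [ordProd, map_list_prod, List.map_map]
  rfl

theorem signExp_eq_zero (deg : I → ℤ) {a c : I →₀ ℕ} (h : ∀ i ∈ a.support, ∀ j ∈ c.support, i ≤ j) :
    signExp deg a c = 0 := by
  unfold signExp
  exact Finset.sum_eq_zero fun i hi => Finset.sum_eq_zero fun j hj =>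
    if_neg (not_lt.2 (h i hi j hj))

theorem signExp_single_single (deg : I → ℤ) {i j : I} (h : j < i) :
    signExp deg (Finsupp.single i 1) (Finsupp.single j 1) = deg i * deg j := by
  simp [signExp, h]

variable {k : Type*} [Field k] [Algebra k R] {b : I → R} {deg : I → ℤ}

theorem ordProd_mul_single (hb : ∀ i j, b i * b j = sgn k (deg i * deg j) • (b j * b i))
    (a : I →₀ ℕ) (j : I) :
    ordProd b a * b j =
      sgn k (signExp deg a (Finsupp.single j 1)) • ordProd b (a + Finsupp.single j 1) := by
  induction a using ordered_induction with
  | zero => simp [ordProd_zero, signExp_zero_left, sgn_zero, ordProd_single]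
  | add a i h ih =>
    have hsupp : ∀ l ∈ (a + Finsupp.single i 1).support, l ≤ i := by
      classical
      intro l hl
      rcases Finset.mem_union.1 (Finsupp.support_add hl) with hl | hl
      · exact h l hl
      · exact (Finset.mem_singleton.1 (Finsupp.support_single_subset hl)).le
    rcases le_or_gt i j with hij | hij
    · rw [ordProd_add_single b fun l hl => (hsupp l hl).trans hij, signExp_eq_zero, sgn_zero,
        one_smul]
      intro l hl l' hl'
      rw [Finset.mem_singleton.1 (Finsupp.support_single_subset hl')]
      exact (hsupp l hl).trans hij
    · have hsupp' : ∀ l ∈ (a + Finsupp.single j 1).support, l ≤ i := by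
        classical
        intro l hl
        rcases Finset.mem_union.1 (Finsupp.support_add hl) with hl | hl
        · exact h l hl
        · exact (Finset.mem_singleton.1 (Finsupp.support_single_subset hl)).le.trans hij.le
      rw [ordProd_add_single b h, mul_assoc, hb i j, mul_smul_comm, ← mul_assoc, ih,
        smul_mul_assoc, ← ordProd_add_single b hsupp', smul_smul, signExp_add_left, sgn_add,
        signExp_single_single deg hij, mul_comm (sgn k _), add_right_comm]

/-- Ordered monomials in graded commuting elements multiply with the sign `signExp`. -/
theorem ordProd_mul (hb : ∀ i j, b i * b j = sgn k (deg i * deg j) • (b j * b i))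
    (a c : I →₀ ℕ) :
    ordProd b a * ordProd b c = sgn k (signExp deg a c) • ordProd b (a + c) := by
  induction c using ordered_induction with
  | zero => simp [ordProd_zero, signExp_zero_right, sgn_zero]
  | add c j h ih =>
    have h0 : signExp deg c (Finsupp.single j 1) = 0 := by
      refine signExp_eq_zero deg fun i hi l hl => ?_
      rw [Finset.mem_singleton.1 (Finsupp.support_single_subset hl)]
      exact h i hi
    rw [ordProd_add_single b h, ← mul_assoc, ih, smul_mul_assoc, ordProd_mul_single hb, smul_smul,
      signExp_add_left, h0, add_zero, signExp_add_right, sgn_add, add_assoc]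

theorem ordProd_add_eq_zero (hb : ∀ i j, b i * b j = sgn k (deg i * deg j) • (b j * b i))
    {a c : I →₀ ℕ} (h : ordProd b a * ordProd b c = 0) : ordProd b (a + c) = 0 := by
  rw [ordProd_mul hb] at h
  have h2 := congrArg (sgn k (signExp deg a c) • ·) h
  simpa only [smul_smul, sgn_mul_self, one_smul, smul_zero] using h2

theorem ordProd_eq_zero_of_apply_eq_zero
    (hb : ∀ i j, b i * b j = sgn k (deg i * deg j) • (b j * b i)) {m : I →₀ ℕ} {i : I}
    (hi : m i ≠ 0) (h : b i = 0) : ordProd b m = 0 := by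
  have e : m - Finsupp.single i 1 + Finsupp.single i 1 = m :=
    tsub_add_cancel_of_le (by simpa using Nat.one_le_iff_ne_zero.2 hi)
  rw [← e]
  exact ordProd_add_eq_zero hb (by rw [ordProd_single, h, mul_zero])

/-- Odd elements square to zero. -/
theorem ordProd_eq_zero_of_not_isSuper [CharZero k]
    (hb : ∀ i j, b i * b j = sgn k (deg i * deg j) • (b j * b i)) {m : I →₀ ℕ}
    (hm : ¬ IsSuper deg m) : ordProd b m = 0 := by
  simp only [IsSuper, not_forall, not_le] at hm
  obtain ⟨i, hi, h⟩ := hm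
  have hsq : b i * b i = 0 := by
    have h1 := hb i i
    rw [sgn_odd (hi.mul hi), neg_smul, one_smul, eq_neg_iff_add_eq_zero, ← two_smul k] at h1
    exact (smul_eq_zero.1 h1).resolve_left two_ne_zero
  have e : m - (Finsupp.single i 1 + Finsupp.single i 1) +
      (Finsupp.single i 1 + Finsupp.single i 1) = m := by
    refine tsub_add_cancel_of_le ?_
    rw [← Finsupp.single_add]
    simpa using Nat.succ_le_of_lt h
  rw [← e]
  refine ordProd_add_eq_zero hb ?_
  have h2 : ordProd b (Finsupp.single i 1 + Finsupp.single i 1) = 0 :=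
    ordProd_add_eq_zero hb (by rw [ordProd_single, hsq])
  rw [h2, mul_zero]

end OrderedMonomials

/-! ### Monomials in the power series algebra -/

section Monomials

variable {k : Type u} [Field k] {I : Type v} [LinearOrder I] {deg : I → ℤ}

namespace SuperPowerSeries

open Classical in
/-- The monomial `t^m`, which is zero unless `m` satisfies `IsSuper`. -/
def mono (k : Type u) [Field k] (deg : I → ℤ) (m : I →₀ ℕ) : SuperPowerSeries k deg :=
  fun n => if n.1 = m then 1 else 0

open Classical in
theorem coeff_mono {m n : I →₀ ℕ} (hn : IsSuper deg n) :
    coeff (mono k deg m) n = if n = m then 1 else 0 := by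
  rw [coeff_of _ hn]; rfl

theorem coeff_mono_of_ne {m n : I →₀ ℕ} (h : n ≠ m) : coeff (mono k deg m) n = 0 := by
  by_cases hn : IsSuper deg n
  · rw [coeff_mono hn, if_neg h]
  · rw [coeff_of_not _ hn]

theorem mono_zero : mono k deg 0 = 1 :=
  ext_coeff fun m hm => by rw [coeff_mono hm, coeff_one]

theorem mono_mul_mono {a c : I →₀ ℕ} (h : IsSuper deg (a + c)) :
    mono k deg a * mono k deg c = sgn k (signExp deg a c) • mono k deg (a + c) := by
  have ha : IsSuper deg a := h.of_le le_self_add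
  have hc : IsSuper deg c := h.of_le le_add_self
  refine ext_coeff fun m hm => ?_
  rw [coeff_mul _ _ hm, coeff_smul, coeff_mono hm]
  split_ifs with hmac
  · rw [Finset.sum_eq_single (a, c)]
    · rw [coeff_mono ha, coeff_mono hc, if_pos rfl, if_pos rfl, mul_one]
    · rintro ⟨p, q⟩ _ hne
      by_cases hp : p = a
      · rw [coeff_mono_of_ne (n := q), mul_zero, mul_zero]
        rintro rfl
        exact hne (by rw [hp])
      · rw [coeff_mono_of_ne hp, zero_mul, mul_zero]
    · intro hn
      exact absurd (Finset.HasAntidiagonal.mem_antidiagonal.2 hmac.symm) hn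
  · rw [mul_zero]
    refine Finset.sum_eq_zero ?_
    rintro ⟨p, q⟩ hpq
    rw [Finset.HasAntidiagonal.mem_antidiagonal] at hpq
    by_cases hp : p = a
    · rw [coeff_mono_of_ne (n := q), mul_zero, mul_zero]
      rintro rfl
      exact hmac (by rw [← hpq, hp])
    · rw [coeff_mono_of_ne hp, zero_mul, mul_zero]

/-- The coordinate `tᵢ`. -/
def X (k : Type u) [Field k] (deg : I → ℤ) (i : I) : SuperPowerSeries k deg :=
  mono k deg (Finsupp.single i 1)

theorem isSuper_single (i : I) : IsSuper deg (Finsupp.single i 1) := fun j _ => by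
  classical
  rw [Finsupp.single_apply]; split_ifs <;> simp

theorem ordProd_X {m : I →₀ ℕ} (hm : IsSuper deg m) : ordProd (X k deg) m = mono k deg m := by
  induction m using ordered_induction with
  | zero => rw [ordProd_zero, mono_zero]
  | add m i h ih =>
    rw [ordProd_add_single _ h, ih (hm.of_le le_self_add), X, mono_mul_mono hm, signExp_eq_zero,
      sgn_zero, one_smul]
    intro j hj l hl
    rw [Finset.mem_singleton.1 (Finsupp.support_single_subset hl)]
    exact h j hj

theorem isHomog_X (i : I) : IsHomog (X k deg i) (deg i) := by
  intro m hm
  have h : m = Finsupp.single i 1 := by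
    by_contra hne
    exact hm (coeff_mono_of_ne hne)
  simp [h]

theorem constCoeff_X (i : I) : constCoeff (X k deg i) = 0 :=
  coeff_mono_of_ne (n := 0) (by simp [eq_comm])

theorem coeff_sum {ι : Type*} (s : Finset ι) (f : ι → SuperPowerSeries k deg) (m : I →₀ ℕ) :
    coeff (∑ i ∈ s, f i) m = ∑ i ∈ s, coeff (f i) m := by
  classical
  induction s using Finset.induction_on with
  | empty => simp
  | insert a s ha ih => rw [Finset.sum_insert ha, Finset.sum_insert ha, coeff_add, ih]

theorem coeff_sub (f g : SuperPowerSeries k deg) (m : I →₀ ℕ) :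
    coeff (f - g) m = coeff f m - coeff g m := by
  have h := coeff_add (f - g) g m
  rw [sub_add_cancel] at h
  rw [h, add_sub_cancel_right]

theorem coeff_sum_mono (f : SuperPowerSeries k deg) (S : Finset (I →₀ ℕ)) {m : I →₀ ℕ}
    (hm : IsSuper deg m) (hmS : m ∈ S) :
    coeff (∑ n ∈ S, coeff f n • mono k deg n) m = coeff f m := by
  classical
  rw [coeff_sum, Finset.sum_eq_single m]
  · rw [coeff_smul, coeff_mono hm, if_pos rfl, mul_one]
  · intro n _ hne
    rw [coeff_smul, coeff_mono_of_ne hne.symm, mul_zero]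
  · exact fun h => absurd hmS h

end SuperPowerSeries

end Monomials

/-! ### Homomorphisms from the power series algebra to graded Artin algebras -/

section ProHoms

variable {k : Type u} [Field k] {I : Type v} [LinearOrder I] {deg : I → ℤ} {B : GrArt k}

namespace SuperPowerSeries.ProHom

/-- A continuous homomorphism to a discrete algebra depends on finitely many coefficients. -/
theorem exists_finset (φ : ProHom deg B) :
    ∃ S : Finset (I →₀ ℕ), ∀ f, (∀ m ∈ S, coeff f m = 0) → φ.hom f = 0 := by
  let tk : TopologicalSpace k := ⊥
  have hopen : @IsOpen _ (topology k deg) (φ.hom ⁻¹' {0}) :=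
    @IsOpen.preimage _ _ (topology k deg) ⊥ _ φ.cont _ trivial
  obtain ⟨U, hU, hpre⟩ := isOpen_induced_iff.1 hopen
  have h0 : coeff (0 : SuperPowerSeries k deg) ∈ U := by
    have : (0 : SuperPowerSeries k deg) ∈ coeff ⁻¹' U := by
      rw [hpre]
      exact map_zero φ.hom
    exact this
  obtain ⟨S, u, hu, hS⟩ := isOpen_pi_iff.1 hU _ h0
  refine ⟨S, fun f hf => ?_⟩
  have : f ∈ coeff ⁻¹' U := by
    refine hS fun m hm => ?_
    have := (hu m hm).2
    rwa [coeff_zero, ← hf m hm] at this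
  rw [hpre] at this
  exact this

theorem hom_X_mem (φ : ProHom deg B) (i : I) :
    φ.hom (X k deg i) ∈ B.gr (deg i) ∧ φ.hom (X k deg i) ∈ B.m :=
  ⟨φ.homog _ _ (isHomog_X i), φ.loc _ (constCoeff_X i)⟩

theorem finite_hom_X_ne_zero (φ : ProHom deg B) : {i | φ.hom (X k deg i) ≠ 0}.Finite := by
  obtain ⟨S, hS⟩ := φ.exists_finset
  have hinj : Function.Injective fun i : I => Finsupp.single i 1 :=
    Finsupp.single_left_injective (one_ne_zero (α := ℕ))
  refine (S.finite_toSet.preimage hinj.injOn).subset fun i hi => ?_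
  by_contra h
  refine hi (hS _ fun m hm => coeff_mono_of_ne ?_)
  rintro rfl
  exact h hm

/-- The images of the coordinates. -/
def toFamily (φ : ProHom deg B) : families deg B :=
  ⟨Finsupp.ofSupportFinite (fun i => φ.hom (X k deg i)) φ.finite_hom_X_ne_zero,
    fun i => φ.hom_X_mem i⟩

theorem toFamily_apply (φ : ProHom deg B) (i : I) : φ.toFamily.1 i = φ.hom (X k deg i) := rfl

theorem hom_eq_sum (φ : ProHom deg B) (f : SuperPowerSeries k deg) {S : Finset (I →₀ ℕ)}
    (hS : ∀ f, (∀ m ∈ S, coeff f m = 0) → φ.hom f = 0) :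
    φ.hom f = ∑ m ∈ S, coeff f m • ordProd (fun i => φ.hom (X k deg i)) m := by
  have h := hS (f - ∑ n ∈ S, coeff f n • mono k deg n) fun m hm => by
    by_cases hs : IsSuper deg m
    · rw [coeff_sub, coeff_sum_mono f S hs hm, sub_self]
    · rw [coeff_of_not _ hs]
  rw [map_sub, sub_eq_zero] at h
  rw [h, map_sum]
  refine Finset.sum_congr rfl fun m _ => ?_
  rw [map_smul]
  by_cases hs : IsSuper deg m
  · rw [← ordProd_X hs]
    exact congrArg _ (map_ordProd (φ.hom : SuperPowerSeries k deg →+* B.carrier) _ m)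
  · rw [coeff_of_not _ hs, zero_smul, zero_smul]

theorem toFamily_injective : Function.Injective (toFamily : ProHom deg B → families deg B) := by
  classical
  intro φ ψ h
  have hX : (fun i => φ.hom (X k deg i)) = fun i => ψ.hom (X k deg i) := by
    funext i
    rw [← toFamily_apply, h, toFamily_apply]
  obtain ⟨S, hS⟩ := φ.exists_finset
  obtain ⟨T, hT⟩ := ψ.exists_finset
  refine ProHom.ext' fun f => ?_
  rw [φ.hom_eq_sum f (S := S ∪ T) fun f hf => hS f fun m hm => hf m (Finset.mem_union_left _ hm),
    ψ.hom_eq_sum f (S := S ∪ T) fun f hf => hT f fun m hm => hf m (Finset.mem_union_right _ hm),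
    hX]

end SuperPowerSeries.ProHom

section Eval

variable (β : families deg B)

theorem families.comm (i j : I) : β.1 i * β.1 j = sgn k (deg i * deg j) • (β.1 j * β.1 i) :=
  B.comm _ _ _ (β.2 i).1 _ (β.2 j).1

theorem families.ordProd_mem_gr (m : I →₀ ℕ) :
    ordProd β.1 m ∈ B.gr (m.sum fun i x => (x : ℤ) * deg i) := by
  induction m using ordered_induction with
  | zero => rw [ordProd_zero, Finsupp.sum_zero_index]; exact SetLike.one_mem_graded _
  | add m i h ih =>
    rw [ordProd_add_single _ h, Finsupp.sum_add_index' (by simp) (by intros; push_cast; ring),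
      Finsupp.sum_single_index (by simp), Nat.cast_one, one_mul]
    exact SetLike.mul_mem_graded ih (β.2 i).1

theorem families.ordProd_mem_pow (m : I →₀ ℕ) : ordProd β.1 m ∈ B.m ^ m.degree := by
  induction m using ordered_induction with
  | zero => rw [ordProd_zero, map_zero, pow_zero]; exact Submodule.one_le.1 le_rfl
  | add m i h ih =>
    rw [ordProd_add_single _ h, map_add, Finsupp.degree_single, pow_succ]
    exact Submodule.mul_mem_mul ih (β.2 i).2

/-- Only finitely many monomials in the elements of a family are nonzero, because the family is
finitely supported and the maximal ideal is nilpotent. -/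
theorem families.finite_ordProd_ne_zero : {m | ordProd β.1 m ≠ 0}.Finite := by
  classical
  obtain ⟨N, hN⟩ := B.nilp
  refine (Set.finite_Iic (∑ i ∈ β.1.support, Finsupp.single i N)).subset fun m hm => ?_
  have hdeg : m.degree < N := by
    by_contra h
    obtain ⟨r, hr⟩ := Nat.exists_eq_add_of_le (not_lt.1 h)
    have h2 := families.ordProd_mem_pow β m
    rw [hr, pow_add, show B.m ^ N = ⊥ from hN, Submodule.bot_mul, Submodule.mem_bot] at h2
    exact hm h2
  intro i
  rw [Finsupp.finsetSum_apply]
  by_cases hi : m i = 0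
  · rw [hi]; exact Nat.zero_le _
  · have hβ : i ∈ β.1.support := by
      rw [Finsupp.mem_support_iff]
      exact fun h => hm (ordProd_eq_zero_of_apply_eq_zero (families.comm β) hi h)
    refine (Finsupp.le_degree i m).trans (hdeg.le.trans ?_)
    refine le_trans ?_ (Finset.single_le_sum (f := fun j => (Finsupp.single j N : I →₀ ℕ) i)
      (fun _ _ => Nat.zero_le _) hβ)
    simp

/-- The finite set of exponents of nonzero monomials in a family. -/
def families.exponents : Finset (I →₀ ℕ) := (families.finite_ordProd_ne_zero β).toFinset

theorem families.mem_exponents {m : I →₀ ℕ} : m ∈ families.exponents β ↔ ordProd β.1 m ≠ 0 := by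
  simp [families.exponents]

/-- The value of a power series at a family. -/
def families.eval (f : SuperPowerSeries k deg) : B.carrier :=
  ∑ m ∈ families.exponents β, coeff f m • ordProd β.1 m

theorem families.eval_mul [CharZero k] (f g : SuperPowerSeries k deg) :
    families.eval β (f * g) = families.eval β f * families.eval β g := by
  classical
  set S := families.exponents β with hS
  let F : (I →₀ ℕ) × (I →₀ ℕ) → B.carrier := fun p =>
    (sgn k (signExp deg p.1 p.2) * (coeff f p.1 * coeff g p.2)) • ordProd β.1 (p.1 + p.2)
  have hF : ∀ a c, (coeff f a • ordProd β.1 a) * (coeff g c • ordProd β.1 c) = F (a, c) := by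
    intro a c
    rw [smul_mul_smul_comm, ordProd_mul (families.comm β), smul_smul, mul_comm (_ * _)]
  have hR : families.eval β f * families.eval β g = ∑ p ∈ S ×ˢ S, F p := by
    rw [families.eval, families.eval, Finset.sum_mul_sum, ← Finset.sum_product']
    exact Finset.sum_congr rfl fun p _ => hF p.1 p.2
  have hsub : ∑ p ∈ S ×ˢ S with p.1 + p.2 ∈ S, F p = ∑ p ∈ S ×ˢ S, F p := by
    refine Finset.sum_filter_of_ne fun p _ hp => ?_
    rw [families.mem_exponents]
    exact fun h => hp (by simp only [F, h, smul_zero])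
  have hmaps : ∀ p ∈ {p ∈ S ×ˢ S | p.1 + p.2 ∈ S}, p.1 + p.2 ∈ S := fun p hp =>
    (Finset.mem_filter.1 hp).2
  rw [hR, ← hsub, ← Finset.sum_fiberwise_of_maps_to hmaps, families.eval]
  refine Finset.sum_congr rfl fun m hm => ?_
  have hm0 := (families.mem_exponents β).1 hm
  have hsup : IsSuper deg m := by
    by_contra h
    exact hm0 (ordProd_eq_zero_of_not_isSuper (families.comm β) h)
  rw [coeff_mul _ _ hsup, Finset.sum_smul]
  have e : ∀ p ∈ Finset.HasAntidiagonal.antidiagonal m,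
      (sgn k (signExp deg p.1 p.2) * (coeff f p.1 * coeff g p.2)) • ordProd β.1 m = F p := by
    intro p hp
    simp only [F, Finset.HasAntidiagonal.mem_antidiagonal.1 hp]
  rw [Finset.sum_congr rfl e]
  refine (Finset.sum_subset (fun p hp => ?_) fun p hp hp' => ?_).symm
  · simp only [Finset.mem_filter] at hp
    exact Finset.HasAntidiagonal.mem_antidiagonal.2 hp.2
  · have hpm := Finset.HasAntidiagonal.mem_antidiagonal.1 hp
    -- the product of the two monomials is the nonzero monomial of exponent `m`, up to sign
    have hne : ordProd β.1 p.1 * ordProd β.1 p.2 ≠ 0 := fun h =>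
      hm0 (hpm ▸ ordProd_add_eq_zero (families.comm β) h)
    refine absurd ?_ hp'
    simp only [Finset.mem_filter, Finset.mem_product]
    refine ⟨⟨⟨?_, ?_⟩, hpm ▸ hm⟩, hpm⟩
    · exact (families.mem_exponents β).2 (left_ne_zero_of_mul hne)
    · exact (families.mem_exponents β).2 (right_ne_zero_of_mul hne)

theorem families.eval_mono {m : I →₀ ℕ} (hm : IsSuper deg m) :
    families.eval β (mono k deg m) = ordProd β.1 m := by
  classical
  rw [families.eval, Finset.sum_eq_single m]
  · rw [coeff_mono hm, if_pos rfl, one_smul]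
  · intro n _ hne
    rw [coeff_mono_of_ne hne, zero_smul]
  · intro h
    rw [families.mem_exponents, not_not] at h
    rw [h, smul_zero]

/-- Evaluation of power series at a family, as an algebra homomorphism. -/
def families.evalHom [CharZero k] : SuperPowerSeries k deg →ₐ[k] B.carrier :=
  AlgHom.ofLinearMap
    { toFun := families.eval β
      map_add' := fun f g => by
        simp only [families.eval, coeff_add, add_smul, Finset.sum_add_distrib]
      map_smul' := fun c f => by
        simp only [families.eval, coeff_smul, mul_smul, Finset.smul_sum, RingHom.id_apply] }
    (by
      change families.eval β 1 = 1
      rw [← mono_zero, families.eval_mono β isSuper_zero, ordProd_zero])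
    (families.eval_mul β)

/-- The continuous homomorphism given by evaluation at a family. -/
def families.toProHom [CharZero k] : ProHom deg B where
  hom := families.evalHom β
  cont := by
    let tk : TopologicalSpace k := ⊥
    have : DiscreteTopology k := ⟨rfl⟩
    let tB : TopologicalSpace B.carrier := ⊥
    have : DiscreteTopology B.carrier := ⟨rfl⟩
    let := topology k deg
    have h : Continuous fun c : (I →₀ ℕ) → k =>
        ∑ m ∈ families.exponents β, c m • ordProd β.1 m :=
      continuous_finsetSum _ fun m _ =>
        (continuous_of_discreteTopology (f := fun x : k => x • ordProd β.1 m)).comp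
          (continuous_apply m)
    exact h.comp continuous_induced_dom
  homog n f hf := by
    refine sum_mem fun m _ => ?_
    by_cases h : coeff f m = 0
    · rw [h, zero_smul]; exact zero_mem _
    · exact Submodule.smul_mem _ _ (hf m h ▸ families.ordProd_mem_gr β m)
  loc f hf := by
    refine sum_mem fun m _ => ?_
    by_cases h : m = 0
    · rw [h, show coeff f 0 = 0 from hf, zero_smul]; exact zero_mem _
    · refine Submodule.smul_mem _ _ ?_
      obtain ⟨r, hr⟩ := Nat.exists_eq_succ_of_ne_zero
        (fun h0 => h ((Finsupp.degree_eq_zero_iff m).1 h0))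
      have := families.ordProd_mem_pow β m
      rw [hr, pow_succ] at this
      exact B.m_mul_le _ this

/-- Local continuous homomorphisms from `k[[t_I]]` correspond to the images of the coordinates. -/
def proHomEquiv [CharZero k] (deg : I → ℤ) (B : GrArt k) : ProHom deg B ≃ families deg B :=
  Equiv.ofBijective ProHom.toFamily ⟨ProHom.toFamily_injective, fun β =>
    ⟨families.toProHom β, by
      refine Subtype.ext (Finsupp.ext fun i => ?_)
      rw [ProHom.toFamily_apply]
      change families.eval β (mono k deg (Finsupp.single i 1)) = _
      rw [families.eval_mono β (isSuper_single i), ordProd_single]⟩⟩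

theorem proHomEquiv_map [CharZero k] {B' : GrArt k} (f : B ⟶ B') (φ : ProHom deg B) :
    proHomEquiv deg B' ((proFunctor k deg).map f φ) = families.map f (proHomEquiv deg B φ) :=
  Subtype.ext (Finsupp.ext fun _ => rfl)

end Eval

end ProHoms

/-! ### The completion of the algebra of convergent power series -/

section Completion

namespace SuperPowerSeries

variable {k : Type u} [Field k] {I : Type v} [LinearOrder I] {deg : I → ℤ}
  (v : AbsoluteValue k ℝ)

/-- `f` and `g` have the same coefficients in degrees less than `n`. -/
def AgreeBelow (n : ℕ) (f g : SuperPowerSeries k deg) : Prop :=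
  ∀ m : I →₀ ℕ, m.degree < n → coeff f m = coeff g m

theorem AgreeBelow.mul {n : ℕ} {f f' g g' : SuperPowerSeries k deg} (hf : AgreeBelow n f f')
    (hg : AgreeBelow n g g') : AgreeBelow n (f * g) (f' * g') := by
  intro m hm
  by_cases h : IsSuper deg m
  · rw [coeff_mul _ _ h, coeff_mul _ _ h]
    refine Finset.sum_congr rfl fun p hp => ?_
    have hd := congrArg Finsupp.degree (Finset.HasAntidiagonal.mem_antidiagonal.1 hp)
    rw [map_add] at hd
    rw [hf _ (by omega), hg _ (by omega)]
  · rw [coeff_of_not _ h, coeff_of_not _ h]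

theorem agreeBelow_mul_zero {a b : ℕ} {f g : SuperPowerSeries k deg} (hf : AgreeBelow a f 0)
    (hg : AgreeBelow b g 0) : AgreeBelow (a + b) (f * g) 0 := by
  intro m hm
  rw [coeff_zero]
  by_cases h : IsSuper deg m
  · rw [coeff_mul _ _ h]
    refine Finset.sum_eq_zero fun p hp => ?_
    have hd := congrArg Finsupp.degree (Finset.HasAntidiagonal.mem_antidiagonal.1 hp)
    rw [map_add] at hd
    rcases lt_or_ge p.1.degree a with h1 | h1
    · rw [hf _ h1, coeff_zero, zero_mul, mul_zero]
    · rw [hg p.2 (by omega), coeff_zero, mul_zero, mul_zero]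
  · rw [coeff_of_not _ h]

theorem agreeBelow_sub_zero_iff {n : ℕ} {f g : SuperPowerSeries k deg} :
    AgreeBelow n (f - g) 0 ↔ AgreeBelow n f g :=
  forall₂_congr fun m _ => by rw [coeff_sub, coeff_zero, sub_eq_zero]

/-- The ideal of convergent power series of order at least `n`. -/
def orderIdeal (deg : I → ℤ) (n : ℕ) : Ideal (convergent v deg) where
  carrier := {x | AgreeBelow n x.1 0}
  add_mem' {x y} hx hy m hm := by
    change coeff (x.1 + y.1) m = _
    rw [coeff_add, hx m hm, hy m hm, coeff_zero, add_zero]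
  zero_mem' _ _ := rfl
  smul_mem' c x hx := by
    have h : AgreeBelow (0 + n) (c.1 * x.1) 0 := agreeBelow_mul_zero (by intro m hm; omega) hx
    rwa [zero_add] at h

theorem isConvergent_of_finite {f : SuperPowerSeries k deg} (h : {m | coeff f m ≠ 0}.Finite) :
    IsConvergent v f := by
  refine ⟨1, one_pos, ∑ m ∈ h.toFinset, v (coeff f m), fun m => ?_⟩
  rw [one_pow, mul_one]
  by_cases hm : coeff f m = 0
  · rw [hm, map_zero]
    exact Finset.sum_nonneg fun _ _ => v.nonneg _
  · exact Finset.single_le_sum (f := fun m => v (coeff f m)) (fun _ _ => v.nonneg _)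
      (h.mem_toFinset.2 hm)

theorem isConvergent_X (i : I) : IsConvergent v (X k deg i) := by
  refine isConvergent_of_finite v ((Set.finite_singleton (Finsupp.single i 1)).subset ?_)
  intro m hm
  by_contra hne
  exact hm (coeff_mono_of_ne hne)

theorem coeff_X_mul (i : I) (g : SuperPowerSeries k deg) {q : I →₀ ℕ}
    (hq : IsSuper deg (Finsupp.single i 1 + q)) :
    coeff (X k deg i * g) (Finsupp.single i 1 + q) =
      sgn k (signExp deg (Finsupp.single i 1) q) * coeff g q := by
  have hmem : (Finsupp.single i 1, q) ∈
      Finset.HasAntidiagonal.antidiagonal (Finsupp.single i 1 + q) := by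
    rw [Finset.HasAntidiagonal.mem_antidiagonal]
  rw [coeff_mul _ _ hq, Finset.sum_eq_single (Finsupp.single i 1, q)]
  · rw [X, coeff_mono (isSuper_single i), if_pos rfl, one_mul]
  · rintro ⟨a, c⟩ hac hne
    rw [X, coeff_mono_of_ne (n := a), zero_mul, mul_zero]
    rintro rfl
    rw [Finset.HasAntidiagonal.mem_antidiagonal] at hac
    have hc : c = q := add_left_cancel hac
    exact hne (by rw [hc])
  · exact fun h => absurd hmem h

theorem coeff_X_mul_of_eq_zero (i : I) (g : SuperPowerSeries k deg) {m : I →₀ ℕ} (hm : m i = 0) :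
    coeff (X k deg i * g) m = 0 := by
  by_cases h : IsSuper deg m
  · rw [coeff_mul _ _ h]
    refine Finset.sum_eq_zero fun p hp => ?_
    rw [X, coeff_mono_of_ne (n := p.1), zero_mul, mul_zero]
    intro hp1
    have h2 := DFunLike.congr_fun (Finset.HasAntidiagonal.mem_antidiagonal.1 hp) i
    rw [hp1, Finsupp.add_apply, Finsupp.single_eq_same, hm] at h2
    omega
  · rw [coeff_of_not _ h]

open Classical in
/-- The quotient by `tᵢ` of the part of `f` consisting of the monomials with first variable
`tᵢ`. -/
def quotX (f : SuperPowerSeries k deg) (i : I) : SuperPowerSeries k deg := fun q =>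
  if ∀ j ∈ q.1.support, i ≤ j then coeff f (Finsupp.single i 1 + q.1) else 0

theorem coeff_quotX (f : SuperPowerSeries k deg) (i : I) {q : I →₀ ℕ} (hq : IsSuper deg q)
    (h : ∀ j ∈ q.support, i ≤ j) : coeff (quotX f i) q = coeff f (Finsupp.single i 1 + q) := by
  rw [coeff_of _ hq, quotX, if_pos h]

theorem coeff_quotX_of_not (f : SuperPowerSeries k deg) (i : I) {q : I →₀ ℕ}
    (h : ¬ ∀ j ∈ q.support, i ≤ j) : coeff (quotX f i) q = 0 := by
  by_cases hq : IsSuper deg q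
  · rw [coeff_of _ hq, quotX, if_neg h]
  · rw [coeff_of_not _ hq]

theorem coeff_quotX_eq_or (f : SuperPowerSeries k deg) (i : I) (q : I →₀ ℕ) :
    coeff (quotX f i) q = coeff f (Finsupp.single i 1 + q) ∨ coeff (quotX f i) q = 0 := by
  by_cases hq : IsSuper deg q
  · by_cases h : ∀ j ∈ q.support, i ≤ j
    · exact Or.inl (coeff_quotX f i hq h)
    · exact Or.inr (coeff_quotX_of_not f i h)
  · exact Or.inr (coeff_of_not _ hq)

theorem isConvergent_quotX {f : SuperPowerSeries k deg} (hf : IsConvergent v f) (i : I) :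
    IsConvergent v (quotX f i) := by
  obtain ⟨r, hr, C, hC⟩ := hf
  refine ⟨r, hr, C / r, fun q => ?_⟩
  rw [le_div_iff₀ hr, mul_assoc, ← pow_succ]
  rcases coeff_quotX_eq_or f i q with h | h
  · have h2 := hC (Finsupp.single i 1 + q)
    rwa [map_add, Finsupp.degree_single, add_comm 1, ← h] at h2
  · rw [h, map_zero, zero_mul]
    exact le_trans (by positivity) (hC 0)

/-- A power series without constant term is the sum of the products `tᵢ gᵢ`, where `tᵢ gᵢ` collects
its monomials with first variable `tᵢ`; no signs occur. -/
theorem eq_sum_X_mul_quotX [Fintype I] {f : SuperPowerSeries k deg} (h0 : coeff f 0 = 0) :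
    f = ∑ i, X k deg i * quotX f i := by
  refine ext_coeff fun m hm => ?_
  rw [coeff_sum]
  by_cases hm0 : m = 0
  · rw [hm0, h0]
    exact (Finset.sum_eq_zero fun i _ => coeff_X_mul_of_eq_zero _ _ rfl).symm
  have hne : m.support.Nonempty := Finsupp.support_nonempty_iff.2 hm0
  set i₀ := m.support.min' hne with hi₀
  have hsub : ∀ i, m i ≠ 0 → Finsupp.single i 1 + (m - Finsupp.single i 1) = m := fun i hi =>
    add_tsub_cancel_of_le (by simpa using Nat.one_le_iff_ne_zero.2 hi)
  have hmi₀ : m i₀ ≠ 0 := Finsupp.mem_support_iff.1 (m.support.min'_mem hne)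
  rw [Finset.sum_eq_single i₀]
  · have hle : ∀ j ∈ (m - Finsupp.single i₀ 1).support, i₀ ≤ j := fun j hj => by
      refine m.support.min'_le j ?_
      rw [Finsupp.mem_support_iff] at hj ⊢
      rw [Finsupp.tsub_apply] at hj
      omega
    have e := hsub i₀ hmi₀
    conv_rhs => rw [← e]
    rw [coeff_X_mul _ _ (by rwa [e]), coeff_quotX f i₀ (hm.of_le tsub_le_self) hle, e,
      signExp_eq_zero, sgn_zero, one_mul]
    intro j hj l hl
    rw [Finset.mem_singleton.1 (Finsupp.support_single_subset hj)]
    exact hle l hl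
  · intro i _ hi
    by_cases hmi : m i = 0
    · exact coeff_X_mul_of_eq_zero i _ hmi
    · have e := hsub i hmi
      conv_lhs => rw [← e]
      rw [coeff_X_mul _ _ (by rwa [e]), coeff_quotX_of_not, mul_zero]
      intro hall
      have hlt : i₀ < i := lt_of_le_of_ne
        (m.support.min'_le i (Finsupp.mem_support_iff.2 hmi)) (Ne.symm hi)
      refine absurd (hall i₀ ?_) (not_le.2 hlt)
      rw [Finsupp.mem_support_iff, Finsupp.tsub_apply, Finsupp.single_eq_of_ne hlt.ne, tsub_zero]
      exact hmi₀
  · exact fun h => absurd (Finset.mem_univ _) h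

/-- For finitely many variables, the powers of the maximal ideal of the algebra of convergent power
series are given by the order of vanishing. -/
theorem convergentIdeal_pow [Finite I] (n : ℕ) : convergentIdeal v deg ^ n = orderIdeal v deg n := by
  have := Fintype.ofFinite I
  induction n with
  | zero =>
    rw [Submodule.pow_zero, Ideal.one_eq_top, eq_comm, Ideal.eq_top_iff_one]
    intro m hm
    omega
  | succ n ih =>
    rw [Ideal.IsTwoSided.pow_succ, ih]
    refine le_antisymm (Ideal.mul_le.2 fun x hx y hy => ?_) fun x hx => ?_
    · have hx1 : AgreeBelow 1 x.1 0 := fun m hm => by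
        rw [(Finsupp.degree_eq_zero_iff m).1 (by omega), coeff_zero]
        exact hx
      rw [add_comm]
      exact agreeBelow_mul_zero hx1 hy
    · have hx0 : coeff x.1 0 = 0 := (hx 0 (by simp)).trans (coeff_zero 0)
      have e : x = ∑ i, (⟨X k deg i, isConvergent_X v i⟩ : convergent v deg) *
          ⟨quotX x.1 i, isConvergent_quotX v x.2 i⟩ := by
        refine Subtype.ext ?_
        rw [AddSubmonoidClass.coe_finsetSum]
        exact eq_sum_X_mul_quotX hx0
      rw [e]
      refine sum_mem fun i _ => Ideal.mul_mem_mul (constCoeff_X i) fun q hq => ?_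
      rcases coeff_quotX_eq_or x.1 i q with h | h
      · change coeff (quotX x.1 i) q = _
        rw [h, coeff_zero, ← coeff_zero (Finsupp.single i 1 + q)]
        exact hx _ (by rw [map_add, Finsupp.degree_single]; omega)
      · exact h.trans (coeff_zero q).symm

open Classical in
/-- The truncation of a power series to the degrees less than `n`. -/
def trunc (n : ℕ) (f : SuperPowerSeries k deg) : SuperPowerSeries k deg := fun m =>
  if m.1.degree < n then coeff f m.1 else 0

theorem coeff_trunc {n : ℕ} (f : SuperPowerSeries k deg) (m : I →₀ ℕ) :
    coeff (trunc n f) m = if m.degree < n then coeff f m else 0 := by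
  by_cases h : IsSuper deg m
  · rw [coeff_of _ h]; rfl
  · rw [coeff_of_not _ h, coeff_of_not _ h, ite_self]

theorem trunc_agreeBelow (n : ℕ) (f : SuperPowerSeries k deg) : AgreeBelow n (trunc n f) f :=
  fun m hm => by rw [coeff_trunc, if_pos hm]

theorem isConvergent_trunc [Finite I] (n : ℕ) (f : SuperPowerSeries k deg) :
    IsConvergent v (trunc n f) := by
  refine isConvergent_of_finite v ((Finsupp.finite_of_degree_le n).subset fun m hm => ?_)
  by_contra h
  refine hm ?_
  rw [coeff_trunc, if_neg]
  exact fun h2 => h h2.le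

variable (deg) in
/-- For finitely many variables, the algebra of formal power series is the completion of the
algebra of convergent ones: a formal power series is the sequence of its truncations. -/
theorem isCompletion_convergentIncl [Finite I] :
    IsCompletion (convergentIncl v deg) (convergentIdeal v deg) := by
  let J := convergentIdeal v deg
  have hmk : ∀ (n : ℕ) (x y : convergent v deg),
      Ideal.Quotient.mk (J ^ n) x = Ideal.Quotient.mk (J ^ n) y ↔ AgreeBelow n x.1 y.1 := by
    intro n x y
    rw [Ideal.Quotient.mk_eq_mk_iff_sub_mem, convergentIdeal_pow, ← agreeBelow_sub_zero_iff]
    rfl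
  let T : ℕ → SuperPowerSeries k deg → convergent v deg := fun n f =>
    ⟨trunc n f, isConvergent_trunc v n f⟩
  have hT : ∀ n f, AgreeBelow n (T n f).1 f := trunc_agreeBelow
  let F : SuperPowerSeries k deg →+* ∀ n : ℕ, convergent v deg ⧸ J ^ n :=
    { toFun := fun f n => Ideal.Quotient.mk (J ^ n) (T n f)
      map_one' := funext fun n => by
        rw [Pi.one_apply, ← map_one (Ideal.Quotient.mk (J ^ n)), hmk]
        exact hT n 1
      map_mul' := fun f g => funext fun n => by
        rw [Pi.mul_apply, ← map_mul (Ideal.Quotient.mk (J ^ n)), hmk]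
        exact fun m hm => (hT n _ m hm).trans
          (((hT n f).mul (hT n g)) m hm).symm
      map_zero' := funext fun n => by
        rw [Pi.zero_apply, ← map_zero (Ideal.Quotient.mk (J ^ n)), hmk]
        exact hT n 0
      map_add' := fun f g => funext fun n => by
        rw [Pi.add_apply, ← map_add (Ideal.Quotient.mk (J ^ n)), hmk]
        intro m hm
        change coeff (T n (f + g)).1 m = coeff ((T n f).1 + (T n g).1) m
        rw [hT n _ m hm, coeff_add, coeff_add, hT n _ m hm, hT n _ m hm] }
  have hF : ∀ f, F f ∈ adicLimit J := fun f n => by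
    change Ideal.Quotient.factor _ (Ideal.Quotient.mk _ (T (n + 1) f)) =
      Ideal.Quotient.mk _ (T n f)
    rw [Ideal.Quotient.factor_mk, hmk]
    intro m hm
    rw [hT n f m hm, hT (n + 1) f m (by omega)]
  have hbij : Function.Bijective (F.codRestrict (adicLimit J) hF) := by
    constructor
    · intro f g hfg
      refine ext_coeff fun m _ => ?_
      have h : Ideal.Quotient.mk (J ^ (m.degree + 1)) (T _ f) = Ideal.Quotient.mk _ (T _ g) :=
        congrFun (congrArg Subtype.val hfg) (m.degree + 1)
      have h2 := (hmk _ _ _).1 h m (by omega)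
      rwa [hT _ f m (by omega), hT _ g m (by omega)] at h2
    · intro s
      choose r hr using fun n => Ideal.Quotient.mk_surjective (s.1 n)
      have hstep : ∀ n, AgreeBelow n (r (n + 1)).1 (r n).1 := fun n => by
        rw [← hmk, hr, ← s.2 n, ← hr (n + 1), Ideal.Quotient.factor_mk]
      have hle : ∀ n l, AgreeBelow n (r (n + l)).1 (r n).1 := fun n l => by
        induction l with
        | zero => exact fun m _ => rfl
        | succ l ih => exact fun m hm => (hstep (n + l) m (by omega)).trans (ih m hm)
      let f : SuperPowerSeries k deg := fun m => coeff (r (m.1.degree + 1)).1 m.1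
      refine ⟨f, Subtype.ext (funext fun n => ?_)⟩
      rw [← hr n]
      refine (hmk n _ _).2 fun m hm => (hT n f m hm).trans ?_
      by_cases h : IsSuper deg m
      · rw [coeff_of _ h]
        obtain ⟨l, rfl⟩ := Nat.exists_eq_add_of_le (Nat.succ_le_of_lt hm)
        exact (hle (m.degree + 1) l m (by omega)).symm
      · rw [coeff_of_not _ h, coeff_of_not _ h]
  refine ⟨RingEquiv.ofBijective _ hbij, fun x => Subtype.ext (funext fun n => ?_)⟩
  exact (hmk n _ _).2 (hT n x.1)

end SuperPowerSeries

end Completion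

/-! ### Pro-representability and slices -/

section ProRepresentability

variable {k : Type u} [Field k] {G : Type v} [AddCommGroup G] [Module k G]
  {𝒢 : ℤ → Submodule k G} [DirectSum.Decomposition 𝒢]

/-- The linear functor is pro-represented by formal power series in the coordinates of homotopy
data, on Artin algebras for which only the degrees in `D` contribute. -/
def proIsoDefLin [CharZero k] {A : DGLA 𝒢} {I : Type v} [LinearOrder I] {deg : I → ℤ} {D : Set ℤ}
    (H : HomotopyData A deg D) {𝒞 : Type*} [Category 𝒞] (E : 𝒞 ⥤ GrArt k)
    (hE : ∀ X, ∀ i ∉ D, ∀ b ∈ (E.obj X).gr (1 - i), b = 0) :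
    E ⋙ proFunctor k deg ≅ E ⋙ DefLin A :=
  NatIso.ofComponents
    (fun X => ((proHomEquiv deg (E.obj X)).trans (H.familiesEquiv (hE X))).toIso) fun {X Y} f => by
      ext φ
      exact (congrArg (H.familiesEquiv (hE Y)) (proHomEquiv_map (E.map f) φ)).trans
        (H.familiesEquiv_map (hE X) (hE Y) (E.map f) _)

theorem DGLA.exists_homotopyData_coordDeg (A : DGLA 𝒢) (ι : ℤ → Type v)
    (b : ∀ i, Module.Basis (ι i) k (A.coh i)) :
    Nonempty (HomotopyData A (DGLA.coordDeg ι) Set.univ) := by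
  have e : ∀ i, Function.Bijective
      (fun x => ⟨⟨i, x⟩, rfl⟩ : ι i → {α : Σ i, ι i // DGLA.coordDeg ι α = 1 - i}) := by
    intro i
    constructor
    · intro x y h
      exact sigma_mk_injective (congrArg Subtype.val h)
    · rintro ⟨⟨j, x⟩, h⟩
      obtain rfl : j = i := by simpa [DGLA.coordDeg] using h
      exact ⟨x, rfl⟩
  exact A.exists_homotopyData _ _ (fun i _ => (b i).reindex (Equiv.ofBijective _ (e i)))
    fun _ => trivial

theorem DGLA.exists_homotopyData_one (A : DGLA 𝒢) {J : Type v} (b : Module.Basis J k (A.coh 1)) :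
    Nonempty (HomotopyData A (fun _ : J => (0 : ℤ)) {1}) := by
  refine A.exists_homotopyData _ _ (fun i hi => ?_) (by simp)
  obtain rfl : i = 1 := hi
  exact b.reindex (Equiv.subtypeUnivEquiv (p := fun _ => (0 : ℤ) = 1 - 1) fun _ => by norm_num).symm

theorem eq_zero_of_mem_gr_of_concentrated {B : GrArt k} (hB : concentrated k B) {j : ℤ}
    (hj : j ≠ 0) {b : B.carrier} (hb : b ∈ B.gr j) : b = 0 := by
  by_contra h
  have h0 : b ∈ B.gr 0 := by rw [show B.gr 0 = ⊤ from hB]; trivial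
  exact hj (DirectSum.degree_eq_of_mem_mem B.gr hb h0 h)

/-! ### The slice form of the deformation functor -/

/-- The projection of `𝔤` to a complement `C` of the coboundaries in `𝔤¹`, with a primitive `ν x` of
the remaining part of `x ∈ 𝔤¹`. -/
theorem DGLA.exists_slice_projection (A : DGLA 𝒢) {C : Submodule k G}
    (hd : Disjoint C ((𝒢 0).map A.d)) (hs : C ⊔ (𝒢 0).map A.d = 𝒢 1) :
    ∃ π ν : G →ₗ[k] G, (∀ i, ∀ x ∈ 𝒢 i, π x ∈ 𝒢 i) ∧ (∀ i, ∀ x ∈ 𝒢 i, π x ∈ C) ∧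
      (∀ x ∈ C, π x = x) ∧ (∀ x, π (A.d x) = 0) ∧
      (∀ i, ∀ x ∈ 𝒢 i, ν x ∈ 𝒢 (i - 1)) ∧ ∀ x ∈ 𝒢 1, x - π x = A.d (ν x) := by
  obtain ⟨τ, hτ, hdτ⟩ := A.exists_pseudo_inverse
  obtain ⟨W, hW, hWC⟩ := hd.symm.exists_isCompl
  have hC : C ≤ 𝒢 1 := hs ▸ le_sup_left
  let P : G →ₗ[k] G := C.subtype ∘ₗ Submodule.projectionOnto C W hWC.symm
  have hPC : ∀ x, P x ∈ C := fun x => (Submodule.projectionOnto C W hWC.symm x).2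
  have hPid : ∀ x ∈ C, P x = x := fun x hx =>
    congrArg Subtype.val (Submodule.projectionOnto_apply_left hWC.symm ⟨x, hx⟩)
  have hPd : ∀ x ∈ 𝒢 0, P (A.d x) = 0 := fun x hx => by
    have : A.d x ∈ W := hW (Submodule.mem_map_of_mem hx)
    simp only [P, LinearMap.comp_apply, Submodule.projectionOnto_apply_of_mem_right hWC.symm this,
      map_zero]
  let π : G →ₗ[k] G := ofComponents 𝒢 fun i => if i = 1 then P ∘ₗ (𝒢 i).subtype else 0
  have hπ : ∀ x ∈ 𝒢 1, π x = P x := fun x hx => by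
    simp only [π, ofComponents_of_mem _ hx, if_pos]; rfl
  have hπ0 : ∀ i, i ≠ 1 → ∀ x ∈ 𝒢 i, π x = 0 := fun i hi x hx => by
    simp only [π, ofComponents_of_mem _ hx, if_neg hi]; rfl
  have hπmem : ∀ i, ∀ x ∈ 𝒢 i, π x ∈ 𝒢 i := fun i x hx => by
    by_cases hi : i = 1
    · subst hi; rw [hπ x hx]; exact hC (hPC x)
    · rw [hπ0 i hi x hx]; exact zero_mem _
  refine ⟨π, τ ∘ₗ (LinearMap.id - π), hπmem, ?_, ?_, ?_, ?_, ?_⟩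
  · intro i x hx
    by_cases hi : i = 1
    · subst hi; rw [hπ x hx]; exact hPC x
    · rw [hπ0 i hi x hx]; exact zero_mem _
  · intro x hx
    rw [hπ x (hC hx), hPid x hx]
  · intro x
    induction x using DirectSum.Decomposition.inductionOn 𝒢 with
    | zero => simp
    | @homogeneous i x =>
      by_cases hi : i = 0
      · subst hi
        rw [hπ _ (A.d_mem 0 x x.2), hPd x x.2]
      · exact hπ0 (i + 1) (by omega) _ (A.d_mem i x x.2)
    | add x y hx hy => rw [map_add, map_add, hx, hy, add_zero]
  · intro i x hx
    exact hτ i _ (sub_mem hx (hπmem i x hx))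
  · intro x hx
    have hx' := hx
    rw [← hs] at hx'
    obtain ⟨c, hc, _, ⟨w, hw, rfl⟩, rfl⟩ := Submodule.mem_sup.1 hx'
    have e : c + A.d w - π (c + A.d w) = A.d w := by
      rw [hπ _ hx, map_add, hPid c hc, hPd w hw]
      abel
    change _ = A.d (τ (c + A.d w - π (c + A.d w)))
    rw [e, hdτ]

theorem opT_eq_self {π : G →ₗ[k] G} {C : Submodule k G} (h : ∀ x ∈ C, π x = x) {B : GrArt k}
    {z : G ⊗[k] B.carrier} (hz : z ∈ tensorM C B) : opT π B z = z := by
  have hle : tensorM C B ≤ LinearMap.eqLocus (opT π B) LinearMap.id := by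
    refine Submodule.span_le.2 ?_
    rintro _ ⟨x, hx, b, -, rfl⟩
    change opT π B (x ⊗ₜ b) = x ⊗ₜ b
    rw [opT_tmul, h x hx]
  exact hle hz

theorem opT_mem_tensorM {π : G →ₗ[k] G} {C : Submodule k G} (h : ∀ i, ∀ x ∈ 𝒢 i, π x ∈ C)
    {B : GrArt k} {n : ℤ} {z : G ⊗[k] B.carrier} (hz : z ∈ totDeg 𝒢 B n) :
    opT π B z ∈ tensorM C B := by
  refine totDeg_induction (p := fun z => opT π B z ∈ tensorM C B) ?_ ?_ ?_ hz
  · intro i j x b _ hx _ hb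
    exact Submodule.subset_span ⟨π x, h i x hx, b, hb, rfl⟩
  · rw [map_zero]; exact zero_mem _
  · intro x y hx hy; rw [map_add]; exact add_mem hx hy

theorem opT_comp (π κ : G →ₗ[k] G) (B : GrArt k) (z : G ⊗[k] B.carrier) :
    opT (π ∘ₗ κ) B z = opT π B (opT κ B z) := by
  simp [opT, LinearMap.rTensor_comp]

theorem opT_straighten {A : DGLA 𝒢} (π κ : G →ₗ[k] G) {B : GrArt k} {Γ : G ⊗[k] B.carrier}
    (h : opT π B Γ = Γ) :
    opT π B (straighten A κ B Γ) = straighten A (π ∘ₗ κ) B Γ := by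
  rw [straighten, map_add, map_smul, h, straighten, opT_comp]

/-- On Artin algebras in degree zero, every cohomology class contains the straightening of exactly
one Maurer-Cartan element in the slice `C ⊗ m_B`: projecting to the slice turns the condition into
the fixed point problem for the operator `π η`. -/
theorem slice_bijective [CharZero k] {A : DGLA 𝒢} {η : G →ₗ[k] G}
    (hη : ∀ i, ∀ x ∈ 𝒢 i, η x ∈ 𝒢 (i - 1)) {C : Submodule k G}
    (hd : Disjoint C ((𝒢 0).map A.d)) (hs : C ⊔ (𝒢 0).map A.d = 𝒢 1) {B : GrArt k}
    (hB : concentrated k B) :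
    Function.Bijective fun Γ : {Γ : MC A η B // Γ.1 ∈ tensorM C B} =>
      (cobT A B).mkQ (MC.cocycle hη Γ.1) := by
  obtain ⟨π, ν, hπ, hπC, hπid, hπd, hν, hπν⟩ := A.exists_slice_projection hd hs
  have hκ : ∀ i, ∀ x ∈ 𝒢 i, (π ∘ₗ η) x ∈ 𝒢 (i - 1) := fun i x hx => hπ _ _ (hη i x hx)
  have hπdT : ∀ z : G ⊗[k] B.carrier, opT π B (A.dT B z) = 0 := fun z => by
    induction z using TensorProduct.induction_on with
    | zero => simp
    | tmul x b => rw [dT_tmul, opT_tmul, hπd, TensorProduct.zero_tmul]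
    | add x y hx hy => rw [map_add, map_add, hx, hy, add_zero]
  constructor
  · intro Γ Γ' h
    obtain ⟨w, -, hw⟩ := (mkQ_cobT_eq_iff _ _).1 h
    have h2 := congrArg (opT π B) hw
    rw [hπdT, map_sub] at h2
    have h3 := sub_eq_zero.1 h2.symm
    simp only [MC.cocycle] at h3
    rw [opT_straighten π η (opT_eq_self hπid Γ.2), opT_straighten π η (opT_eq_self hπid Γ'.2)] at h3
    exact Subtype.ext (Subtype.ext (straighten_inj hκ Γ.1.2.1 Γ'.1.2.1 h3))
  · intro z
    obtain ⟨z, rfl⟩ := (cobT A B).mkQ_surjective z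
    have hπ' : ∀ i, ∀ x ∈ 𝒢 i, π x ∈ 𝒢 (i + 0) := fun i x hx => by simpa using hπ i x hx
    obtain ⟨Γ, hΓ, h⟩ := exists_straighten_eq (A := A) hκ
      (opT_mem_totDeg (n' := 1) hπ' (by norm_num) z.2.2)
    have hΓC : Γ ∈ tensorM C B := by
      have e : Γ = opT π B (z.1 - (2 : k)⁻¹ • opT η B (A.brT B Γ Γ)) := by
        rw [map_sub, map_smul, ← opT_comp, ← h, straighten, add_sub_cancel_right]
      rw [e]
      exact opT_mem_tensorM hπC (sub_mem z.2.2
        (Submodule.smul_mem _ _ (opT_brT_mem_totDeg A hη (n'' := 1) (by norm_num) hΓ hΓ)))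
    -- on `(𝔤 ⊗ m_B)¹ = 𝔤¹ ⊗ m_B` the kernel of the projection consists of coboundaries
    have hprim : ∀ u ∈ totDeg 𝒢 B 1, u - opT π B u = A.dT B (opT ν B u) := fun u hu => by
      refine totDeg_induction (p := fun u => u - opT π B u = A.dT B (opT ν B u)) ?_ ?_ ?_ hu
      · intro i j x b hij hx hb _
        by_cases hj : j = 0
        · obtain rfl : i = 1 := by omega
          rw [opT_tmul, opT_tmul, dT_tmul, ← hπν x hx, TensorProduct.sub_tmul]
        · rw [eq_zero_of_mem_gr_of_concentrated hB hj hb]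
          simp
      · simp
      · intro x y hx hy
        rw [map_add, add_sub_add_comm, hx, hy, map_add, map_add]
    set u := straighten A η B Γ - z.1 with hu
    have hum : u ∈ totDeg 𝒢 B 1 := sub_mem (straighten_mem hη hΓ) z.2.2
    have hπu : opT π B u = 0 := by
      rw [hu, map_sub, opT_straighten π η (opT_eq_self hπid hΓC), h, sub_self]
    have hue := hprim u hum
    rw [hπu, sub_zero] at hue
    have hz : A.dT B z.1 = 0 := z.2.1
    have hmc : IsMC A η B Γ := (isMC_iff hη).2 ⟨hΓ, by
      rw [← sub_add_cancel (straighten A η B Γ) z.1, ← hu, map_add, hz, hue, dT_dT, add_zero]⟩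
    refine ⟨⟨⟨Γ, hmc⟩, hΓC⟩, (mkQ_cobT_eq_iff _ _).2 ?_⟩
    change u ∈ _
    rw [hue]
    exact Submodule.mem_map_of_mem (opT_mem_totDeg (e := -1) hν (by norm_num) hum)

/-- The slice form of the deformation functor is isomorphic to the linear functor. -/
def sliceIsoDefLin [CharZero k] (A : DGLA 𝒢) {η : G →ₗ[k] G}
    (hη : ∀ i, ∀ x ∈ 𝒢 i, η x ∈ 𝒢 (i - 1)) {C : Submodule k G}
    (hd : Disjoint C ((𝒢 0).map A.d)) (hs : C ⊔ (𝒢 0).map A.d = 𝒢 1) :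
    MDef0Slice A η C ≅ (concentrated k).ι ⋙ DefLin A :=
  NatIso.ofComponents
    (fun B => (Equiv.ofBijective _ (slice_bijective hη hd hs B.property)).toIso) fun f => by
      ext Γ
      exact congrArg (cobT A _).mkQ (Subtype.ext (tmap_straighten A _ Γ.1.1).symm)

end ProRepresentability

end

end FormalDef

theorem corollary3p3 {k : Type u} [Field k] [CharZero k]
    {G : Type v} [AddCommGroup G] [Module k G]
    (𝒢 : ℤ → Submodule k G) [DirectSum.Decomposition 𝒢] (A : DGLA 𝒢)
    (η : G →ₗ[k] G) (hη : ∀ i, ∀ x ∈ 𝒢 i, η x ∈ 𝒢 (i - 1)) :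
    -- the modified deformation functor is equivalent to the linear functor
    Nonempty (MDefZ A η ≅ DefLin A) ∧
    -- both are pro-represented by the formal power series on `H^*(𝔤)[1]`
    (∀ (ι : ℤ → Type v) [LinearOrder (Σ i, ι i)] (_ : ∀ i, Module.Basis (ι i) k (A.coh i)),
      Nonempty (DefLin A ≅ SuperPowerSeries.proFunctor k (DGLA.coordDeg ι)) ∧
      Nonempty (MDefZ A η ≅ SuperPowerSeries.proFunctor k (DGLA.coordDeg ι)) ∧
      -- and this algebra is the completion of the analytic germ at the origin
      (Finite (Σ i, ι i) → ∀ v : AbsoluteValue k ℝ,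
        IsCompletion (SuperPowerSeries.convergentIncl v (DGLA.coordDeg ι))
          (SuperPowerSeries.convergentIdeal v (DGLA.coordDeg ι)))) ∧
    -- the functor on algebras in degree zero is pro-represented by formal power series on `H^1(𝔤)`,
    -- with gauge classes as well as with a complement to the coboundaries
    (∀ (J : Type v) [LinearOrder J] (_ : Module.Basis J k (A.coh 1)),
      Nonempty (MDef0 A η ≅
        (concentrated k).ι ⋙ SuperPowerSeries.proFunctor k (fun _ : J => 0)) ∧
      ∀ C : Submodule k G, Disjoint C ((𝒢 0).map A.d) → C ⊔ (𝒢 0).map A.d = 𝒢 1 →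
        Nonempty (MDef0Slice A η C ≅
          (concentrated k).ι ⋙ SuperPowerSeries.proFunctor k (fun _ : J => 0))) := by
  have iso : MDefZ A η ≅ DefLin A := mdefIsoDefLin A hη
  refine ⟨⟨iso⟩, fun ι _ b => ?_, fun J _ b => ?_⟩
  · obtain ⟨H⟩ := A.exists_homotopyData_coordDeg ι b
    have lin : DefLin A ≅ SuperPowerSeries.proFunctor k (DGLA.coordDeg ι) :=
      (proIsoDefLin H (𝟭 (GrArt k)) fun _ _ hi => absurd trivial hi).symm
    exact ⟨⟨lin⟩, ⟨iso ≪≫ lin⟩, fun _ v =>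
      SuperPowerSeries.isCompletion_convergentIncl (DGLA.coordDeg ι) v⟩
  · obtain ⟨H⟩ := A.exists_homotopyData_one b
    have lin : (concentrated k).ι ⋙ DefLin A ≅
        (concentrated k).ι ⋙ SuperPowerSeries.proFunctor k (fun _ : J => 0) :=
      (proIsoDefLin H (concentrated k).ι fun B i hi _ hb =>
        eq_zero_of_mem_gr_of_concentrated B.property
          (fun h => hi (sub_eq_zero.1 h).symm) hb).symm
    exact ⟨⟨Functor.isoWhiskerLeft _ iso ≪≫ lin⟩, fun C hd hs => ⟨sliceIsoDefLin A hη hd hs ≪≫ lin⟩⟩
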